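/- **J-reflection groups.** For integers $k,n,m\ge 2$ let $J(k,n,m)=\langle s,t,u\mid s^k=t^n=u^m=1,\ stu=tus=ust\rangle$. Let $k,b,n,c,m$ be positive integers with $k,\,bn,\,cm\ge 2$ and $\gcd(n,m)=1$. The J-reflection group $W=W_b^c(k,bn,cm)$ is the normal closure of $\{s,t^n,u^m\}$ in $J(k,bn,cm)$. Its set of reflections $R(W)$ consists of the conjugates in $J(k,bn,cm)$ of the non-trivial powers of $s$, $t^n$ or $u^m$. Two J-reflection groups $W_1,W_2$ are *isomorphic in reflection* if there is a group isomorphism $W_1\to W_2$ mapping $R(W_1)$ onto $R(W_2)$. **Braid groups.** Write $m=qn+r$ with $q\ge 0$ and $0\le r\le n-1$. Let $\mathcal B_*^*(n,m)$ be the group with generators $x_1,\dots,x_n,y,z$ and relations, where $\delta=x_1\cdots x_n y$, $$x_1\cdots x_n\,y\,z=z\,x_1\cdots x_n\,y, \tag{a}$$ $$x_{i+1}\cdots x_n\,yz\,\delta^{q-1}x_1\cdots x_{i+r}=x_i\cdots x_n\,yz\,\delta^{q-1}x_1\cdots x_{i+r-1}\qquad(1\le i\le n-r), \tag{b}$$ $$x_{i+1}\cdots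 x_n\,yz\,\delta^{q}x_1\cdots x_{i+r-n}=x_i\cdots x_n\,yz\,\delta^{q}x_1\cdots x_{i+r-n-1}\qquad(n-r+1\le i\le n). \tag{c}$$ Let $\mathcal B_*(n,m)$ be the group with generators $x_1,\dots,x_n,y$ whose relations are (b), (c) with the letter $z$ deleted. Let $\mathcal B^*(n,m)$ be the group with generators $x_1,\dots,x_n,z$ whose relations are (a), (b), (c) with the letter $y$ deleted (so $\delta=x_1\cdots x_n$). Let $$\mathcal B(n,m)=\langle x_1,\dots,x_n\mid x_i\cdots x_{i+m-1}=x_j\cdots x_{j+m-1}\ \ (1\le i<j\le n)\rangle,$$ with indices taken modulo $n$. The braid group $\mathcal B(W)$ associated to $W=W_b^c(k,bn,cm)$ is $\mathcal B_*^*(n,m)$ if $b,c\ge 2$; $\mathcal B_*(n,m)$ if $b\ge2$ and $c=1$; $\mathcal B^*(n,m)$ if $b=1$ and $c\ge 2$; and $\mathcal B(n,m)$ if $b=c=1$. **Theorem.** Let $W_1=W_{b_1}^{c_1}(k_1,b_1n_1,c_1m_1)$ and $W_2=W_{b_2}^{c_2}(k_2,b_2n_2,c_2m_2)$ be J-reflection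 groups. If $W_1$ and $W_2$ are isomorphic in reflection, then the groups $\mathcal B(W_1)$ and $\mathcal B(W_2)$ are isomorphic. -/

import Mathlib

namespace JBraid

/-! ## J-groups and their reflections -/

/-- The three canonical generators of `J(k, n, m)`. -/
inductive JGen : Type
  | s
  | t
  | u

/-- The relators of `J(k, n, m) = ⟨ s, t, u | s^k = t^n = u^m = 1, stu = tus = ust ⟩`. -/
def jRels (k n m : ℕ) : Set (FreeGroup JGen) :=
  let s := FreeGroup.of JGen.s
  let t := FreeGroup.of JGen.t
  let u := FreeGroup.of JGen.u
  {s ^ k, t ^ n, u ^ m, (s * t * u) * (t * u * s)⁻¹, (t * u * s) * (u * s * t)⁻¹}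

/-- The group `J(k, n, m)`. -/
abbrev J (k n m : ℕ) : Type := PresentedGroup (jRels k n m)

namespace J

/-- The canonical generator `s` of `J(k, n, m)`. -/
def s (k n m : ℕ) : J k n m := PresentedGroup.of JGen.s

/-- The canonical generator `t` of `J(k, n, m)`. -/
def t (k n m : ℕ) : J k n m := PresentedGroup.of JGen.t

/-- The canonical generator `u` of `J(k, n, m)`. -/
def u (k n m : ℕ) : J k n m := PresentedGroup.of JGen.u

/-- The set `{s^{k'}, t^{n'}, u^{m'}}` in `J(k, n, m)`. -/
def basic (k n m k' n' m' : ℕ) : Set (J k n m) :=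
  {s k n m ^ k', t k n m ^ n', u k n m ^ m'}

end J

/-- The J-group with columns `(k, k')`, `(n, n')`, `(m, m')`: the normal closure of
`{s^{k'}, t^{n'}, u^{m'}}` in `J(k, n, m)`. -/
def jGroup (k n m k' n' m' : ℕ) : Subgroup (J k n m) :=
  Subgroup.normalClosure (J.basic k n m k' n' m')

/-- The set `R(H)` of algebraic reflections of the J-group `H`: the conjugates in `J(k, n, m)` of
the non-trivial powers of `s^{k'}`, `t^{n'}`, `u^{m'}` (they all lie in `H`). -/
def reflections (k n m k' n' m' : ℕ) : Set (jGroup k n m k' n' m') :=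
  {h | ∃ g : J k n m, ∃ a ∈ J.basic k n m k' n' m', ∃ e : ℤ,
    a ^ e ≠ 1 ∧ (h : J k n m) = g * a ^ e * g⁻¹}

/-! ## J-reflection groups -/

/-- The parameters of a J-reflection group `W_b^c(k, bn, cm)`. The parameters `b, n, c, m` are
positive since `bn` and `cm` are at least `2`. -/
structure JReflectionData where
  k : ℕ
  b : ℕ
  n : ℕ
  c : ℕ
  m : ℕ
  two_le_k : 2 ≤ k
  two_le_bn : 2 ≤ b * n
  two_le_cm : 2 ≤ c * m
  coprime : Nat.Coprime n m

namespace JReflectionData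

/-- The J-reflection group `W_b^c(k, bn, cm)`, that is, the J-group with columns
`(k, 1)`, `(bn, n)`, `(cm, m)`. -/
abbrev W (P : JReflectionData) : Subgroup (J P.k (P.b * P.n) (P.c * P.m)) :=
  jGroup P.k (P.b * P.n) (P.c * P.m) 1 P.n P.m

/-- The algebraic reflections of `W_b^c(k, bn, cm)`. -/
abbrev R (P : JReflectionData) : Set P.W :=
  reflections P.k (P.b * P.n) (P.c * P.m) 1 P.n P.m

/-- Two J-reflection groups are isomorphic in reflection if there is a group isomorphism between
them that sends the set of reflections of the first onto that of the second. -/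
def IsomorphicInReflection (P₁ P₂ : JReflectionData) : Prop :=
  ∃ f : P₁.W ≃* P₂.W, f '' P₁.R = P₂.R

end JReflectionData

/-! ## Braid groups

Indices are shifted by one: `x i` stands for `x_{i+1}`. -/

section Words

variable {G : Type} [Group G]

/-- The word `x_{a+1} x_{a+2} ⋯ x_b` (empty if `b ≤ a`). -/
def seg (x : ℕ → G) (a b : ℕ) : G :=
  ((List.Ico a b).map x).prod

/-- The relator of `x_1 ⋯ x_n y z = z x_1 ⋯ x_n y`. -/
def commRel (n : ℕ) (x : ℕ → G) (y z : G) : G :=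
  (seg x 0 n * y * z) * (z * seg x 0 n * y)⁻¹

/-- With `δ = x_1 ⋯ x_n y`, `q = ⌊m / n⌋` and `r = m - qn`, the relators of
`x_{i+1} ⋯ x_n y z δ^{q-1} x_1 ⋯ x_{i+r} = x_i ⋯ x_n y z δ^{q-1} x_1 ⋯ x_{i+r-1}`
for `1 ≤ i ≤ n - r`, and of
`x_{i+1} ⋯ x_n y z δ^q x_1 ⋯ x_{i+r-n} = x_i ⋯ x_n y z δ^q x_1 ⋯ x_{i+r-n-1}`
for `n - r + 1 ≤ i ≤ n`. In the code, `j` is `i - 1`, so that `0 ≤ j < n`. -/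
def slideRels (n m : ℕ) (x : ℕ → G) (y z : G) : Set G :=
  let q := m / n
  let r := m % n
  let δ := seg x 0 n * y
  {w | ∃ j : ℕ, j + r < n ∧
    w = (seg x (j + 1) n * y * z * δ ^ ((q : ℤ) - 1) * seg x 0 (j + 1 + r)) *
        (seg x j n * y * z * δ ^ ((q : ℤ) - 1) * seg x 0 (j + r))⁻¹} ∪
  {w | ∃ j : ℕ, n ≤ j + r ∧ j < n ∧
    w = (seg x (j + 1) n * y * z * δ ^ q * seg x 0 (j + 1 + r - n)) *
        (seg x j n * y * z * δ ^ q * seg x 0 (j + r - n))⁻¹}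

end Words

/-- Generators `x_1, …, x_n, y, z`. -/
inductive GenXYZ (n : ℕ) : Type
  | x (i : Fin n)
  | y
  | z

/-- Generators `x_1, …, x_n, y`. -/
inductive GenXY (n : ℕ) : Type
  | x (i : Fin n)
  | y

/-- Generators `x_1, …, x_n, z`. -/
inductive GenXZ (n : ℕ) : Type
  | x (i : Fin n)
  | z

/-- Generators `x_1, …, x_n`. -/
inductive GenX (n : ℕ) : Type
  | x (i : Fin n)

/-- The sequence of letters `x_1, …, x_n` in a free group, as a function on `ℕ` (it is only
evaluated at arguments below `n`). -/
def letters {α : Type} {n : ℕ} (x : Fin n → α) (i : ℕ) : FreeGroup α :=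
  if h : i < n then FreeGroup.of (x ⟨i, h⟩) else 1

/-- The group `𝓑_*^*(n, m)` on the generators `x_1, …, x_n, y, z`. -/
abbrev BBoth (n m : ℕ) : Type :=
  PresentedGroup
    ({commRel n (letters GenXYZ.x) (FreeGroup.of (GenXYZ.y : GenXYZ n)) (FreeGroup.of GenXYZ.z)} ∪
      slideRels n m (letters GenXYZ.x) (FreeGroup.of (GenXYZ.y : GenXYZ n)) (FreeGroup.of GenXYZ.z))

/-- The group `𝓑_*(n, m)` on the generators `x_1, …, x_n, y`: the letter `z` is dropped from the
relations. -/
abbrev BLower (n m : ℕ) : Type :=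
  PresentedGroup (slideRels n m (letters GenXY.x) (FreeGroup.of (GenXY.y : GenXY n)) 1)

/-- The group `𝓑^*(n, m)` on the generators `x_1, …, x_n, z`: the letter `y` is dropped from the
relations. -/
abbrev BUpper (n m : ℕ) : Type :=
  PresentedGroup
    ({commRel n (letters GenXZ.x) 1 (FreeGroup.of (GenXZ.z : GenXZ n))} ∪
      slideRels n m (letters GenXZ.x) 1 (FreeGroup.of (GenXZ.z : GenXZ n)))

/-- The word `x_i x_{i+1} ⋯ x_{i+m-1}` with `i = j + 1` and indices taken modulo `n`. -/
def cyclicWord (n m j : ℕ) : FreeGroup (GenX n) :=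
  ((List.range m).map fun l => letters GenX.x ((j + l) % n)).prod

/-- The group `𝓑(n, m)`: generators `x_1, …, x_n` and relations
`x_i ⋯ x_{i+m-1} = x_j ⋯ x_{j+m-1}` for `1 ≤ i < j ≤ n`, with indices modulo `n`. -/
abbrev BToric (n m : ℕ) : Type :=
  PresentedGroup {w : FreeGroup (GenX n) | ∃ i j : ℕ, i < j ∧ j < n ∧
    w = cyclicWord n m i * (cyclicWord n m j)⁻¹}

/-- The braid group associated to the J-reflection group `W_b^c(k, bn, cm)`. It is given by one of
four presentations, according to which of `b` and `c` are equal to `1`. -/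
noncomputable def JReflectionData.braidGroup (P : JReflectionData) : GrpCat.{0} :=
  if P.b = 1 then
    if P.c = 1 then GrpCat.of (BToric P.n P.m) else GrpCat.of (BUpper P.n P.m)
  else
    if P.c = 1 then GrpCat.of (BLower P.n P.m) else GrpCat.of (BBoth P.n P.m)

end JBraid

/-! Each braid group retains very little of its parameters, and what it retains can be read off by
counting representations of `W`.

Braid side. In a group satisfying (a)-(c), extend x_1, ..., x_n to a sequence over ℤ by X_{a+n} = y
X_a y⁻¹. The slide relations amount to an element D₀ (`shiftElt`) that commutes with y and shifts
the sequence by -m under conjugation. As n and m are coprime, βn = αm + 1 for some α, β; then T =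
D₀^α y^β shifts by one and h = D₀^n y^m is central. In terms of s = x_1, T and h, the relations
become y = T^n h^{-α} and z = h^β (sT)^{-m}. Hence 𝓑_*^* is F₂ × ℤ, 𝓑_* is ⟨T, w | w^m central⟩, 𝓑^*
is ⟨c, w | w^n central⟩, and 𝓑, by a periodic version of the argument, is ⟨a, b | a^n = b^m⟩ (the
four `nonempty_B..._mulEquiv`). It is therefore enough to recover which of b, c equal 1, up to
exchange, together with nothing, m, n or {n, m} respectively.

Reflection side. An isomorphism in reflection permutes the non-empty classes of reflections (those
of s, t^n, u^m) and preserves their orders (`exists_image_cls`, `ord_eq_of_image`), which settles b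
and c. For n and m, count the d-dimensional representations of `W` in which the class of s acts by
rank one perturbations of the identity with no common fixed vector, while a chosen set of
reflections acts trivially. The element δ = stu is central, J = W⟨δ⟩, and δ^i lies in W only for nm
∣ i; so each such representation has exactly nm extensions to J, one for each value λ of the scalar
by which δ acts. By a rigidity argument in the style of Levelt (`exists_equiv_mulX`), an extension
is determined by the characteristic polynomials of t and st together with λ. The eigenvalues are d
distinct a-th roots of unity for t and d distinct m-th roots of unity for u⁻¹, and the determinant
of s leaves d(k-1) values of λ. Thus `reflCount_mul`: nm times the count is C(a,d) C(m,d) d(k-1),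
with a = n or a = bn according to whether the class of t is killed. Dimensions 2 and 3 give enough
equations to finish. -/

namespace JBraid

/-! ### Products of consecutive letters and transport of the relators -/

section SegLemmas

variable {G H : Type} [Group G] [Group H]

lemma seg_mul_seg (x : ℕ → G) {a b c : ℕ} (hab : a ≤ b) (hbc : b ≤ c) :
    seg x a b * seg x b c = seg x a c := by
  unfold seg
  rw [← List.Ico.append_consecutive hab hbc, List.map_append, List.prod_append]

lemma seg_self (x : ℕ → G) (a : ℕ) : seg x a a = 1 := by
  simp [seg]

lemma seg_succ (x : ℕ → G) {a b : ℕ} (hab : a ≤ b) :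
    seg x a (b + 1) = seg x a b * x b := by
  rw [← seg_mul_seg x hab (Nat.le_succ b)]
  simp [seg, List.Ico.succ_singleton]

lemma seg_eq (x : ℕ → G) {a b : ℕ} (hab : a ≤ b) :
    seg x a b = (seg x 0 a)⁻¹ * seg x 0 b := by
  rw [← seg_mul_seg x (Nat.zero_le a) hab, inv_mul_cancel_left]

lemma map_seg (φ : G →* H) (x : ℕ → G) (a b : ℕ) :
    φ (seg x a b) = seg (fun i => φ (x i)) a b := by
  simp [seg, map_list_prod, Function.comp_def]

lemma map_commRel (φ : G →* H) (n : ℕ) (x : ℕ → G) (y z : G) :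
    φ (commRel n x y z) = commRel n (fun i => φ (x i)) (φ y) (φ z) := by
  simp [commRel, map_seg]

lemma map_mem_slideRels (φ : G →* H) {n m : ℕ} {x : ℕ → G} {y z w : G}
    (hw : w ∈ slideRels n m x y z) :
    φ w ∈ slideRels n m (fun i => φ (x i)) (φ y) (φ z) := by
  rcases hw with ⟨j, hj, rfl⟩ | ⟨j, hj, hj', rfl⟩
  · exact Or.inl ⟨j, hj, by simp [map_seg]⟩
  · exact Or.inr ⟨j, hj, hj', by simp [map_seg]⟩

lemma mem_slideRels_of_map (φ : G →* H) {n m : ℕ} {x : ℕ → G} {y z : G} {w : H}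
    (hw : w ∈ slideRels n m (fun i => φ (x i)) (φ y) (φ z)) :
    ∃ v ∈ slideRels n m x y z, φ v = w := by
  rcases hw with ⟨j, hj, rfl⟩ | ⟨j, hj, hj', rfl⟩
  · exact ⟨_, Or.inl ⟨j, hj, rfl⟩, by simp [map_seg]⟩
  · exact ⟨_, Or.inr ⟨j, hj, hj', rfl⟩, by simp [map_seg]⟩

/-- The product telescopes: between two consecutive conjugates only one factor `T` survives, and `T
^ i` is left over at the end. -/
lemma seg_conj_pow {n : ℕ} {x : ℕ → G} {s T : G}
    (hx : ∀ j < n, x j = T ^ j * s * (T ^ j)⁻¹) {i : ℕ} (hi : i ≤ n) :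
    seg x 0 i = (s * T) ^ i * (T ^ i)⁻¹ := by
  induction i with
  | zero => simp [seg_self]
  | succ i ih =>
    rw [seg_succ x (Nat.zero_le i), ih (by omega), hx i (by omega), pow_succ, pow_succ]
    group

end SegLemmas

/-! ### The shift hidden in the slide relations -/

section SlideStructure

variable {G : Type} [Group G]

/-- The element `D₀`, which shifts the sequence of conjugates of the generators by `-m`. -/
def shiftElt (n m : ℕ) (x : ℕ → G) (y z : G) : G :=
  z * (seg x 0 n * y) ^ (m / n) * seg x 0 (m % n) * (y ^ (m / n))⁻¹

variable {n m : ℕ} {x : ℕ → G} {y z : G}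

/-- Write P_i = x_1 ⋯ x_i, so that x_{i+1} ⋯ x_n = P_i⁻¹ P_n. Since δ commutes with z, both sides of
(b) have the form P_i⁻¹ z δ^q P_{i+r}; the relation says that this expression does not depend on i,
and i = 0 gives its value. -/
lemma slide_lower (hc : commRel n x y z = 1)
    (hs : ∀ w ∈ slideRels n m x y z, w = 1) {i : ℕ} (hi : i + m % n ≤ n) :
    z * (seg x 0 n * y) ^ (m / n) * seg x 0 (i + m % n) =
      seg x 0 i * (z * (seg x 0 n * y) ^ (m / n) * seg x 0 (m % n)) := by
  have hcz : seg x 0 n * y * z = z * (seg x 0 n * y) := by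
    rw [commRel, mul_inv_eq_one] at hc
    rw [hc, mul_assoc]
  induction i with
  | zero => simp [seg_self]
  | succ j ih =>
    have h := hs _ (Or.inl ⟨j, by omega, rfl⟩)
    rw [mul_inv_eq_one, seg_eq x (show j + 1 ≤ n by omega), seg_eq x (show j ≤ n by omega)] at h
    have ih' := ih (by omega)
    have e : ∀ g g' : G, g⁻¹ * seg x 0 n * y * z * (seg x 0 n * y) ^ (((m / n : ℕ) : ℤ) - 1) * g'
        = g⁻¹ * (z * (seg x 0 n * y) ^ (m / n) * g') := by
      intro g g'
      have : g⁻¹ * seg x 0 n * y * z = g⁻¹ * (seg x 0 n * y * z) := by group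
      rw [this, hcz]
      generalize seg x 0 n * y = δ
      group
    rw [e, e, ih', inv_mul_cancel_left] at h
    rw [← h, mul_inv_cancel_left]

/-- As in `slide_lower`, relation (c) makes P_i⁻¹ z δ^{q+1} P_{i+r-n} constant. The two ranges meet
at i = n - r, where P_{i+r} = P_n and the extra factor y completes one more δ. -/
lemma slide_upper (hn : 0 < n) (hc : commRel n x y z = 1)
    (hs : ∀ w ∈ slideRels n m x y z, w = 1) {i : ℕ} (hi : n ≤ i + m % n) (hin : i ≤ n) :
    z * (seg x 0 n * y) ^ (m / n + 1) * seg x 0 (i + m % n - n) =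
      seg x 0 i * (z * (seg x 0 n * y) ^ (m / n) * seg x 0 (m % n)) * y := by
  have hcz : seg x 0 n * y * z = z * (seg x 0 n * y) := by
    rw [commRel, mul_inv_eq_one] at hc
    rw [hc, mul_assoc]
  have hr : m % n < n := Nat.mod_lt _ hn
  obtain ⟨l, rfl⟩ : ∃ l, i = n - m % n + l := ⟨i - (n - m % n), by omega⟩
  induction l with
  | zero =>
    have h := slide_lower (m := m) (i := n - m % n) hc hs (by omega)
    rw [show n - m % n + m % n = n by omega] at h
    rw [show n - m % n + 0 = n - m % n from rfl, ← h, Nat.sub_add_cancel hr.le, Nat.sub_self, seg_self, pow_succ]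
    group
  | succ l ih =>
    have h := hs _ (Or.inr ⟨n - m % n + l, by omega, by omega, rfl⟩)
    rw [mul_inv_eq_one, seg_eq x (show n - m % n + l + 1 ≤ n by omega),
      seg_eq x (show n - m % n + l ≤ n by omega)] at h
    have ih' := ih (by omega) (by omega)
    have e : ∀ g g' : G, g⁻¹ * seg x 0 n * y * z * (seg x 0 n * y) ^ (m / n) * g'
        = g⁻¹ * (z * (seg x 0 n * y) ^ (m / n + 1) * g') := by
      intro g g'
      have : g⁻¹ * seg x 0 n * y * z = g⁻¹ * (seg x 0 n * y * z) := by group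
      rw [this, hcz]
      generalize seg x 0 n * y = δ
      group
    rw [e, e, ih', mul_assoc (seg x 0 _) _ y, inv_mul_cancel_left] at h
    rw [← Nat.add_assoc, mul_assoc (seg x 0 _) _ y, ← h, mul_inv_cancel_left]

/-- This is the end point i = n of `slide_upper`: moving one δ = P_n y to the left of z and
cancelling P_n leaves the commutation with y. -/
lemma slide_commute (hn : 0 < n) (hc : commRel n x y z = 1)
    (hs : ∀ w ∈ slideRels n m x y z, w = 1) :
    Commute y (z * (seg x 0 n * y) ^ (m / n) * seg x 0 (m % n)) := by
  have hcz : seg x 0 n * y * z = z * (seg x 0 n * y) := by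
    rw [commRel, mul_inv_eq_one] at hc
    rw [hc, mul_assoc]
  have h := slide_upper (i := n) hn hc hs (by omega) le_rfl
  rw [Nat.add_sub_cancel_left, pow_succ'] at h
  have h2 : z * (seg x 0 n * y * (seg x 0 n * y) ^ (m / n)) * seg x 0 (m % n) =
      seg x 0 n * (y * (z * (seg x 0 n * y) ^ (m / n) * seg x 0 (m % n))) := by
    rw [← mul_assoc z, ← hcz]
    simp only [mul_assoc]
  rw [h2, mul_assoc (seg x 0 n) _ y] at h
  exact mul_left_cancel h

/-- Conjugation by `g` shifts the sequence `X` by `c`. -/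
def ConjShift (X : ℤ → G) (g : G) (c : ℤ) : Prop :=
  ∀ a, g * X a * g⁻¹ = X (a + c)

lemma ConjShift.mul {X : ℤ → G} {g h : G} {c d : ℤ} (hg : ConjShift X g c)
    (hh : ConjShift X h d) : ConjShift X (g * h) (c + d) := fun a => by
  rw [add_comm c d, ← add_assoc, ← hg, ← hh]
  group

lemma ConjShift.inv {X : ℤ → G} {g : G} {c : ℤ} (hg : ConjShift X g c) :
    ConjShift X g⁻¹ (-c) := fun a => by
  rw [← sub_eq_add_neg, show X a = X (a - c + c) by simp, ← hg]
  group

lemma ConjShift.pow {X : ℤ → G} {g : G} {c : ℤ} (hg : ConjShift X g c) (k : ℕ) :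
    ConjShift X (g ^ k) (k * c) := by
  induction k with
  | zero => intro a; simp
  | succ k ih =>
    rw [pow_succ, Nat.cast_succ, add_mul, one_mul]
    exact ih.mul hg

/-- The sequence `x` extended to `ℤ` by conjugation by `y`. -/
def extendSeq (n : ℕ) (x : ℕ → G) (y : G) (a : ℤ) : G :=
  y ^ (a / n) * x (a % n).toNat * (y ^ (a / n))⁻¹

lemma extendSeq_natCast {j : ℕ} (hj : j < n) : extendSeq n x y j = x j := by
  unfold extendSeq
  rw [Int.ediv_eq_zero_of_lt (by omega) (by omega), Int.emod_eq_of_lt (by omega) (by omega)]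
  simp

lemma extendSeq_eq {l a : ℤ} {i : ℕ} (hi : i < n) (ha : a = n * l + i) :
    extendSeq n x y a = y ^ l * x i * (y ^ l)⁻¹ := by
  have h1 : a / n = l := by
    rw [ha, Int.add_comm, Int.add_mul_ediv_left _ _ (by omega),
      Int.ediv_eq_zero_of_lt (by omega) (by omega), zero_add]
  have h2 : a % n = i := by
    rw [ha, Int.add_comm, Int.add_mul_emod_self_left, Int.emod_eq_of_lt (by omega) (by omega)]
  rw [extendSeq, h1, h2, Int.toNat_natCast]

lemma conjShift_y (hn : 0 < n) : ConjShift (extendSeq n x y) y n := fun a => by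
  have hi : (a % n).toNat < n := by
    have := Int.emod_lt_of_pos a (show (0 : ℤ) < n by omega)
    have := Int.emod_nonneg a (show (n : ℤ) ≠ 0 by omega)
    omega
  have hi' : ((a % n).toNat : ℤ) = a % n :=
    Int.toNat_of_nonneg (Int.emod_nonneg a (show (n : ℤ) ≠ 0 by omega))
  have ha : a = n * (a / n) + (a % n).toNat := by
    rw [hi']; exact (Int.mul_ediv_add_emod a n).symm
  rw [extendSeq_eq hi ha, extendSeq_eq (l := a / n + 1) (a := a + n) hi (by linarith),
    zpow_add_one, mul_assoc (y ^ (a / n)) y, (Commute.refl y).zpow_left (a / n) |>.eq]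
  group

/-- Let D = z δ^q P_r. Dividing consecutive instances of `slide_lower` gives D x_{i+r} = x_i D, and
of `slide_upper` gives D y x_{i+r-n} = x_i D y. The conjugation by y that appears on wrapping past n
is the one built into `extendSeq`. -/
lemma conjShift_of_slide (hn : 0 < n) (hc : commRel n x y z = 1)
    (hs : ∀ w ∈ slideRels n m x y z, w = 1) :
    ConjShift (extendSeq n x y) (z * (seg x 0 n * y) ^ (m / n) * seg x 0 (m % n))⁻¹
      (m % n : ℕ) := fun a => by
  have hi : (a % n).toNat < n := by
    have := Int.emod_lt_of_pos a (show (0 : ℤ) < n by omega)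
    have := Int.emod_nonneg a (show (n : ℤ) ≠ 0 by omega)
    omega
  have hi' : ((a % n).toNat : ℤ) = a % n :=
    Int.toNat_of_nonneg (Int.emod_nonneg a (show (n : ℤ) ≠ 0 by omega))
  have ha : a = n * (a / n) + (a % n).toNat := by
    rw [hi']; exact (Int.mul_ediv_add_emod a n).symm
  have hyD := slide_commute hn hc hs
  have hr : m % n < n := Nat.mod_lt _ hn
  have hlow : ∀ i, i + m % n ≤ n → _ := fun i => slide_lower (i := i) hc hs
  have hupp : ∀ i, n ≤ i + m % n → i ≤ n → _ := fun i => slide_upper (i := i) hn hc hs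
  generalize (a % n).toNat = i at *
  generalize a / n = l at *
  have hpow : z * (seg x 0 n * y) ^ (m / n + 1) =
    z * (seg x 0 n * y) ^ (m / n) * (seg x 0 n * y) := by rw [pow_succ, mul_assoc]
  rw [extendSeq_eq hi ha]
  by_cases hir : i + m % n < n
  · rw [extendSeq_eq (l := l) (a := a + (m % n : ℕ)) hir (by push_cast; linarith)]
    have h1 := hlow i (by omega)
    have h2 := hlow (i + 1) (by omega)
    rw [show i + 1 + m % n = i + m % n + 1 by omega, seg_succ x (Nat.zero_le _), ← mul_assoc, h1,
      seg_succ x (Nat.zero_le _)] at h2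
    generalize z * (seg x 0 n * y) ^ (m / n) * seg x 0 (m % n) = D at *
    have h3 : D * x (i + m % n) = x i * D := by
      simpa only [mul_assoc, mul_right_inj] using h2
    have h4 : x (i + m % n) = D⁻¹ * x i * D := by rw [mul_assoc, ← h3, inv_mul_cancel_left]
    rw [h4, inv_inv]
    have h5 : D⁻¹ * y ^ l = y ^ l * D⁻¹ := ((hyD.zpow_left l).inv_right).eq.symm
    have h6 : (y ^ l)⁻¹ * D = D * (y ^ l)⁻¹ := ((hyD.zpow_left l).inv_left).eq
    calc D⁻¹ * (y ^ l * x i * (y ^ l)⁻¹) * D = (D⁻¹ * y ^ l) * x i * ((y ^ l)⁻¹ * D) := by group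
      _ = _ := by rw [h5, h6]; group
  · rw [extendSeq_eq (l := l + 1) (a := a + (m % n : ℕ)) (i := i + m % n - n) (by omega)
      (by push_cast [show n ≤ i + m % n by omega]; linarith)]
    have h1 := hupp i (by omega) (by omega)
    have h2 := hupp (i + 1) (by omega) (by omega)
    rw [show i + 1 + m % n - n = i + m % n - n + 1 by omega, seg_succ x (Nat.zero_le _),
      ← mul_assoc, h1, seg_succ x (Nat.zero_le _)] at h2
    generalize z * (seg x 0 n * y) ^ (m / n) * seg x 0 (m % n) = D at *
    have h3 : D * (y * x (i + m % n - n)) = x i * (D * y) := by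
      simpa only [mul_assoc, mul_right_inj] using h2
    have h4 : y * x (i + m % n - n) * y⁻¹ = D⁻¹ * x i * D := by
      have : y * x (i + m % n - n) = D⁻¹ * (x i * (D * y)) := by rw [← h3, inv_mul_cancel_left]
      rw [this]; group
    have h5 : D⁻¹ * y ^ l = y ^ l * D⁻¹ := ((hyD.zpow_left l).inv_right).eq.symm
    have h6 : (y ^ l)⁻¹ * D = D * (y ^ l)⁻¹ := ((hyD.zpow_left l).inv_left).eq
    calc D⁻¹ * (y ^ l * x i * (y ^ l)⁻¹) * D⁻¹⁻¹
        = (D⁻¹ * y ^ l) * x i * ((y ^ l)⁻¹ * D) := by group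
      _ = y ^ l * (D⁻¹ * x i * D) * (y ^ l)⁻¹ := by rw [h5, h6]; group
      _ = _ := by rw [← h4, zpow_add_one]; group

lemma commute_y_shiftElt (hn : 0 < n) (hc : commRel n x y z = 1)
    (hs : ∀ w ∈ slideRels n m x y z, w = 1) : Commute y (shiftElt n m x y z) :=
  (slide_commute hn hc hs).mul_right (((Commute.refl y).pow_right _).inv_right)

/-- D shifts by -r, and the correction y^{-q} shifts by -qn; together they shift by -m. -/
lemma conjShift_shiftElt (hn : 0 < n) (hc : commRel n x y z = 1)
    (hs : ∀ w ∈ slideRels n m x y z, w = 1) :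
    ConjShift (extendSeq n x y) (shiftElt n m x y z) (-m) := by
  have h1 := (conjShift_of_slide hn hc hs).inv
  have h2 := ((conjShift_y (x := x) (y := y) hn).pow (m / n)).inv
  have h := h1.mul h2
  rw [inv_inv] at h
  have e : (-((m % n : ℕ) : ℤ) + -((m / n : ℕ) * n : ℤ)) = -m := by
    have : (m : ℤ) = ((m % n + n * (m / n) : ℕ) : ℤ) := by rw [Nat.mod_add_div]
    rw [this]; push_cast; ring
  rwa [e] at h

end SlideStructure

/-! ### A unit shift and a central element from Bézout's identity -/

section SlideBezout

variable {G : Type} [Group G] {n m α β : ℕ} {x : ℕ → G} {y z : G}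

/-- The element `T`, which shifts the sequence of conjugates of the generators by one. -/
def unitShift (n m α β : ℕ) (x : ℕ → G) (y z : G) : G :=
  shiftElt n m x y z ^ α * y ^ β

/-- The central element of the slide group. -/
def slideCenter (n m : ℕ) (x : ℕ → G) (y z : G) : G :=
  shiftElt n m x y z ^ n * y ^ m

lemma conjShift_unitShift (hn : 0 < n) (hαβ : β * n = α * m + 1) (hc : commRel n x y z = 1)
    (hs : ∀ w ∈ slideRels n m x y z, w = 1) :
    ConjShift (extendSeq n x y) (unitShift n m α β x y z) 1 := by
  have h := ((conjShift_shiftElt hn hc hs).pow α).mul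
    ((conjShift_y (x := x) (y := y) hn).pow β)
  have e : (α : ℤ) * -(m : ℤ) + β * n = 1 := by
    have : (β : ℤ) * n = α * m + 1 := by exact_mod_cast hαβ
    linarith
  rwa [e] at h

lemma eq_conj_unitShift (hn : 0 < n) (hαβ : β * n = α * m + 1) (hc : commRel n x y z = 1)
    (hs : ∀ w ∈ slideRels n m x y z, w = 1) {j : ℕ} (hj : j < n) :
    x j = unitShift n m α β x y z ^ j * x 0 * (unitShift n m α β x y z ^ j)⁻¹ := by
  have h := (conjShift_unitShift hn hαβ hc hs).pow j 0
  rw [← extendSeq_natCast (x := x) (y := y) hj, ← extendSeq_natCast (x := x) (y := y) hn]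
  simpa using h.symm

/-- The exponents of the central element are chosen so that its total shift is n·(-m) + m·n = 0. -/
lemma slideCenter_commute_x (hn : 0 < n) (hc : commRel n x y z = 1)
    (hs : ∀ w ∈ slideRels n m x y z, w = 1) {j : ℕ} (hj : j < n) :
    Commute (slideCenter n m x y z) (x j) := by
  have h := (((conjShift_shiftElt hn hc hs).pow n).mul
    ((conjShift_y (x := x) (y := y) hn).pow m)) j
  rw [show (n : ℤ) * -(m : ℤ) + m * n = 0 by ring, add_zero, extendSeq_natCast hj,
    mul_inv_eq_iff_eq_mul] at h
  exact h

lemma slideCenter_commute_y (hn : 0 < n) (hc : commRel n x y z = 1)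
    (hs : ∀ w ∈ slideRels n m x y z, w = 1) : Commute (slideCenter n m x y z) y :=
  ((commute_y_shiftElt hn hc hs).symm.pow_left n).mul_left ((Commute.refl y).pow_left m)

lemma slideCenter_commute_shiftElt (hn : 0 < n) (hc : commRel n x y z = 1)
    (hs : ∀ w ∈ slideRels n m x y z, w = 1) :
    Commute (slideCenter n m x y z) (shiftElt n m x y z) :=
  ((Commute.refl _).pow_left n).mul_left ((commute_y_shiftElt hn hc hs).pow_left m)

lemma slideCenter_commute_unitShift (hn : 0 < n) (hc : commRel n x y z = 1)
    (hs : ∀ w ∈ slideRels n m x y z, w = 1) :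
    Commute (slideCenter n m x y z) (unitShift n m α β x y z) :=
  ((slideCenter_commute_shiftElt hn hc hs).pow_right α).mul_right
    ((slideCenter_commute_y hn hc hs).pow_right β)

/-- The shift element D₀ and y commute, so this only compares exponents: βn = αm + 1 turns D₀^{αn}
y^{βn} into y (D₀^n y^m)^α. -/
lemma unitShift_pow_n (hn : 0 < n) (hαβ : β * n = α * m + 1) (hc : commRel n x y z = 1)
    (hs : ∀ w ∈ slideRels n m x y z, w = 1) :
    unitShift n m α β x y z ^ n = y * slideCenter n m x y z ^ α := by
  have h := (commute_y_shiftElt hn hc hs).symm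
  rw [unitShift, slideCenter, (h.pow_pow α β).mul_pow, (h.pow_pow n m).mul_pow, ← pow_mul,
    ← pow_mul, ← pow_mul, ← pow_mul, hαβ, mul_comm n α, mul_comm m α, pow_succ', ← mul_assoc,
    ← mul_assoc, (h.pow_left (α * n)).eq]

lemma unitShift_pow_m (hn : 0 < n) (hαβ : β * n = α * m + 1) (hc : commRel n x y z = 1)
    (hs : ∀ w ∈ slideRels n m x y z, w = 1) :
    shiftElt n m x y z * unitShift n m α β x y z ^ m = slideCenter n m x y z ^ β := by
  have h := (commute_y_shiftElt hn hc hs).symm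
  rw [unitShift, slideCenter, (h.pow_pow α β).mul_pow, (h.pow_pow n m).mul_pow, ← pow_mul,
    ← pow_mul, ← pow_mul, ← pow_mul, mul_comm n β, hαβ, mul_comm m β, pow_succ', ← mul_assoc]

lemma delta_mul_pow (hn : 0 < n) (hαβ : β * n = α * m + 1) (hc : commRel n x y z = 1)
    (hs : ∀ w ∈ slideRels n m x y z, w = 1) :
    seg x 0 n * y * slideCenter n m x y z ^ α = (x 0 * unitShift n m α β x y z) ^ n := by
  rw [seg_conj_pow (fun j hj => eq_conj_unitShift (α := α) (β := β) hn hαβ hc hs hj) le_rfl,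
    mul_assoc, ← unitShift_pow_n hn hαβ hc hs, inv_mul_cancel_right]

/-- Splitting m = qn + r in both (sT)^m and T^m reduces the claim to D₀ T^m = h^β: the δ's and P_r
in (sT)^m combine with z to give D₀ y^q, and the central powers of h agree. -/
lemma z_mul_pow (hn : 0 < n) (hαβ : β * n = α * m + 1) (hc : commRel n x y z = 1)
    (hs : ∀ w ∈ slideRels n m x y z, w = 1) :
    z * (x 0 * unitShift n m α β x y z) ^ m = slideCenter n m x y z ^ β := by
  have hT := unitShift_pow_n hn hαβ hc hs
  have hδ := delta_mul_pow hn hαβ hc hs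
  have hp := seg_conj_pow (fun j hj => eq_conj_unitShift (α := α) (β := β) hn hαβ hc hs hj)
    (Nat.mod_lt m hn).le
  have hyD := commute_y_shiftElt hn hc hs
  have hhy := slideCenter_commute_y hn hc hs
  have hhδ : Commute (slideCenter n m x y z) (seg x 0 n * y) := by
    refine Commute.mul_right ?_ hhy
    rw [seg]
    refine Commute.list_prod_right _ _ fun g hg => ?_
    simp only [List.mem_map, List.Ico.mem] at hg
    obtain ⟨j, hj, rfl⟩ := hg
    exact slideCenter_commute_x hn hc hs hj.2
  have hD : shiftElt n m x y z * y ^ (m / n) =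
      z * (seg x 0 n * y) ^ (m / n) * seg x 0 (m % n) := by
    rw [shiftElt, inv_mul_cancel_right]
  rw [← unitShift_pow_m hn hαβ hc hs]
  have hm : m = m % n + n * (m / n) := (Nat.mod_add_div m n).symm
  have hhc : Commute (slideCenter n m x y z) (x 0 * unitShift n m α β x y z) :=
    (slideCenter_commute_x hn hc hs hn).mul_right (slideCenter_commute_unitShift hn hc hs)
  have hhT := slideCenter_commute_unitShift (α := α) (β := β) hn hc hs
  generalize shiftElt n m x y z = D at *
  generalize unitShift n m α β x y z = T at *
  generalize slideCenter n m x y z = h at *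
  generalize m % n = r at *
  generalize m / n = q at *
  have e1 : (x 0 * T) ^ m = (seg x 0 n * y) ^ q * (x 0 * T) ^ r * (h ^ α) ^ q := by
    rw [hm, add_comm, pow_add, pow_mul, ← hδ, ((hhδ.pow_left α).symm).mul_pow, mul_assoc,
      ((hhc.pow_left α).pow_pow q r).eq, mul_assoc]
  have e2 : T ^ m = y ^ q * (h ^ α) ^ q * T ^ r := by
    rw [hm, add_comm, pow_add, pow_mul, hT, ((hhy.pow_left α).symm).mul_pow]
  have e3 : (x 0 * T) ^ r = seg x 0 r * T ^ r := by rw [hp, inv_mul_cancel_right]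
  rw [e1, e2, e3]
  calc z * ((seg x 0 n * y) ^ q * (seg x 0 r * T ^ r) * (h ^ α) ^ q)
      = z * (seg x 0 n * y) ^ q * seg x 0 r * (T ^ r * (h ^ α) ^ q) := by
        simp only [mul_assoc]
    _ = D * y ^ q * ((h ^ α) ^ q * T ^ r) := by
        rw [← hD, ((hhT.pow_left α).pow_pow q r).eq]
    _ = _ := by simp only [mul_assoc]

end SlideBezout

/-! ### Converse: the slide relations follow from centrality of h -/

section SlideConverse

variable {G : Type} [Group G] {n m α β : ℕ} {x : ℕ → G} {y z s T h : G}

/-- Every factor is a power of c = sT, of T or of h, and `he` says that the total exponent of c is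
zero. What remains depends on i and l only through i - l, which is the same on both sides of (b) and
of (c); this is why those relations hold. -/
lemma slide_word (hs : Commute h s) (hT : Commute h T)
    (hx : ∀ j < n, x j = T ^ j * s * (T ^ j)⁻¹) (hy : T ^ n = y * h ^ α)
    (hz : z * (s * T) ^ m = h ^ β) {i l : ℕ} (hi : i ≤ n) (hl : l ≤ n) (e : ℤ)
    (he : (n : ℤ) - i - m + n * e + l = 0) :
    seg x i n * y * z * (seg x 0 n * y) ^ e * seg x 0 l =
      h ^ ((β : ℤ) - α - α * e) * T ^ ((i : ℤ) - l) := by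
  have hy' : y = T ^ n * (h ^ α)⁻¹ := by rw [hy, mul_inv_cancel_right]
  have hz' : z = h ^ β * ((s * T) ^ m)⁻¹ := by rw [← hz, mul_inv_cancel_right]
  have hc : Commute h (s * T) := hs.mul_right hT
  rw [seg_eq x hi, seg_conj_pow hx hi, seg_conj_pow hx hl, seg_conj_pow hx le_rfl, hy', hz']
  generalize s * T = c at *
  have hδ : (c ^ n * (T ^ n)⁻¹ * (T ^ n * (h ^ α)⁻¹)) ^ e = h ^ (-(α * e : ℤ)) * c ^ (n * e) := by
    have : c ^ n * (T ^ n)⁻¹ * (T ^ n * (h ^ α)⁻¹) = h ^ (-α : ℤ) * c ^ (n : ℤ) := by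
      rw [mul_assoc, inv_mul_cancel_left, ((hc.pow_pow α n).inv_left).eq.symm]
      simp
    rw [this, (hc.zpow_zpow _ _).mul_zpow, ← zpow_mul, ← zpow_mul]
    congr 2
    ring
  rw [hδ]
  have Hc : ∀ a b : ℤ, c ^ a * h ^ b = h ^ b * c ^ a := fun a b => (hc.zpow_zpow b a).eq.symm
  have Hc' : ∀ (a b : ℤ) (w : G), c ^ a * (h ^ b * w) = h ^ b * (c ^ a * w) := fun a b w => by
    rw [← mul_assoc, Hc, mul_assoc]
  have HT : ∀ (a b : ℤ) (w : G), T ^ a * (h ^ b * w) = h ^ b * (T ^ a * w) := fun a b w => by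
    rw [← mul_assoc, (hT.zpow_zpow b a).eq.symm, mul_assoc]
  calc (c ^ i * (T ^ i)⁻¹)⁻¹ * (c ^ n * (T ^ n)⁻¹) * (T ^ n * (h ^ α)⁻¹) *
        (h ^ β * (c ^ m)⁻¹) * (h ^ (-(α * e : ℤ)) * c ^ (n * e)) * (c ^ l * (T ^ l)⁻¹)
      = T ^ (i : ℤ) * (c ^ (n - i : ℤ) * (h ^ (β - α : ℤ) * (c ^ (-m : ℤ) *
          (h ^ (-(α * e : ℤ)) * (c ^ (n * e + l) * T ^ (-l : ℤ)))))) := by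
        simp only [zpow_add, zpow_sub, zpow_neg, zpow_natCast, mul_inv_rev, inv_inv]
        group
    _ = h ^ (β - α : ℤ) * (h ^ (-(α * e : ℤ)) * (T ^ (i : ℤ) * (c ^ (n - i : ℤ) *
          (c ^ (-m : ℤ) * (c ^ (n * e + l) * T ^ (-l : ℤ)))))) := by
        simp only [Hc', HT]
    _ = _ := by
        rw [← mul_assoc (c ^ (-m : ℤ)), ← zpow_add, ← mul_assoc (c ^ (n - i : ℤ)), ← zpow_add,
          show (n - i : ℤ) + (-m + (n * e + l)) = 0 by linarith, zpow_zero, one_mul, ← zpow_add,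
          ← mul_assoc, ← zpow_add]
        congr 1

lemma commRel_of_central (hs : Commute h s) (hT : Commute h T)
    (hx : ∀ j < n, x j = T ^ j * s * (T ^ j)⁻¹) (hy : T ^ n = y * h ^ α)
    (hz : z * (s * T) ^ m = h ^ β) : commRel n x y z = 1 := by
  have hy' : y = T ^ n * (h ^ α)⁻¹ := by rw [hy, mul_inv_cancel_right]
  have hz' : z = h ^ β * ((s * T) ^ m)⁻¹ := by rw [← hz, mul_inv_cancel_right]
  have hc : Commute h (s * T) := hs.mul_right hT
  have hd : seg x 0 n * y = (s * T) ^ n * (h ^ α)⁻¹ := by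
    rw [seg_conj_pow hx le_rfl, hy', mul_assoc, inv_mul_cancel_left]
  have : Commute (seg x 0 n * y) z := by
    rw [hd, hz']
    refine Commute.mul_left (Commute.mul_right ?_ ?_) (Commute.mul_right ?_ ?_)
    · exact (hc.pow_pow β n).symm
    · exact ((Commute.refl (s * T)).pow_pow n m).inv_right
    · exact ((Commute.refl h).pow_pow α β).inv_left
    · exact (hc.pow_pow α m).inv_inv
  rw [commRel, this.eq, mul_inv_eq_one, mul_assoc]

lemma slideRels_of_central (hn : 0 < n) (hs : Commute h s) (hT : Commute h T)
    (hx : ∀ j < n, x j = T ^ j * s * (T ^ j)⁻¹) (hy : T ^ n = y * h ^ α)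
    (hz : z * (s * T) ^ m = h ^ β) : ∀ w ∈ slideRels n m x y z, w = 1 := by
  have hm : (m : ℤ) = (m % n : ℕ) + n * (m / n : ℕ) := by
    exact_mod_cast (Nat.mod_add_div m n).symm
  have hr := Nat.mod_lt m hn
  rintro w (⟨j, hj, rfl⟩ | ⟨j, hj, hj', rfl⟩)
  · rw [mul_inv_eq_one, slide_word hs hT hx hy hz (by omega) (by omega) _
      (by push_cast at hm ⊢; linarith), slide_word hs hT hx hy hz (by omega) (by omega) _
      (by push_cast at hm ⊢; linarith)]
    congr 2
    push_cast
    ring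
  · rw [mul_inv_eq_one, ← zpow_natCast _ (m / n), slide_word hs hT hx hy hz (by omega) (by omega) _
      (by rw [Nat.cast_sub (by omega)]; push_cast at hm ⊢; linarith),
      slide_word hs hT hx hy hz (by omega) (by omega) _
      (by rw [Nat.cast_sub (by omega)]; push_cast at hm ⊢; linarith)]
    congr 2
    rw [Nat.cast_sub (by omega), Nat.cast_sub (by omega)]
    push_cast
    ring

lemma delta_of_central (hx : ∀ j < n, x j = T ^ j * s * (T ^ j)⁻¹) (hy : T ^ n = y * h ^ α) :
    seg x 0 n * y * h ^ α = (s * T) ^ n := by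
  rw [mul_assoc, ← hy, seg_conj_pow hx le_rfl, inv_mul_cancel_right]

lemma shiftElt_of_central (hn : 0 < n) (hs : Commute h s) (hT : Commute h T)
    (hx : ∀ j < n, x j = T ^ j * s * (T ^ j)⁻¹) (hy : T ^ n = y * h ^ α)
    (hz : z * (s * T) ^ m = h ^ β) : shiftElt n m x y z * T ^ m = h ^ β := by
  have hm : (m : ℤ) = (m % n : ℕ) + n * (m / n : ℕ) := by
    exact_mod_cast (Nat.mod_add_div m n).symm
  have hcr := commRel_of_central hs hT hx hy hz
  have hcz : seg x 0 n * y * z = z * (seg x 0 n * y) := by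
    rw [commRel, mul_inv_eq_one] at hcr
    rw [hcr, mul_assoc]
  -- For i = 0, l = r and e = q - 1 the word is δ z δ^{q-1} P_r, which equals z δ^q P_r because δ
  -- and z commute.
  have hw := slide_word hs hT hx hy hz (i := 0) (l := m % n) (by omega) (Nat.mod_lt m hn).le
    ((m / n : ℕ) - 1) (by push_cast at hm ⊢; linarith)
  have hw' : z * (seg x 0 n * y) ^ (m / n) * seg x 0 (m % n) =
      h ^ ((β : ℤ) - α * (m / n : ℕ)) * T ^ (-((m % n : ℕ) : ℤ)) := by
    rw [hcz] at hw
    rw [show (-((m % n : ℕ) : ℤ)) = ((0 : ℕ) : ℤ) - (m % n : ℕ) by simp,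
      show ((β : ℤ) - α * (m / n : ℕ)) = β - α - α * ((m / n : ℕ) - 1) by ring, ← hw]
    generalize seg x 0 n * y = δ
    group
  have hhy : Commute h y := by
    rw [show y = T ^ n * (h ^ α)⁻¹ by rw [hy, mul_inv_cancel_right]]
    exact (hT.pow_right n).mul_right ((Commute.refl h).pow_right α).inv_right
  have e2 : T ^ (m : ℤ) = T ^ ((m % n : ℕ) : ℤ) * y ^ (m / n) * h ^ ((α : ℤ) * (m / n : ℕ)) := by
    rw [hm, zpow_add, zpow_natCast T (m % n), zpow_mul, zpow_natCast T n, hy, zpow_natCast,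
      ((hhy.pow_left α).symm).mul_pow, zpow_mul, zpow_natCast, zpow_natCast, mul_assoc]
  have hyT : Commute y T := by
    rw [show y = T ^ n * (h ^ α)⁻¹ by rw [hy, mul_inv_cancel_right]]
    exact ((Commute.refl T).pow_left n).mul_left (hT.pow_left α).inv_left
  rw [← zpow_natCast T m, e2, shiftElt, hw', ← ((hyT.zpow_right _).pow_left _).eq]
  have : ∀ a b c d e : G, a * b * c⁻¹ * (c * d * e) = a * (b * d) * e := by
    intros; group
  rw [this, ← zpow_add, neg_add_cancel, zpow_zero, mul_one, ← zpow_add]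
  simp

lemma unitShift_of_central (hn : 0 < n) (hαβ : β * n = α * m + 1) (hs : Commute h s)
    (hT : Commute h T) (hx : ∀ j < n, x j = T ^ j * s * (T ^ j)⁻¹) (hy : T ^ n = y * h ^ α)
    (hz : z * (s * T) ^ m = h ^ β) : unitShift n m α β x y z = T := by
  have hD := shiftElt_of_central hn hs hT hx hy hz
  rw [unitShift, eq_mul_inv_of_mul_eq hD, eq_mul_inv_of_mul_eq hy.symm,
    ((hT.pow_pow β m).inv_right).mul_pow, ((hT.pow_pow α n).symm.inv_right).mul_pow,
    inv_pow, inv_pow, ← pow_mul, ← pow_mul, ← pow_mul, ← pow_mul, mul_comm n β, hαβ,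
    mul_comm m α, mul_comm β α, pow_succ, mul_assoc, ← mul_assoc _ _ (h ^ (α * β))⁻¹,
    inv_mul_cancel_left, ← mul_assoc, (hT.pow_left _).eq, mul_inv_cancel_right]

lemma slideCenter_of_central (hn : 0 < n) (hαβ : β * n = α * m + 1) (hs : Commute h s)
    (hT : Commute h T) (hx : ∀ j < n, x j = T ^ j * s * (T ^ j)⁻¹) (hy : T ^ n = y * h ^ α)
    (hz : z * (s * T) ^ m = h ^ β) : slideCenter n m x y z = h := by
  have hD := shiftElt_of_central hn hs hT hx hy hz
  rw [slideCenter, eq_mul_inv_of_mul_eq hD, eq_mul_inv_of_mul_eq hy.symm,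
    ((hT.pow_pow β m).inv_right).mul_pow, ((hT.pow_pow α n).symm.inv_right).mul_pow,
    inv_pow, inv_pow, ← pow_mul, ← pow_mul, ← pow_mul, ← pow_mul, hαβ, mul_comm n m,
    ← mul_assoc, inv_mul_cancel_right, pow_succ', mul_inv_cancel_right]

end SlideConverse

/-! ### The one-relator models of the braid groups -/

/-- The relators of `⟨s, T, h | h central⟩`, with `s, T, h` indexed by `0, 1, 2`. -/
def freeCenterRels : Set (FreeGroup (Fin 3)) :=
  {FreeGroup.of 2 * FreeGroup.of 0 * (FreeGroup.of 0 * FreeGroup.of 2)⁻¹,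
    FreeGroup.of 2 * FreeGroup.of 1 * (FreeGroup.of 1 * FreeGroup.of 2)⁻¹}

/-- The relators of `⟨c, w | w ^ m c = c w ^ m⟩`, with `c, w` indexed by `0, 1`. -/
def powerCommRels (m : ℕ) : Set (FreeGroup (Fin 2)) :=
  {FreeGroup.of 1 ^ m * FreeGroup.of 0 * (FreeGroup.of 0 * FreeGroup.of 1 ^ m)⁻¹}

/-- The relators of `⟨a, b | a ^ n = b ^ m⟩`, with `a, b` indexed by `0, 1`. -/
def torusRels (n m : ℕ) : Set (FreeGroup (Fin 2)) :=
  {FreeGroup.of 0 ^ n * (FreeGroup.of 1 ^ m)⁻¹}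

lemma letters_of_lt {ι : Type} {n : ℕ} (x : Fin n → ι) {i : ℕ} (hi : i < n) :
    letters x i = FreeGroup.of (x ⟨i, hi⟩) := by
  rw [letters, dif_pos hi]

lemma lift_letters {ι G : Type} [Group G] {n : ℕ} (f : ι → G) (x : Fin n → ι) {i : ℕ}
    (hi : i < n) : FreeGroup.lift f (letters x i) = f (x ⟨i, hi⟩) := by
  rw [letters_of_lt x hi, FreeGroup.lift_apply_of]

lemma map_shiftElt {G H : Type} [Group G] [Group H] (φ : G →* H) (n m : ℕ) (x : ℕ → G) (y z : G) :
    φ (shiftElt n m x y z) = shiftElt n m (fun i => φ (x i)) (φ y) (φ z) := by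
  simp [shiftElt, map_seg]

lemma mk_eq_one {ι : Type} {rels : Set (FreeGroup ι)} {r : FreeGroup ι} (hr : r ∈ rels) :
    PresentedGroup.mk rels r = 1 :=
  PresentedGroup.one_of_mem hr

lemma map_unitShift {G H : Type} [Group G] [Group H] (φ : G →* H) (n m α β : ℕ) (x : ℕ → G)
    (y z : G) :
    φ (unitShift n m α β x y z) = unitShift n m α β (fun i => φ (x i)) (φ y) (φ z) := by
  simp [unitShift, map_shiftElt]

lemma map_slideCenter {G H : Type} [Group G] [Group H] (φ : G →* H) (n m : ℕ) (x : ℕ → G)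
    (y z : G) :
    φ (slideCenter n m x y z) = slideCenter n m (fun i => φ (x i)) (φ y) (φ z) := by
  simp [slideCenter, map_shiftElt]

section Slide

variable {ι G : Type} [Group G] {n m α β : ℕ}

/-- In a group in which the slide relators hold, the images of the letters satisfy them. -/
lemma slideRels_mk {rels : Set (FreeGroup ι)} {x : ℕ → FreeGroup ι} {y z : FreeGroup ι}
    (hr : slideRels n m x y z ⊆ rels) :
    ∀ w ∈ slideRels n m (fun i => PresentedGroup.mk rels (x i)) (PresentedGroup.mk rels y)
      (PresentedGroup.mk rels z), w = 1 := by
  intro w hw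
  obtain ⟨v, hv, rfl⟩ := mem_slideRels_of_map _ hw
  exact mk_eq_one (hr hv)

end Slide

variable {n m α β : ℕ}

/-- `𝓑_*^*(n, m)` is the product of a free group of rank two and an infinite cyclic group. -/
theorem nonempty_BBoth_mulEquiv (hn : 0 < n) (hαβ : β * n = α * m + 1) :
    Nonempty (BBoth n m ≃* PresentedGroup freeCenterRels) := by
  -- the homomorphism to the model
  let s : PresentedGroup freeCenterRels := PresentedGroup.of 0
  let T : PresentedGroup freeCenterRels := PresentedGroup.of 1
  let h : PresentedGroup freeCenterRels := PresentedGroup.of 2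
  have hs : Commute h s := by
    have := mk_eq_one (rels := freeCenterRels) (Or.inl rfl)
    rw [map_mul, map_inv, mul_inv_eq_one] at this
    exact this
  have hT : Commute h T := by
    have := mk_eq_one (rels := freeCenterRels) (Or.inr rfl)
    rw [map_mul, map_inv, mul_inv_eq_one] at this
    exact this
  let f : GenXYZ n → PresentedGroup freeCenterRels := fun g => match g with
    | .x i => T ^ (i : ℕ) * s * (T ^ (i : ℕ))⁻¹
    | .y => T ^ n * (h ^ α)⁻¹
    | .z => h ^ β * ((s * T) ^ m)⁻¹
  have hx : ∀ j < n, FreeGroup.lift f (letters GenXYZ.x j) = T ^ j * s * (T ^ j)⁻¹ :=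
    fun j hj => lift_letters f GenXYZ.x hj
  have hy : T ^ n = FreeGroup.lift f (FreeGroup.of GenXYZ.y) * h ^ α := by
    rw [FreeGroup.lift_apply_of, inv_mul_cancel_right]
  have hz : FreeGroup.lift f (FreeGroup.of GenXYZ.z) * (s * T) ^ m = h ^ β := by
    rw [FreeGroup.lift_apply_of, inv_mul_cancel_right]
  let rels := {commRel n (letters GenXYZ.x) (FreeGroup.of (GenXYZ.y : GenXYZ n))
    (FreeGroup.of GenXYZ.z)} ∪ slideRels n m (letters GenXYZ.x)
      (FreeGroup.of (GenXYZ.y : GenXYZ n)) (FreeGroup.of GenXYZ.z)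
  have hf : ∀ r ∈ rels, FreeGroup.lift f r = 1 := by
    rintro r (rfl | hr)
    · rw [map_commRel]
      exact commRel_of_central hs hT hx hy hz
    · exact slideRels_of_central hn hs hT hx hy hz _ (map_mem_slideRels _ hr)
  let F : PresentedGroup rels →* PresentedGroup freeCenterRels := PresentedGroup.toGroup hf
  -- the inverse homomorphism
  let X : ℕ → PresentedGroup rels := fun i => PresentedGroup.mk rels (letters GenXYZ.x i)
  let Y : PresentedGroup rels := PresentedGroup.of GenXYZ.y
  let Z : PresentedGroup rels := PresentedGroup.of GenXYZ.z
  have hC : commRel n X Y Z = 1 := by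
    have := mk_eq_one (rels := rels) (Or.inl rfl)
    rwa [map_commRel] at this
  have hS : ∀ w ∈ slideRels n m X Y Z, w = 1 := slideRels_mk (fun _ hr => Or.inr hr)
  let g : Fin 3 → PresentedGroup rels :=
    ![X 0, unitShift n m α β X Y Z, slideCenter n m X Y Z]
  have hg : ∀ r ∈ freeCenterRels, FreeGroup.lift g r = 1 := by
    rintro r (rfl | rfl)
    · simp only [map_mul, map_inv, FreeGroup.lift_apply_of, mul_inv_eq_one]
      exact slideCenter_commute_x hn hC hS hn
    · simp only [map_mul, map_inv, FreeGroup.lift_apply_of, mul_inv_eq_one]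
      exact slideCenter_commute_unitShift hn hC hS
  let K : PresentedGroup freeCenterRels →* PresentedGroup rels := PresentedGroup.toGroup hg
  have Ks : K s = X 0 := PresentedGroup.toGroup.of _
  have KT : K T = unitShift n m α β X Y Z := PresentedGroup.toGroup.of _
  have Kh : K h = slideCenter n m X Y Z := PresentedGroup.toGroup.of _
  have FY : F Y = T ^ n * (h ^ α)⁻¹ := PresentedGroup.toGroup.of _
  have FZ : F Z = h ^ β * ((s * T) ^ m)⁻¹ := PresentedGroup.toGroup.of _
  have FT : F (unitShift n m α β X Y Z) = T := by
    rw [map_unitShift]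
    exact unitShift_of_central hn hαβ hs hT (x := fun i => F (X i)) hx hy hz
  have Fh : F (slideCenter n m X Y Z) = h := by
    rw [map_slideCenter]
    exact slideCenter_of_central hn hαβ hs hT (x := fun i => F (X i)) hx hy hz
  refine ⟨MonoidHom.toMulEquiv F K ?_ ?_⟩
  · refine PresentedGroup.ext fun a => ?_
    rcases a with i | _ | _
    · change K (F (PresentedGroup.of (GenXYZ.x i))) = _
      have : F (PresentedGroup.of (GenXYZ.x i)) = T ^ (i : ℕ) * s * (T ^ (i : ℕ))⁻¹ :=
        PresentedGroup.toGroup.of _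
      rw [this, map_mul, map_mul, map_inv, map_pow, KT, Ks,
        ← eq_conj_unitShift hn hαβ hC hS i.2]
      change PresentedGroup.mk rels (letters GenXYZ.x i) = _
      rw [letters_of_lt _ i.2]
      rfl
    · change K (F Y) = Y
      rw [FY, map_mul, map_inv, map_pow, map_pow, KT, Kh, unitShift_pow_n hn hαβ hC hS,
        mul_inv_cancel_right]
    · change K (F Z) = Z
      rw [FZ, map_mul, map_inv, map_pow, map_pow, map_mul, KT, Kh, Ks, ← z_mul_pow hn hαβ hC hS,
        mul_inv_cancel_right]
  · refine PresentedGroup.ext fun a => ?_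
    fin_cases a
    · change F (K s) = s
      rw [Ks]
      exact (hx 0 hn).trans (by simp)
    · change F (K T) = T
      rw [KT, FT]
    · change F (K h) = h
      rw [Kh, Fh]

/-- `𝓑_*(n, m)` depends only on `m`. -/
theorem nonempty_BLower_mulEquiv (hn : 0 < n) (hαβ : β * n = α * m + 1) :
    Nonempty (BLower n m ≃* PresentedGroup (powerCommRels m)) := by
  let T : PresentedGroup (powerCommRels m) := PresentedGroup.of 0
  let w : PresentedGroup (powerCommRels m) := PresentedGroup.of 1
  -- Here `w` plays the part of δ. When z = 1, Bézout's identity forces δ^m = h and δ^β = sT, which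
  -- dictates the choice of `h` and `s`.
  let h : PresentedGroup (powerCommRels m) := w ^ m
  let s : PresentedGroup (powerCommRels m) := w ^ β * T⁻¹
  have hT : Commute h T := by
    have := mk_eq_one (rels := powerCommRels m) rfl
    rw [map_mul, map_inv, mul_inv_eq_one, map_mul, map_mul, map_pow] at this
    exact this
  have hs : Commute h s := ((Commute.refl w).pow_pow m β).mul_right hT.inv_right
  have hsT : s * T = w ^ β := inv_mul_cancel_right _ _
  let f : GenXY n → PresentedGroup (powerCommRels m) := fun g => match g with
    | .x i => T ^ (i : ℕ) * s * (T ^ (i : ℕ))⁻¹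
    | .y => T ^ n * (h ^ α)⁻¹
  have hx : ∀ j < n, FreeGroup.lift f (letters GenXY.x j) = T ^ j * s * (T ^ j)⁻¹ :=
    fun j hj => lift_letters f GenXY.x hj
  have hy : T ^ n = FreeGroup.lift f (FreeGroup.of GenXY.y) * h ^ α := by
    rw [FreeGroup.lift_apply_of, inv_mul_cancel_right]
  have hz : 1 * (s * T) ^ m = h ^ β := by
    rw [hsT, one_mul, ← pow_mul, ← pow_mul, mul_comm]
  let rels := slideRels n m (letters GenXY.x) (FreeGroup.of (GenXY.y : GenXY n)) 1
  have hf : ∀ r ∈ rels, FreeGroup.lift f r = 1 := by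
    intro r hr
    refine slideRels_of_central hn hs hT hx hy hz _ ?_
    have := map_mem_slideRels (FreeGroup.lift f) hr
    rwa [map_one] at this
  let F : PresentedGroup rels →* PresentedGroup (powerCommRels m) := PresentedGroup.toGroup hf
  let X : ℕ → PresentedGroup rels := fun i => PresentedGroup.mk rels (letters GenXY.x i)
  let Y : PresentedGroup rels := PresentedGroup.of GenXY.y
  have hC : commRel n X Y 1 = 1 := by simp [commRel]
  have hS : ∀ w ∈ slideRels n m X Y 1, w = 1 := by
    have := slideRels_mk (rels := rels) (fun _ hr => hr)
    rwa [map_one] at this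
  have hδ := delta_mul_pow (α := α) (β := β) hn hαβ hC hS
  have hzm := z_mul_pow (α := α) (β := β) hn hαβ hC hS
  have hcx := (slideCenter_commute_x hn hC hS hn).mul_right
    (slideCenter_commute_unitShift (α := α) (β := β) hn hC hS)
  rw [one_mul] at hzm
  have hδ' := eq_mul_inv_of_mul_eq hδ
  -- From δ = (sT)^n h^{-α} and (sT)^m = h^β one gets δ^m = h^{βn - αm} = h.
  have hδm : (seg X 0 n * Y) ^ m = slideCenter n m X Y 1 := by
    rw [hδ', ((hcx.pow_pow α n).symm.inv_right).mul_pow, ← pow_mul, mul_comm n m, pow_mul, hzm,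
      ← pow_mul, hαβ, inv_pow, ← pow_mul, pow_succ', mul_inv_cancel_right]
  let g : Fin 2 → PresentedGroup rels := ![unitShift n m α β X Y 1, seg X 0 n * Y]
  have hg : ∀ r ∈ powerCommRels m, FreeGroup.lift g r = 1 := by
    rintro r rfl
    simp only [map_mul, map_inv, map_pow, FreeGroup.lift_apply_of, mul_inv_eq_one]
    change (seg X 0 n * Y) ^ m * unitShift n m α β X Y 1 = _ * (seg X 0 n * Y) ^ m
    rw [hδm]
    exact slideCenter_commute_unitShift hn hC hS
  let K : PresentedGroup (powerCommRels m) →* PresentedGroup rels := PresentedGroup.toGroup hg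
  have KT : K T = unitShift n m α β X Y 1 := PresentedGroup.toGroup.of _
  have Kw : K w = seg X 0 n * Y := PresentedGroup.toGroup.of _
  have Kh : K h = slideCenter n m X Y 1 := by rw [map_pow, Kw, hδm]
  have Ks : K s = X 0 := by
    rw [map_mul, map_inv, map_pow, KT, Kw, hδ', ((hcx.pow_pow α n).symm.inv_right).mul_pow,
      ← pow_mul, mul_comm n β, hαβ, pow_succ', mul_comm α m, pow_mul, hzm, inv_pow, ← pow_mul,
      ← pow_mul, mul_comm β α, mul_inv_cancel_right, mul_inv_cancel_right]
  have FY : F Y = T ^ n * (h ^ α)⁻¹ := PresentedGroup.toGroup.of _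
  have FT : F (unitShift n m α β X Y 1) = T := by
    rw [map_unitShift, map_one]
    exact unitShift_of_central hn hαβ hs hT (x := fun i => F (X i)) hx hy hz
  have Fδ : F (seg X 0 n * Y) = w := by
    rw [map_mul, map_seg]
    have := delta_of_central (x := fun i => F (X i)) hx hy
    rw [hsT, ← pow_mul, ← pow_mul, hαβ, mul_comm m α, pow_succ'] at this
    exact mul_right_cancel this
  refine ⟨MonoidHom.toMulEquiv F K ?_ ?_⟩
  · refine PresentedGroup.ext fun a => ?_
    rcases a with i | _
    · change K (F (PresentedGroup.of (GenXY.x i))) = _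
      have : F (PresentedGroup.of (GenXY.x i)) = T ^ (i : ℕ) * s * (T ^ (i : ℕ))⁻¹ :=
        PresentedGroup.toGroup.of _
      rw [this, map_mul, map_mul, map_inv, map_pow, KT, Ks,
        ← eq_conj_unitShift hn hαβ hC hS i.2]
      change PresentedGroup.mk rels (letters GenXY.x i) = _
      rw [letters_of_lt _ i.2]
      rfl
    · change K (F Y) = Y
      rw [FY, map_mul, map_inv, map_pow, map_pow, KT, Kh, unitShift_pow_n hn hαβ hC hS,
        mul_inv_cancel_right]
  · refine PresentedGroup.ext fun a => ?_
    fin_cases a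
    · change F (K T) = T
      rw [KT, FT]
    · change F (K w) = w
      rw [Kw, Fδ]

/-- `𝓑^*(n, m)` depends only on `n`. -/
theorem nonempty_BUpper_mulEquiv (hn : 0 < n) (hαβ : β * n = α * m + 1) :
    Nonempty (BUpper n m ≃* PresentedGroup (powerCommRels n)) := by
  let c : PresentedGroup (powerCommRels n) := PresentedGroup.of 0
  let w : PresentedGroup (powerCommRels n) := PresentedGroup.of 1
  -- Here `w` plays the part of the shift element D₀: when y = 1 the definitions of h and T reduce
  -- to D₀^n and D₀^α. The second generator `c` stands for sT.
  let h : PresentedGroup (powerCommRels n) := w ^ n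
  let T : PresentedGroup (powerCommRels n) := w ^ α
  let s : PresentedGroup (powerCommRels n) := c * T⁻¹
  have hc : Commute h c := by
    have := mk_eq_one (rels := powerCommRels n) rfl
    rw [map_mul, map_inv, mul_inv_eq_one, map_mul, map_mul, map_pow] at this
    exact this
  have hT : Commute h T := (Commute.refl w).pow_pow n α
  have hs : Commute h s := hc.mul_right hT.inv_right
  have hsT : s * T = c := inv_mul_cancel_right _ _
  let f : GenXZ n → PresentedGroup (powerCommRels n) := fun g => match g with
    | .x i => T ^ (i : ℕ) * s * (T ^ (i : ℕ))⁻¹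
    | .z => h ^ β * (c ^ m)⁻¹
  have hx : ∀ j < n, FreeGroup.lift f (letters GenXZ.x j) = T ^ j * s * (T ^ j)⁻¹ :=
    fun j hj => lift_letters f GenXZ.x hj
  have hy : T ^ n = 1 * h ^ α := by
    rw [one_mul, ← pow_mul, ← pow_mul, mul_comm]
  have hz : FreeGroup.lift f (FreeGroup.of GenXZ.z) * (s * T) ^ m = h ^ β := by
    rw [FreeGroup.lift_apply_of, hsT, inv_mul_cancel_right]
  let rels := {commRel n (letters GenXZ.x) 1 (FreeGroup.of (GenXZ.z : GenXZ n))} ∪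
    slideRels n m (letters GenXZ.x) 1 (FreeGroup.of (GenXZ.z : GenXZ n))
  have hf : ∀ r ∈ rels, FreeGroup.lift f r = 1 := by
    rintro r (rfl | hr)
    · rw [map_commRel, map_one]
      exact commRel_of_central hs hT hx hy hz
    · refine slideRels_of_central hn hs hT hx hy hz _ ?_
      have := map_mem_slideRels (FreeGroup.lift f) hr
      rwa [map_one] at this
  let F : PresentedGroup rels →* PresentedGroup (powerCommRels n) := PresentedGroup.toGroup hf
  let X : ℕ → PresentedGroup rels := fun i => PresentedGroup.mk rels (letters GenXZ.x i)
  let Z : PresentedGroup rels := PresentedGroup.of GenXZ.z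
  have hC : commRel n X 1 Z = 1 := by
    have := mk_eq_one (rels := rels) (Or.inl rfl)
    rwa [map_commRel, map_one] at this
  have hS : ∀ w ∈ slideRels n m X 1 Z, w = 1 := by
    have := slideRels_mk (rels := rels) (fun _ hr => Or.inr hr)
    rwa [map_one] at this
  have hDn : shiftElt n m X 1 Z ^ n = slideCenter n m X 1 Z := by
    rw [slideCenter, one_pow, mul_one]
  have hDα : shiftElt n m X 1 Z ^ α = unitShift n m α β X 1 Z := by
    rw [unitShift, one_pow, mul_one]
  let g : Fin 2 → PresentedGroup rels := ![X 0 * unitShift n m α β X 1 Z, shiftElt n m X 1 Z]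
  have hg : ∀ r ∈ powerCommRels n, FreeGroup.lift g r = 1 := by
    rintro r rfl
    simp only [map_mul, map_inv, map_pow, FreeGroup.lift_apply_of, mul_inv_eq_one]
    change shiftElt n m X 1 Z ^ n * (X 0 * unitShift n m α β X 1 Z) =
      _ * shiftElt n m X 1 Z ^ n
    rw [hDn]
    exact (slideCenter_commute_x hn hC hS hn).mul_right
      (slideCenter_commute_unitShift hn hC hS)
  let K : PresentedGroup (powerCommRels n) →* PresentedGroup rels := PresentedGroup.toGroup hg
  have Kc : K c = X 0 * unitShift n m α β X 1 Z := PresentedGroup.toGroup.of _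
  have Kw : K w = shiftElt n m X 1 Z := PresentedGroup.toGroup.of _
  have Kh : K h = slideCenter n m X 1 Z := by rw [map_pow, Kw, hDn]
  have KT : K T = unitShift n m α β X 1 Z := by rw [map_pow, Kw, hDα]
  have Ks : K s = X 0 := by rw [map_mul, map_inv, Kc, KT, mul_inv_cancel_right]
  have FZ : F Z = h ^ β * (c ^ m)⁻¹ := PresentedGroup.toGroup.of _
  have FT : F (unitShift n m α β X 1 Z) = T := by
    rw [map_unitShift, map_one]
    exact unitShift_of_central hn hαβ hs hT (x := fun i => F (X i)) hx hy hz
  have FD : F (shiftElt n m X 1 Z) = w := by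
    have := shiftElt_of_central hn hs hT (x := fun i => F (X i)) hx hy hz
    rw [← pow_mul, ← pow_mul, mul_comm n β, hαβ, pow_succ'] at this
    rw [map_shiftElt, map_one]
    exact mul_right_cancel this
  refine ⟨MonoidHom.toMulEquiv F K ?_ ?_⟩
  · refine PresentedGroup.ext fun a => ?_
    rcases a with i | _
    · change K (F (PresentedGroup.of (GenXZ.x i))) = _
      have : F (PresentedGroup.of (GenXZ.x i)) = T ^ (i : ℕ) * s * (T ^ (i : ℕ))⁻¹ :=
        PresentedGroup.toGroup.of _
      rw [this, map_mul, map_mul, map_inv, map_pow, KT, Ks,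
        ← eq_conj_unitShift hn hαβ hC hS i.2]
      change PresentedGroup.mk rels (letters GenXZ.x i) = _
      rw [letters_of_lt _ i.2]
      rfl
    · change K (F Z) = Z
      rw [FZ, map_mul, map_inv, map_pow K h, map_pow K c, Kh, Kc, ← z_mul_pow hn hαβ hC hS,
        mul_inv_cancel_right]
  · refine PresentedGroup.ext fun a => ?_
    fin_cases a
    · change F (K c) = c
      rw [Kc, map_mul, FT]
      have : F (X 0) = s := (hx 0 hn).trans (by simp)
      rw [this, hsT]
    · change F (K w) = w
      rw [Kw, FD]

/-! ### The toric case -/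

lemma map_cyclicWord {G : Type} [Group G] (φ : FreeGroup (GenX n) →* G) (j : ℕ) :
    φ (cyclicWord n m j) =
      ((List.range m).map fun l => φ (letters GenX.x ((j + l) % n))).prod := by
  simp [cyclicWord, map_list_prod, Function.comp_def]

lemma prod_conj_pow {G : Type} [Group G] {X : ℕ → G} {s T : G}
    (hX : ∀ j, X j = T ^ j * s * (T ^ j)⁻¹) (j l : ℕ) :
    ((List.range l).map fun i => X (j + i)).prod = T ^ j * (s * T) ^ l * (T ^ (j + l))⁻¹ := by
  induction l with
  | zero => simp
  | succ l ih =>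
    rw [List.range_succ, List.map_append, List.prod_append, ih, List.map_singleton,
      List.prod_singleton, hX, ← add_assoc, pow_succ (s * T), pow_succ T]
    group

lemma prod_add {G : Type} [Group G] (X : ℕ → G) (j a b : ℕ) :
    ((List.range (a + b)).map fun i => X (j + i)).prod =
      ((List.range a).map fun i => X (j + i)).prod *
        ((List.range b).map fun i => X (j + a + i)).prod := by
  rw [List.range_add, List.map_append, List.prod_append, List.map_map]
  simp [Function.comp_def, add_assoc]

lemma prod_mul_of_const {G : Type} [Group G] {X : ℕ → G} {a : ℕ} {D : G}
    (hD : ∀ j, ((List.range a).map fun i => X (j + i)).prod = D) (j l : ℕ) :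
    ((List.range (l * a)).map fun i => X (j + i)).prod = D ^ l := by
  induction l with
  | zero => simp
  | succ l ih => rw [Nat.succ_mul, prod_add, ih, hD, pow_succ]

/-- `𝓑(n, m)` is a torus knot group. -/
theorem nonempty_BToric_mulEquiv (hn : 0 < n) (hαβ : β * n = α * m + 1) :
    Nonempty (BToric n m ≃* PresentedGroup (torusRels n m)) := by
  let a : PresentedGroup (torusRels n m) := PresentedGroup.of 0
  let b : PresentedGroup (torusRels n m) := PresentedGroup.of 1
  have hab : a ^ n = b ^ m := by
    have := mk_eq_one (rels := torusRels n m) rfl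
    rw [map_mul, map_inv, mul_inv_eq_one, map_pow, map_pow] at this
    exact this
  -- In the dictionary, `a` is the common value of the cyclic words of length m and `b` is the full
  -- product x_1 ⋯ x_n.
  let T : PresentedGroup (torusRels n m) := a ^ α
  let s : PresentedGroup (torusRels n m) := b ^ β * T⁻¹
  have hsT : s * T = b ^ β := inv_mul_cancel_right _ _
  have hTn : Commute (T ^ n) s := by
    refine Commute.mul_right ?_ ((Commute.refl T).pow_left n).inv_right
    rw [← pow_mul, mul_comm, pow_mul, hab, ← pow_mul]
    exact (Commute.refl b).pow_pow _ _
  -- T^n = a^{αn} = b^{αm} commutes with s = b^β T⁻¹, so the conjugates of s by powers of T form a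
  -- sequence of period n.
  have hper : ∀ j : ℕ, T ^ (j % n) * s * (T ^ (j % n))⁻¹ = T ^ j * s * (T ^ j)⁻¹ := by
    intro j
    conv_rhs => rw [← Nat.mod_add_div j n, pow_add, pow_mul]
    have := (hTn.pow_left (j / n)).eq
    rw [mul_assoc _ _ s, this]
    group
  let f : GenX n → PresentedGroup (torusRels n m) := fun g => match g with
    | .x i => T ^ (i : ℕ) * s * (T ^ (i : ℕ))⁻¹
  have hx : ∀ j, FreeGroup.lift f (letters GenX.x (j % n)) = T ^ j * s * (T ^ j)⁻¹ :=
    fun j => (lift_letters f GenX.x (Nat.mod_lt j hn)).trans (hper j)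
  have hsT' : ∀ i, (s * T) ^ i = b ^ (β * i) := fun i => by rw [hsT, ← pow_mul]
  have hword : ∀ j, FreeGroup.lift f (cyclicWord n m j) = a := by
    intro j
    rw [map_cyclicWord, prod_conj_pow hx, hsT', mul_comm β m, pow_mul, ← hab, ← pow_mul, ← pow_mul,
      ← pow_mul, ← pow_add, mul_comm n β, hαβ, ← div_eq_mul_inv, div_eq_iff_eq_mul, ← pow_succ']
    congr 1
    ring
  let rels := {w : FreeGroup (GenX n) | ∃ i j : ℕ, i < j ∧ j < n ∧
    w = cyclicWord n m i * (cyclicWord n m j)⁻¹}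
  have hf : ∀ r ∈ rels, FreeGroup.lift f r = 1 := by
    rintro r ⟨i, j, -, -, rfl⟩
    rw [map_mul, map_inv, hword, hword, mul_inv_cancel]
  let F : PresentedGroup rels →* PresentedGroup (torusRels n m) := PresentedGroup.toGroup hf
  let X : ℕ → PresentedGroup rels := fun i => PresentedGroup.mk rels (letters GenX.x (i % n))
  let D : PresentedGroup rels := ((List.range m).map fun i => X (0 + i)).prod
  let E : PresentedGroup rels := ((List.range n).map fun i => X (0 + i)).prod
  have hXn : ∀ j, X (j % n) = X j := fun j => by simp only [X, Nat.mod_mod]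
  have hD : ∀ j, ((List.range m).map fun i => X (j + i)).prod = D := by
    intro j
    have h1 : ((List.range m).map fun i => X (j + i)) =
        ((List.range m).map fun i => X (j % n + i)) := by
      refine List.map_congr_left fun i _ => ?_
      simp only [X, Nat.mod_add_mod]
    have h2 : ∀ i, ((List.range m).map fun l => X (i + l)).prod =
        PresentedGroup.mk rels (cyclicWord n m i) := fun i => (map_cyclicWord _ i).symm
    rw [h1]
    change _ = ((List.range m).map fun i => X (0 + i)).prod
    rw [h2, h2]
    rcases Nat.eq_zero_or_pos (j % n) with h | h
    · rw [h]
    · have := mk_eq_one (rels := rels) ⟨0, j % n, h, Nat.mod_lt j hn, rfl⟩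
      rw [map_mul, map_inv, mul_inv_eq_one] at this
      exact this.symm
  have hE : ∀ l, ((List.range (l * n)).map fun i => X (0 + i)).prod = E ^ l := by
    intro l
    induction l with
    | zero => simp
    | succ l ih =>
      rw [Nat.succ_mul, prod_add, ih, pow_succ]
      congr 2
      refine List.map_congr_left fun i _ => ?_
      rw [← hXn, zero_add, add_comm, Nat.add_mul_mod_self_right, hXn, zero_add]
  -- The cyclic word of length nm can be cut into n blocks of length m or into m blocks of length n.
  have hDE : D ^ n = E ^ m := by
    rw [← prod_mul_of_const hD 0 n, mul_comm, hE]
  -- One letter followed by α blocks of length m is a word of length 1 + αm = βn.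
  have hstep : ∀ j, X j * D ^ α = ((List.range (β * n)).map fun i => X (j + i)).prod := by
    intro j
    rw [hαβ, add_comm, prod_add, prod_mul_of_const hD]
    simp
  -- The word of length αm + 1 starting at j + 1 can also be cut with its single letter last; that
  -- letter has index j + 1 + αm = j + βn, which is j modulo n.
  have hshift : ∀ j, X (j + 1) = D ^ α * X j * (D ^ α)⁻¹ := by
    intro j
    rw [eq_mul_inv_iff_mul_eq, hstep, hαβ, prod_add, prod_mul_of_const hD]
    simp only [List.range_one, List.map_singleton, List.prod_singleton, add_zero]
    rw [add_assoc, add_comm 1, ← hαβ, ← hXn, Nat.add_mul_mod_self_right, hXn]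
  have hX : ∀ j, X j = (D ^ α) ^ j * X 0 * ((D ^ α) ^ j)⁻¹ := by
    intro j
    induction j with
    | zero => simp
    | succ j ih => rw [hshift, ih, pow_succ']; group
  let g : Fin 2 → PresentedGroup rels := ![D, E]
  have hg : ∀ r ∈ torusRels n m, FreeGroup.lift g r = 1 := by
    rintro r rfl
    simp only [map_mul, map_inv, map_pow, FreeGroup.lift_apply_of, mul_inv_eq_one]
    exact hDE
  let K : PresentedGroup (torusRels n m) →* PresentedGroup rels := PresentedGroup.toGroup hg
  have Ka : K a = D := PresentedGroup.toGroup.of _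
  have Kb : K b = E := PresentedGroup.toGroup.of _
  have KT : K T = D ^ α := by rw [map_pow, Ka]
  have Ks : K s = X 0 := by
    rw [map_mul, map_inv, map_pow, Kb, KT, ← hE, ← hstep, mul_inv_cancel_right]
  have FX : ∀ j, F (X j) = T ^ j * s * (T ^ j)⁻¹ := hx
  have FD : F D = a := by
    have := hword 0
    rw [map_cyclicWord] at this
    rw [← this, map_list_prod, List.map_map]
    rfl
  have FE : F E = b := by
    rw [map_list_prod, List.map_map]
    change ((List.range n).map fun i => F (X (0 + i))).prod = b
    rw [prod_conj_pow FX, hsT', hαβ, zero_add, pow_zero, one_mul, ← pow_mul, mul_comm α n, pow_mul,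
      hab, ← pow_mul, mul_comm m α, pow_succ', mul_inv_cancel_right]
  refine ⟨MonoidHom.toMulEquiv F K ?_ ?_⟩
  · refine PresentedGroup.ext fun a => ?_
    rcases a with ⟨i⟩
    change K (F (PresentedGroup.of (GenX.x i))) = _
    have e : PresentedGroup.of (GenX.x i) = X i := by
      simp only [X, Nat.mod_eq_of_lt i.2, letters_of_lt _ i.2]
      rfl
    rw [e, FX, map_mul, map_mul, map_inv, map_pow, KT, Ks, ← hX]
    rfl
  · refine PresentedGroup.ext fun i => ?_
    fin_cases i
    · change F (K a) = a
      rw [Ka, FD]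
    · change F (K b) = b
      rw [Kb, FE]

theorem nonempty_torusRels_swap (n m : ℕ) :
    Nonempty (PresentedGroup (torusRels n m) ≃* PresentedGroup (torusRels m n)) := by
  have key : ∀ n m : ℕ, ∀ r ∈ torusRels n m, FreeGroup.lift
      (![PresentedGroup.of 1, PresentedGroup.of 0] : Fin 2 → PresentedGroup (torusRels m n)) r =
      1 := by
    rintro n m r rfl
    have := mk_eq_one (rels := torusRels m n) rfl
    rw [map_mul, map_inv, mul_inv_eq_one, map_pow, map_pow] at this
    simp only [map_mul, map_inv, map_pow, FreeGroup.lift_apply_of, mul_inv_eq_one]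
    exact this.symm
  refine ⟨MonoidHom.toMulEquiv (PresentedGroup.toGroup (key n m))
    (PresentedGroup.toGroup (key m n)) ?_ ?_⟩ <;>
  · refine PresentedGroup.ext fun i => ?_
    fin_cases i <;> simp

/-! ### The four cases of the braid group and the exchange of columns -/

lemma exists_bezout {n m : ℕ} (hn : 0 < n) (hm : 0 < m) (h : Nat.Coprime n m) :
    ∃ α β : ℕ, β * n = α * m + 1 := by
  rcases Nat.lt_or_ge 1 m with h1 | h1
  · obtain ⟨β, -, hβ⟩ := Nat.exists_mul_mod_eq_one_of_coprime h h1
    refine ⟨n * β / m, β, ?_⟩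
    have := Nat.div_add_mod (n * β) m
    rw [hβ] at this
    rw [mul_comm β, mul_comm _ m, this]
  · obtain rfl : m = 1 := by omega
    exact ⟨n - 1, 1, by omega⟩

namespace JReflectionData

lemma n_pos (P : JReflectionData) : 0 < P.n :=
  Nat.pos_of_mul_pos_left (lt_of_lt_of_le two_pos P.two_le_bn)

lemma b_pos (P : JReflectionData) : 0 < P.b :=
  Nat.pos_of_mul_pos_right (lt_of_lt_of_le two_pos P.two_le_bn)

lemma m_pos (P : JReflectionData) : 0 < P.m :=
  Nat.pos_of_mul_pos_left (lt_of_lt_of_le two_pos P.two_le_cm)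

lemma c_pos (P : JReflectionData) : 0 < P.c :=
  Nat.pos_of_mul_pos_right (lt_of_lt_of_le two_pos P.two_le_cm)

lemma exists_bezout (P : JReflectionData) : ∃ α β : ℕ, β * P.n = α * P.m + 1 :=
  JBraid.exists_bezout P.n_pos P.m_pos P.coprime

lemma braidGroup_both (P : JReflectionData) (hb : P.b ≠ 1) (hc : P.c ≠ 1) :
    Nonempty (P.braidGroup ≃* PresentedGroup freeCenterRels) := by
  obtain ⟨α, β, h⟩ := P.exists_bezout
  rw [braidGroup, if_neg hb, if_neg hc]
  exact nonempty_BBoth_mulEquiv P.n_pos h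

lemma braidGroup_lower (P : JReflectionData) (hb : P.b ≠ 1) (hc : P.c = 1) :
    Nonempty (P.braidGroup ≃* PresentedGroup (powerCommRels P.m)) := by
  obtain ⟨α, β, h⟩ := P.exists_bezout
  rw [braidGroup, if_neg hb, if_pos hc]
  exact nonempty_BLower_mulEquiv P.n_pos h

lemma braidGroup_upper (P : JReflectionData) (hb : P.b = 1) (hc : P.c ≠ 1) :
    Nonempty (P.braidGroup ≃* PresentedGroup (powerCommRels P.n)) := by
  obtain ⟨α, β, h⟩ := P.exists_bezout
  rw [braidGroup, if_pos hb, if_neg hc]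
  exact nonempty_BUpper_mulEquiv P.n_pos h

lemma braidGroup_toric (P : JReflectionData) (hb : P.b = 1) (hc : P.c = 1) :
    Nonempty (P.braidGroup ≃* PresentedGroup (torusRels P.n P.m)) := by
  obtain ⟨α, β, h⟩ := P.exists_bezout
  rw [braidGroup, if_pos hb, if_pos hc]
  exact nonempty_BToric_mulEquiv P.n_pos h

/-- The J-reflection group with the second and third columns exchanged. -/
def swap (P : JReflectionData) : JReflectionData :=
  ⟨P.k, P.c, P.m, P.b, P.n, P.two_le_k, P.two_le_cm, P.two_le_bn, P.coprime.symm⟩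

lemma braidGroup_swap (P : JReflectionData) : Nonempty (P.braidGroup ≃* P.swap.braidGroup) := by
  by_cases hb : P.b = 1 <;> by_cases hc : P.c = 1
  · obtain ⟨e⟩ := P.braidGroup_toric hb hc
    obtain ⟨e'⟩ := P.swap.braidGroup_toric hc hb
    obtain ⟨e''⟩ := nonempty_torusRels_swap P.n P.m
    exact ⟨(e.trans e'').trans e'.symm⟩
  · obtain ⟨e⟩ := P.braidGroup_upper hb hc
    obtain ⟨e'⟩ := P.swap.braidGroup_lower hc hb
    exact ⟨e.trans e'.symm⟩
  · obtain ⟨e⟩ := P.braidGroup_lower hb hc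
    obtain ⟨e'⟩ := P.swap.braidGroup_upper hc hb
    exact ⟨e.trans e'.symm⟩
  · obtain ⟨e⟩ := P.braidGroup_both hb hc
    obtain ⟨e'⟩ := P.swap.braidGroup_both hc hb
    exact ⟨e.trans e'.symm⟩

end JReflectionData

/-! ### The ambient J-group: central element, characters and classes of reflections -/

namespace JReflectionData

variable (P : JReflectionData)

/-- The ambient J-group of a J-reflection group. -/
abbrev Amb : Type := J P.k (P.b * P.n) (P.c * P.m)

/-- The orders `k, b, c` of the three basic reflections. -/
def ord : JGen → ℕ
  | .s => P.k
  | .t => P.b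
  | .u => P.c

/-- The exponents `1, n, m` such that the basic reflections are `s`, `t ^ n`, `u ^ m`. -/
def expo : JGen → ℕ
  | .s => 1
  | .t => P.n
  | .u => P.m

/-- The orders `k, bn, cm` of the generators. -/
def modulus : JGen → ℕ
  | .s => P.k
  | .t => P.b * P.n
  | .u => P.c * P.m

lemma modulus_eq (i : JGen) : P.modulus i = P.ord i * P.expo i := by
  cases i <;> simp [modulus, ord, expo]

lemma expo_pos (i : JGen) : 0 < P.expo i := by
  cases i
  exacts [one_pos, P.n_pos, P.m_pos]

lemma ord_pos (i : JGen) : 0 < P.ord i := by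
  cases i
  exacts [lt_of_lt_of_le two_pos P.two_le_k, P.b_pos, P.c_pos]

/-- The canonical generators of the ambient J-group. -/
def gen (i : JGen) : P.Amb := PresentedGroup.of i

/-- The three basic reflections. -/
def refl (i : JGen) : P.Amb := P.gen i ^ P.expo i

lemma gen_pow (i : JGen) : P.gen i ^ P.modulus i = 1 := by
  have h : ∀ r ∈ jRels P.k (P.b * P.n) (P.c * P.m), PresentedGroup.mk _ r = (1 : P.Amb) :=
    fun r hr => mk_eq_one hr
  cases i
  · exact h _ (Or.inl rfl)
  · exact h _ (Or.inr (Or.inl rfl))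
  · exact h _ (Or.inr (Or.inr (Or.inl rfl)))

lemma refl_pow_ord (i : JGen) : P.refl i ^ P.ord i = 1 := by
  rw [refl, ← pow_mul, mul_comm (P.expo i), ← modulus_eq, gen_pow]

/-- The central element `stu`. -/
def delta : P.Amb := P.gen .s * P.gen .t * P.gen .u

lemma delta_eq_tus : P.delta = P.gen .t * P.gen .u * P.gen .s := by
  have := mk_eq_one (rels := jRels P.k (P.b * P.n) (P.c * P.m))
    (Or.inr (Or.inr (Or.inr (Or.inl rfl))))
  rw [map_mul, map_inv, mul_inv_eq_one] at this
  exact this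

lemma delta_eq_ust : P.delta = P.gen .u * P.gen .s * P.gen .t := by
  have := mk_eq_one (rels := jRels P.k (P.b * P.n) (P.c * P.m))
    (Or.inr (Or.inr (Or.inr (Or.inr rfl))))
  rw [map_mul, map_inv, mul_inv_eq_one] at this
  exact P.delta_eq_tus.trans this

lemma closure_gen : Subgroup.closure (Set.range P.gen) = ⊤ :=
  PresentedGroup.closure_range_of _

lemma delta_commute (g : P.Amb) : Commute P.delta g := by
  have hs : Commute P.delta (P.gen .s) := by
    change P.delta * _ = _ * P.delta
    nth_rw 2 [delta_eq_tus]
    simp only [delta, mul_assoc]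
  have ht : Commute P.delta (P.gen .t) := by
    change P.delta * _ = _ * P.delta
    rw [delta_eq_tus]
    nth_rw 2 [← delta_eq_tus]
    rw [delta_eq_ust]
    simp only [mul_assoc]
  have hu : Commute P.delta (P.gen .u) := by
    change P.delta * _ = _ * P.delta
    rw [delta_eq_ust]
    nth_rw 2 [← delta_eq_ust]
    simp only [delta, mul_assoc]
  have hg : g ∈ Subgroup.closure (Set.range P.gen) := by rw [closure_gen]; trivial
  induction hg using Subgroup.closure_induction with
  | mem x hx =>
    obtain ⟨i, rfl⟩ := hx
    cases i
    exacts [hs, ht, hu]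
  | one => exact Commute.one_right _
  | mul x y _ _ hx hy => exact hx.mul_right hy
  | inv x _ hx => exact hx.inv_right

/-- The characters of the ambient J-group that detect the three classes of reflections. -/
noncomputable def chi (i : JGen) : P.Amb →* Multiplicative (ZMod (P.modulus i)) := by
  classical
  exact PresentedGroup.toGroup (rels := jRels P.k (P.b * P.n) (P.c * P.m))
    (f := fun j => if j = i then Multiplicative.ofAdd 1 else 1) (by
      intro r hr
      simp only [jRels, Set.mem_insert_iff, Set.mem_singleton_iff] at hr
      have h0 : (Multiplicative.ofAdd (1 : ZMod (P.modulus i))) ^ P.modulus i = 1 := by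
        rw [← ofAdd_nsmul]; simp
      rcases hr with rfl | rfl | rfl | rfl | rfl
      · rw [map_pow, FreeGroup.lift_apply_of]
        split_ifs with h
        · subst h; exact h0
        · simp
      · rw [map_pow, FreeGroup.lift_apply_of]
        split_ifs with h
        · subst h; exact h0
        · simp
      · rw [map_pow, FreeGroup.lift_apply_of]
        split_ifs with h
        · subst h; exact h0
        · simp
      · simp only [map_mul, map_inv, FreeGroup.lift_apply_of, mul_inv_eq_one]
        ac_rfl
      · simp only [map_mul, map_inv, FreeGroup.lift_apply_of, mul_inv_eq_one]
        ac_rfl)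

lemma chi_gen_self (i : JGen) : P.chi i (P.gen i) = Multiplicative.ofAdd 1 := by
  refine (PresentedGroup.toGroup.of _).trans ?_
  simp

lemma chi_gen_of_ne {i j : JGen} (h : j ≠ i) : P.chi i (P.gen j) = 1 := by
  refine (PresentedGroup.toGroup.of _).trans ?_
  simp [h]

lemma chi_conj (i : JGen) (g a : P.Amb) : P.chi i (g * a * g⁻¹) = P.chi i a := by
  rw [map_mul, map_mul, map_inv, mul_comm (P.chi i g), mul_inv_cancel_right]

lemma chi_refl_of_ne {i j : JGen} (h : j ≠ i) (e : ℤ) : P.chi i (P.refl j ^ e) = 1 := by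
  rw [refl, map_zpow, map_pow, P.chi_gen_of_ne h, one_pow, one_zpow]

lemma ofAdd_one_zpow (N : ℕ) (e : ℤ) :
    (Multiplicative.ofAdd (1 : ZMod N)) ^ e = 1 ↔ (N : ℤ) ∣ e := by
  rw [← ofAdd_zsmul, ofAdd_eq_one, zsmul_one, ZMod.intCast_zmod_eq_zero_iff_dvd]

lemma chi_refl_eq_one_iff (i : JGen) (e : ℤ) :
    P.chi i (P.refl i ^ e) = 1 ↔ (P.ord i : ℤ) ∣ e := by
  rw [refl, map_zpow, map_pow, chi_gen_self, ← zpow_natCast, ← zpow_mul, ofAdd_one_zpow,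
    modulus_eq, mul_comm (P.ord i), Nat.cast_mul]
  exact mul_dvd_mul_iff_left (by exact_mod_cast (P.expo_pos i).ne')

/-- The relators bound the order from above and the abelian character `chi` bounds it from below, so
no finer knowledge of the J-group is needed. -/
lemma refl_zpow_eq_one_iff (i : JGen) (e : ℤ) : P.refl i ^ e = 1 ↔ (P.ord i : ℤ) ∣ e := by
  refine ⟨fun h => ?_, ?_⟩
  · rw [← chi_refl_eq_one_iff, h, map_one]
  · rintro ⟨d, rfl⟩
    rw [zpow_mul, zpow_natCast, refl_pow_ord, one_zpow]

lemma mem_basic_iff (a : P.Amb) :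
    a ∈ J.basic P.k (P.b * P.n) (P.c * P.m) 1 P.n P.m ↔ ∃ i, a = P.refl i := by
  constructor
  · rintro (rfl | rfl | rfl)
    exacts [⟨.s, rfl⟩, ⟨.t, rfl⟩, ⟨.u, rfl⟩]
  · rintro ⟨i, rfl⟩
    cases i
    exacts [Or.inl rfl, Or.inr (Or.inl rfl), Or.inr (Or.inr rfl)]

instance : P.W.Normal := Subgroup.normalClosure_normal

lemma refl_mem (i : JGen) : P.refl i ∈ P.W :=
  Subgroup.subset_normalClosure ((P.mem_basic_iff _).2 ⟨i, rfl⟩)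

/-- The conjugates of the non-trivial powers of one of the basic reflections. -/
def cls (i : JGen) : Set P.W :=
  {h | ∃ g : P.Amb, ∃ e : ℤ, P.refl i ^ e ≠ 1 ∧ (h : P.Amb) = g * P.refl i ^ e * g⁻¹}

lemma mem_R_iff (h : P.W) : h ∈ P.R ↔ ∃ i, h ∈ P.cls i := by
  constructor
  · rintro ⟨g, a, ha, e, he, hh⟩
    obtain ⟨i, rfl⟩ := (P.mem_basic_iff a).1 ha
    exact ⟨i, g, e, he, hh⟩
  · rintro ⟨i, g, e, he, hh⟩
    exact ⟨g, P.refl i, (P.mem_basic_iff _).2 ⟨i, rfl⟩, e, he, hh⟩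

lemma chi_of_mem_cls {i : JGen} {r : P.W} (hr : r ∈ P.cls i) : P.chi i r ≠ 1 := by
  obtain ⟨g, e, he, hh⟩ := hr
  rw [hh, chi_conj]
  rwa [Ne, chi_refl_eq_one_iff, ← refl_zpow_eq_one_iff]

lemma chi_of_mem_cls_of_ne {i j : JGen} (hij : i ≠ j) {r : P.W} (hr : r ∈ P.cls i) :
    P.chi j r = 1 := by
  obtain ⟨g, e, he, hh⟩ := hr
  rw [hh, chi_conj, P.chi_refl_of_ne hij]

lemma cls_disjoint {i j : JGen} {r : P.W} (hi : r ∈ P.cls i) (hj : r ∈ P.cls j) : i = j := by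
  by_contra h
  exact P.chi_of_mem_cls hj (P.chi_of_mem_cls_of_ne h hi)

lemma reflW_mem_cls {i : JGen} (hi : 2 ≤ P.ord i) :
    (⟨P.refl i, P.refl_mem i⟩ : P.W) ∈ P.cls i := by
  refine ⟨1, 1, ?_, by simp⟩
  rw [Ne, refl_zpow_eq_one_iff]
  intro h
  have := Int.le_of_dvd one_pos h
  omega

lemma cls_empty {i : JGen} (hi : P.ord i = 1) : P.cls i = ∅ := by
  rw [Set.eq_empty_iff_forall_notMem]
  rintro r ⟨g, e, he, -⟩
  exact he ((P.refl_zpow_eq_one_iff i e).2 (by simp [hi]))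

lemma two_le_ord_of_mem {i : JGen} {r : P.W} (hr : r ∈ P.cls i) : 2 ≤ P.ord i := by
  by_contra h
  have h1 : P.ord i = 1 := by have := P.ord_pos i; omega
  rw [P.cls_empty h1] at hr
  exact hr

lemma pow_ord_of_mem_cls {i : JGen} {r : P.W} (hr : r ∈ P.cls i) : r ^ P.ord i = 1 := by
  obtain ⟨g, e, -, hh⟩ := hr
  refine Subtype.ext ?_
  rw [Subgroup.coe_pow, hh, conj_pow, ← zpow_natCast, ← zpow_mul, mul_comm e, zpow_mul,
    zpow_natCast, refl_pow_ord, one_zpow, mul_one, mul_inv_cancel, Subgroup.coe_one]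

/-! ### The ambient group is generated by the J-reflection group and the central element -/

/-- In the quotient by `P.W` the generator s dies, and stu = ust then says that t and u commute. -/
lemma exists_delta_pow (i : ℕ) : (QuotientGroup.mk P.delta : P.Amb ⧸ P.W) ^ i =
    (QuotientGroup.mk (P.gen .t)) ^ i * (QuotientGroup.mk (P.gen .u)) ^ i := by
  have hs : (QuotientGroup.mk (P.gen .s) : P.Amb ⧸ P.W) = 1 := by
    rw [QuotientGroup.eq_one_iff]
    have := P.refl_mem .s
    rwa [refl, expo, pow_one] at this
  have h1 : (QuotientGroup.mk P.delta : P.Amb ⧸ P.W) =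
      QuotientGroup.mk (P.gen .t) * QuotientGroup.mk (P.gen .u) := by
    rw [delta, QuotientGroup.mk_mul, QuotientGroup.mk_mul, hs, one_mul]
  have h2 : (QuotientGroup.mk P.delta : P.Amb ⧸ P.W) =
      QuotientGroup.mk (P.gen .u) * QuotientGroup.mk (P.gen .t) := by
    rw [delta_eq_ust, QuotientGroup.mk_mul, QuotientGroup.mk_mul, hs, mul_one]
  have hc : Commute (QuotientGroup.mk (P.gen .t) : P.Amb ⧸ P.W) (QuotientGroup.mk (P.gen .u)) :=
    h1.symm.trans h2
  rw [h1, hc.mul_pow]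

lemma mk_gen_pow (i : JGen) : (QuotientGroup.mk (P.gen i) : P.Amb ⧸ P.W) ^ P.expo i = 1 := by
  rw [← QuotientGroup.mk_pow, QuotientGroup.eq_one_iff]
  exact P.refl_mem i

lemma pow_eq_of_modEq {G : Type*} [Group G] {a : G} {N i j : ℕ} (ha : a ^ N = 1)
    (h : i ≡ j [MOD N]) : a ^ i = a ^ j := by
  rw [← pow_mod_orderOf a i, ← pow_mod_orderOf a j]
  exact congrArg _ (h.of_dvd (orderOf_dvd_of_pow_eq_one ha))

/-- The quotient by `P.W` is abelian, generated by t and u with t^n = u^m = 1. Since n and m are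
coprime, the Chinese remainder theorem exhibits both as powers of δ = tu. -/
lemma exists_eq_mul_delta (g : P.Amb) : ∃ w : P.W, ∃ i : ℤ, g = w * P.delta ^ i := by
  have hcl : Subgroup.closure (Set.range P.gen) ≤
      (Subgroup.zpowers (QuotientGroup.mk P.delta : P.Amb ⧸ P.W)).comap
        (QuotientGroup.mk' P.W) := by
    rw [Subgroup.closure_le]
    rintro _ ⟨i, rfl⟩
    change QuotientGroup.mk (P.gen i) ∈ Subgroup.zpowers (QuotientGroup.mk P.delta : P.Amb ⧸ P.W)
    have ht := P.mk_gen_pow .t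
    have hu := P.mk_gen_pow .u
    cases i
    · have := P.mk_gen_pow .s
      rw [expo, pow_one] at this
      rw [this]
      exact Subgroup.one_mem _
    · obtain ⟨i, h1, h2⟩ := Nat.chineseRemainder P.coprime 1 0
      have := P.exists_delta_pow i
      rw [pow_eq_of_modEq ht h1, pow_eq_of_modEq hu h2, pow_one, pow_zero, mul_one] at this
      exact ⟨i, by simpa using this⟩
    · obtain ⟨i, h1, h2⟩ := Nat.chineseRemainder P.coprime 0 1
      have := P.exists_delta_pow i
      rw [pow_eq_of_modEq ht h1, pow_eq_of_modEq hu h2, pow_one, pow_zero, one_mul] at this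
      exact ⟨i, by simpa using this⟩
  rw [closure_gen] at hcl
  obtain ⟨i, hi⟩ := hcl (Subgroup.mem_top g)
  have hi' : (QuotientGroup.mk (P.delta ^ i) : P.Amb ⧸ P.W) = QuotientGroup.mk g := hi
  have hw : g * (P.delta ^ i)⁻¹ ∈ P.W := by
    rw [← QuotientGroup.eq_one_iff, QuotientGroup.mk_mul, QuotientGroup.mk_inv, hi',
      mul_inv_cancel]
  exact ⟨⟨_, hw⟩, i, by simp⟩

lemma delta_pow_mem : P.delta ^ (P.n * P.m) ∈ P.W := by
  rw [← QuotientGroup.eq_one_iff, QuotientGroup.mk_pow, exists_delta_pow, pow_mul, mul_comm P.n P.m,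
    pow_mul]
  have ht := P.mk_gen_pow .t
  have hu := P.mk_gen_pow .u
  change _ ^ P.n = 1 at ht
  change _ ^ P.m = 1 at hu
  rw [ht, hu, one_pow, one_pow, mul_one]

/-- The character of t sends `P.W` into the multiples of n and δ to 1, so n divides i; likewise m
divides i by the character of u, and coprimality combines the two. -/
lemma dvd_of_delta_zpow_mem {i : ℤ} (hi : P.delta ^ i ∈ P.W) : ((P.n * P.m : ℕ) : ℤ) ∣ i := by
  have hW : ∀ j, P.W ≤ (Subgroup.zpowers (Multiplicative.ofAdd (1 : ZMod (P.modulus j)) ^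
      P.expo j)).comap (P.chi j) := by
    intro j
    refine Subgroup.normalClosure_le_normal ?_
    intro a ha
    obtain ⟨l, rfl⟩ := (P.mem_basic_iff a).1 ha
    change P.chi j (P.refl l) ∈ Subgroup.zpowers (Multiplicative.ofAdd
      (1 : ZMod (P.modulus j)) ^ P.expo j)
    by_cases h : l = j
    · subst h
      rw [refl, map_pow, chi_gen_self]
      exact Subgroup.mem_zpowers _
    · have := P.chi_refl_of_ne h 1
      rw [zpow_one] at this
      rw [this]
      exact Subgroup.one_mem _
  have hdvd : ∀ j, P.chi j P.delta = Multiplicative.ofAdd 1 → (P.expo j : ℤ) ∣ i := by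
    intro j hj
    obtain ⟨e, he⟩ := hW j hi
    have he' : (Multiplicative.ofAdd (1 : ZMod (P.modulus j)) ^ P.expo j) ^ e =
        P.chi j (P.delta ^ i) := he
    rw [map_zpow, hj, ← zpow_natCast, ← zpow_mul, ← mul_inv_eq_one, ← zpow_neg, ← zpow_add,
      ofAdd_one_zpow, modulus_eq, Nat.cast_mul] at he'
    have h1 : (P.expo j : ℤ) ∣ P.expo j * e + -i := (Dvd.intro_left _ rfl).trans he'
    have h2 := (Int.dvd_add_right (Dvd.intro _ rfl)).1 h1
    exact (Int.dvd_neg).1 h2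
  have h1 := hdvd .t (by
    rw [delta, map_mul, map_mul, chi_gen_self, P.chi_gen_of_ne (by simp),
      P.chi_gen_of_ne (by simp), one_mul, mul_one])
  have h2 := hdvd .u (by
    rw [delta, map_mul, map_mul, chi_gen_self, P.chi_gen_of_ne (by simp),
      P.chi_gen_of_ne (by simp), one_mul, one_mul])
  rw [Nat.cast_mul]
  exact (Nat.isCoprime_iff_coprime.2 P.coprime).mul_dvd h1 h2

/-- Since J = W⟨δ⟩ with δ central, conjugation by J is already realised inside `P.W`. The classes
are thus intrinsic to `P.W`. -/
lemma conj_eq_conj_W (a g : P.Amb) : ∃ w : P.W, g * a * g⁻¹ = w * a * (w : P.Amb)⁻¹ := by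
  obtain ⟨w, i, rfl⟩ := P.exists_eq_mul_delta g
  refine ⟨w, ?_⟩
  have := ((P.delta_commute a).zpow_left i).eq
  rw [mul_assoc (w : P.Amb) _ a, this]
  group

/-! ### Reflection isomorphisms permute the classes -/

/-- Two reflections are related when their product is, modulo commutators, trivial or a
reflection. -/
def SameClass (r r' : P.W) : Prop :=
  ∃ q : P.W, (q = 1 ∨ q ∈ P.R) ∧ r * r' * q⁻¹ ∈ commutator P.W

/-- Modulo commutators both reflections are powers of the same basic reflection, so their product is
again such a power, possibly trivial. -/
lemma sameClass_of_mem {i : JGen} {r r' : P.W} (hr : r ∈ P.cls i) (hr' : r' ∈ P.cls i) :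
    P.SameClass r r' := by
  obtain ⟨g, e, he, hh⟩ := hr
  obtain ⟨g', e', he', hh'⟩ := hr'
  obtain ⟨w, hw⟩ := P.conj_eq_conj_W (P.refl i ^ e) g
  obtain ⟨w', hw'⟩ := P.conj_eq_conj_W (P.refl i ^ e') g'
  let a : P.W := ⟨P.refl i, P.refl_mem i⟩
  have h1 : r = w * a ^ e * w⁻¹ := Subtype.ext (by rw [hh, hw]; simp [a])
  have h2 : r' = w' * a ^ e' * w'⁻¹ := Subtype.ext (by rw [hh', hw']; simp [a])
  refine ⟨a ^ (e + e'), ?_, ?_⟩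
  · by_cases h : P.refl i ^ (e + e') = 1
    · exact Or.inl (Subtype.ext (by simpa [a] using h))
    · exact Or.inr ((P.mem_R_iff _).2 ⟨i, 1, e + e', h, by simp [a]⟩)
  · rw [← QuotientGroup.eq_one_iff (N := commutator P.W)]
    have q1 : Abelianization.of r = Abelianization.of a ^ e := by
      rw [h1, map_mul, map_mul, map_inv, mul_comm (Abelianization.of w), mul_inv_cancel_right,
        map_zpow]
    have q2 : Abelianization.of r' = Abelianization.of a ^ e' := by
      rw [h2, map_mul, map_mul, map_inv, mul_comm (Abelianization.of w'), mul_inv_cancel_right,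
        map_zpow]
    change Abelianization.of (r * r' * (a ^ (e + e'))⁻¹) = 1
    rw [map_mul, map_mul, map_inv, q1, q2, map_zpow, zpow_add, mul_inv_cancel]

lemma chi_eq_one_of_mem_commutator (i : JGen) {w : P.W} (hw : w ∈ commutator P.W) :
    P.chi i w = 1 := by
  have := Abelianization.commutator_subset_ker ((P.chi i).comp P.W.subtype) hw
  exact this

/-- A product of reflections from two different classes is detected by two of the characters `chi`,
whereas a reflection is detected by one only and the identity by none. -/
lemma eq_of_sameClass {i j : JGen} {r r' : P.W} (hr : r ∈ P.cls i) (hr' : r' ∈ P.cls j)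
    (h : P.SameClass r r') : i = j := by
  by_contra hij
  obtain ⟨q, hq, hc⟩ := h
  have key : ∀ l, P.chi l q = P.chi l r * P.chi l r' := by
    intro l
    have := P.chi_eq_one_of_mem_commutator l hc
    rw [Subgroup.coe_mul, Subgroup.coe_mul, map_mul, map_mul, Subgroup.coe_inv, map_inv,
      mul_inv_eq_one] at this
    exact this.symm
  have hi : P.chi i q ≠ 1 := by
    rw [key, P.chi_of_mem_cls_of_ne (Ne.symm hij) hr', mul_one]
    exact P.chi_of_mem_cls hr
  have hj : P.chi j q ≠ 1 := by
    rw [key, P.chi_of_mem_cls_of_ne hij hr, one_mul]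
    exact P.chi_of_mem_cls hr'
  rcases hq with rfl | hq
  · exact hi (by simp)
  · obtain ⟨l, hl⟩ := (P.mem_R_iff q).1 hq
    have h1 : l = i := by
      by_contra h
      exact hi (P.chi_of_mem_cls_of_ne h hl)
    have h2 : l = j := by
      by_contra h
      exact hj (P.chi_of_mem_cls_of_ne h hl)
    exact hij (h1.symm.trans h2)

variable {P} {Q : JReflectionData}

lemma SameClass.map {f : P.W ≃* Q.W} (hf : f '' P.R = Q.R) {r r' : P.W}
    (h : P.SameClass r r') : Q.SameClass (f r) (f r') := by
  obtain ⟨q, hq, hc⟩ := h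
  refine ⟨f q, ?_, ?_⟩
  · rcases hq with rfl | hq
    · exact Or.inl (map_one f)
    · exact Or.inr (hf ▸ Set.mem_image_of_mem f hq)
  · rw [← map_inv, ← map_mul, ← map_mul]
    have : (commutator P.W).map f.toMonoidHom ≤ commutator Q.W := by
      rw [commutator_def, Subgroup.map_commutator]
      exact Subgroup.commutator_mono le_top le_top
    exact this (Subgroup.mem_map_of_mem _ hc)

lemma image_symm_R {f : P.W ≃* Q.W} (hf : f '' P.R = Q.R) : f.symm '' Q.R = P.R := by
  rw [← hf, ← Set.image_comp]
  simp

/-- `SameClass` is phrased through the group and its set of reflections alone, so it is transported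
by `f` and by its inverse; on reflections it is membership in a common class. -/
lemma exists_image_cls {f : P.W ≃* Q.W} (hf : f '' P.R = Q.R) {i : JGen} (hi : 2 ≤ P.ord i) :
    ∃ j, f '' P.cls i = Q.cls j ∧ 2 ≤ Q.ord j := by
  have ha := P.reflW_mem_cls hi
  have hfa : f ⟨P.refl i, P.refl_mem i⟩ ∈ Q.R :=
    hf ▸ Set.mem_image_of_mem f ((P.mem_R_iff _).2 ⟨i, ha⟩)
  obtain ⟨j, hj⟩ := (Q.mem_R_iff _).1 hfa
  refine ⟨j, Set.Subset.antisymm ?_ ?_, Q.two_le_ord_of_mem hj⟩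
  · rintro _ ⟨r, hr, rfl⟩
    have hfr : f r ∈ Q.R := hf ▸ Set.mem_image_of_mem f ((P.mem_R_iff _).2 ⟨i, hr⟩)
    obtain ⟨l, hl⟩ := (Q.mem_R_iff _).1 hfr
    rwa [Q.eq_of_sameClass hj hl ((P.sameClass_of_mem ha hr).map hf)]
  · intro q hq
    have hq' : f.symm q ∈ P.R :=
      image_symm_R hf ▸ Set.mem_image_of_mem f.symm ((Q.mem_R_iff _).2 ⟨j, hq⟩)
    obtain ⟨l, hl⟩ := (P.mem_R_iff _).1 hq'
    have := (Q.sameClass_of_mem hj hq).map (image_symm_R hf)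
    rw [MulEquiv.symm_apply_apply] at this
    have hil := P.eq_of_sameClass ha hl this
    exact ⟨f.symm q, hil ▸ hl, by simp⟩

lemma ord_dvd_of_image {f : P.W ≃* Q.W} {i j : JGen} (hi : 2 ≤ P.ord i)
    (hf : f '' P.cls i = Q.cls j) : P.ord i ∣ Q.ord j := by
  have ha := P.reflW_mem_cls hi
  have h1 := Q.pow_ord_of_mem_cls (hf ▸ Set.mem_image_of_mem f ha)
  rw [← map_pow, MulEquiv.map_eq_one_iff] at h1
  have h2 := congrArg Subtype.val h1
  have h3 : P.refl i ^ (Q.ord j : ℤ) = 1 := by rw [zpow_natCast]; exact h2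
  rw [refl_zpow_eq_one_iff] at h3
  exact_mod_cast h3

lemma image_symm_cls {f : P.W ≃* Q.W} {i j : JGen} (hf : f '' P.cls i = Q.cls j) :
    f.symm '' Q.cls j = P.cls i := by
  rw [← hf, ← Set.image_comp]
  simp

lemma ord_eq_of_image {f : P.W ≃* Q.W} {i j : JGen} (hi : 2 ≤ P.ord i)
    (hf : f '' P.cls i = Q.cls j) : P.ord i = Q.ord j := by
  have hj : 2 ≤ Q.ord j :=
    Q.two_le_ord_of_mem (hf ▸ Set.mem_image_of_mem f (P.reflW_mem_cls hi))
  exact Nat.dvd_antisymm (ord_dvd_of_image hi hf) (ord_dvd_of_image hj (image_symm_cls hf))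

end JReflectionData

/-! ### Companion operators on polynomials of bounded degree -/

open Polynomial

/-- The space of complex polynomials of degree less than `d`. -/
abbrev PolyLT (d : ℕ) : Type := ↥(degreeLT ℂ d)

section Companion

variable {d : ℕ}

lemma coeff_polyLT (f : PolyLT d) {i : ℕ} (hi : d ≤ i) : (f : ℂ[X]).coeff i = 0 :=
  coeff_eq_zero_of_degree_lt (lt_of_lt_of_le (mem_degreeLT.1 f.2) (by exact_mod_cast hi))

lemma mem_degreeLT_of_coeff {f : ℂ[X]} (h : ∀ i, d ≤ i → f.coeff i = 0) : f ∈ degreeLT ℂ d :=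
  mem_degreeLT.2 ((degree_lt_iff_coeff_zero f d).2 h)

lemma eq_zero_of_dvd_polyLT {P : ℂ[X]} (hd : P.natDegree = d) (hP : P.Monic)
    {f : PolyLT d} (h : P ∣ (f : ℂ[X])) : f = 0 := by
  refine Subtype.ext (eq_zero_of_dvd_of_degree_lt h ?_)
  rw [degree_eq_natDegree hP.ne_zero, hd]
  exact mem_degreeLT.1 f.2

/-- Multiplication by `X` modulo a monic polynomial `P` of degree `d`. -/
noncomputable def mulX (P : ℂ[X]) (hP : P.Monic) (hd : P.natDegree = d) :
    Module.End ℂ (PolyLT d) where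
  toFun f := ⟨X * (f : ℂ[X]) - C ((f : ℂ[X]).coeff (d - 1)) * P, mem_degreeLT_of_coeff (by
    intro i hi
    -- The case i = 0 occurs only for d = 0, when `d - 1` is truncated but the space is zero.
    rcases i with _ | i
    · have hf : f = 0 := eq_zero_of_dvd_polyLT hd hP (by
        rw [hP.natDegree_eq_zero.1 (by omega)]
        exact one_dvd _)
      simp [hf]
    · rw [coeff_sub, coeff_X_mul, coeff_C_mul]
      rcases Nat.lt_or_ge i d with h | h
      · have : i = d - 1 := by omega
        rw [this, show d - 1 + 1 = P.natDegree by omega, hP.coeff_natDegree, mul_one, sub_self]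
      · rw [coeff_polyLT f h, coeff_eq_zero_of_natDegree_lt (show P.natDegree < i + 1 by omega),
          mul_zero, sub_zero])⟩
  map_add' f g := Subtype.ext (by
    simp only [Submodule.coe_add, coeff_add, map_add]
    ring)
  map_smul' c f := Subtype.ext (by
    simp only [Submodule.coe_smul, RingHom.id_apply, smul_eq_C_mul, coeff_C_mul,
      map_mul]
    ring)

/-- The difference of two monic polynomials of degree `d`. -/
noncomputable def monicSub (P Q : ℂ[X]) (hP : P.Monic) (hd : P.natDegree = d) (hQ : Q.Monic)
    (hd' : Q.natDegree = d) : PolyLT d :=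
  ⟨P - Q, mem_degreeLT_of_coeff (by
    intro i hi
    rw [coeff_sub]
    rcases hi.eq_or_lt with h | h
    · rw [← h]
      nth_rw 1 [← hd]
      rw [← hd', hP.coeff_natDegree, hQ.coeff_natDegree, sub_self]
    · rw [coeff_eq_zero_of_natDegree_lt (by omega), coeff_eq_zero_of_natDegree_lt (by omega),
        sub_self])⟩

variable {P Q : ℂ[X]} {hP : P.Monic} {hd : P.natDegree = d} {hQ : Q.Monic} {hd' : Q.natDegree = d}

lemma mulX_apply (f : PolyLT d) :
    (mulX P hP hd f : ℂ[X]) = X * (f : ℂ[X]) - C ((f : ℂ[X]).coeff (d - 1)) * P := rfl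

/-- This congruence replaces computation in the quotient ring: evaluating a polynomial at `mulX` is
multiplication by it modulo `P`. -/
lemma dvd_aeval_mulX_sub (g : ℂ[X]) (f : PolyLT d) :
    P ∣ (aeval (mulX P hP hd) g f : PolyLT d) - g * (f : ℂ[X]) := by
  induction g using Polynomial.induction_on generalizing f with
  | C c =>
    have : (aeval (mulX P hP hd) (C c) f : PolyLT d) = c • f := by
      rw [aeval_C, Module.algebraMap_end_apply]
    rw [this, Submodule.coe_smul, smul_eq_C_mul, sub_self]
    exact dvd_zero _
  | add p q hp hq =>
    rw [map_add, LinearMap.add_apply, Submodule.coe_add]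
    convert dvd_add (hp f) (hq f) using 1
    ring
  | monomial n c ih =>
    rw [pow_succ, ← mul_assoc, map_mul, aeval_X, Module.End.mul_apply]
    have h1 := ih (mulX P hP hd f)
    rw [mulX_apply] at h1
    convert h1.sub (Dvd.intro_left (C c * X ^ n * C ((f : ℂ[X]).coeff (d - 1))) rfl) using 1
    ring

lemma mulX_pow_eq {a : ℕ} {c : ℂ} (h : P ∣ X ^ a - C c) :
    mulX P hP hd ^ a = algebraMap ℂ _ c := by
  refine LinearMap.ext fun f => ?_
  rw [← sub_eq_zero]
  refine eq_zero_of_dvd_polyLT hd hP ?_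
  have h1 := dvd_aeval_mulX_sub (hP := hP) (hd := hd) (X ^ a) f
  rw [map_pow, aeval_X] at h1
  have h2 := h1.add (h.mul_right (f : ℂ[X]))
  rw [Submodule.coe_sub, Module.algebraMap_end_apply, Submodule.coe_smul, smul_eq_C_mul]
  convert h2 using 1
  ring

lemma one_mem_polyLT (h0 : 0 < d) : (1 : ℂ[X]) ∈ degreeLT ℂ d :=
  mem_degreeLT.2 (by rw [degree_one]; exact_mod_cast h0)

lemma dvd_of_aeval_mulX (h0 : 0 < d) {g : ℂ[X]} (h : aeval (mulX P hP hd) g = 0) : P ∣ g := by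
  have h1 := dvd_aeval_mulX_sub (hP := hP) (hd := hd) g ⟨1, one_mem_polyLT h0⟩
  rw [h, LinearMap.zero_apply, Submodule.coe_zero, zero_sub, mul_one, dvd_neg] at h1
  exact h1

lemma aeval_mulX_self : aeval (mulX P hP hd) P = 0 := by
  refine LinearMap.ext fun f => eq_zero_of_dvd_polyLT hd hP ?_
  have h1 := dvd_aeval_mulX_sub (hP := hP) (hd := hd) P f
  exact (dvd_sub_left (Dvd.intro _ rfl)).1 h1

/-- `P` annihilates the conjugate operator `mulX Q`, and the annihilator of `mulX Q` consists of
multiples of `Q`; both are monic of the same degree. -/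
lemma eq_of_mulX_conj (h0 : 0 < d) (T : PolyLT d ≃ₗ[ℂ] PolyLT d)
    (hT : ∀ f, T (mulX P hP hd f) = mulX Q hQ hd' (T f)) : P = Q := by
  have key : ∀ g : ℂ[X], ∀ f, T (aeval (mulX P hP hd) g f) = aeval (mulX Q hQ hd') g (T f) := by
    intro g
    induction g using Polynomial.induction_on with
    | C c => intro f; simp [Module.algebraMap_end_apply]
    | add p q hp hq => intro f; simp only [map_add, LinearMap.add_apply, hp, hq]
    | monomial n c ih =>
      intro f
      rw [pow_succ, ← mul_assoc, map_mul (aeval (mulX P hP hd)) _ X,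
        map_mul (aeval (mulX Q hQ hd')) _ X, aeval_X, aeval_X, Module.End.mul_apply,
        Module.End.mul_apply, ih, hT]
  have h1 : aeval (mulX Q hQ hd') P = 0 := by
    refine LinearMap.ext fun f => ?_
    have := key P (T.symm f)
    rw [aeval_mulX_self, LinearMap.zero_apply, map_zero, LinearEquiv.apply_symm_apply] at this
    exact this.symm
  exact eq_of_monic_of_dvd_of_natDegree_le hQ hP (dvd_of_aeval_mulX h0 h1) (by omega)

lemma mulX_eq_add (f : PolyLT d) : mulX Q hQ hd' f =
    mulX P hP hd f + (f : ℂ[X]).coeff (d - 1) • monicSub P Q hP hd hQ hd' := by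
  refine Subtype.ext ?_
  simp only [mulX_apply, Submodule.coe_add, Submodule.coe_smul, monicSub, smul_eq_C_mul]
  ring

lemma coeff_zero_mulX (f : PolyLT d) :
    (mulX P hP hd f : ℂ[X]).coeff 0 = -((f : ℂ[X]).coeff (d - 1) * P.coeff 0) := by
  simp [mulX_apply]

/-- If the top coefficient always vanishes, no reduction modulo `P` ever takes place, and X^d f
would have degree less than d. -/
lemma eq_zero_of_coeff_mulX {f : PolyLT d}
    (h : ∀ i, ((mulX P hP hd ^ i) f : ℂ[X]).coeff (d - 1) = 0) : f = 0 := by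
  have key : ∀ i, ((mulX P hP hd ^ i) f : ℂ[X]) = X ^ i * (f : ℂ[X]) := by
    intro i
    induction i with
    | zero => simp
    | succ i ih =>
      rw [pow_succ', Module.End.mul_apply, mulX_apply, h, ih, pow_succ']
      simp [mul_assoc]
  by_contra hf
  have hf' : (f : ℂ[X]) ≠ 0 := fun h => hf (Subtype.ext h)
  have h1 := mem_degreeLT.1 ((mulX P hP hd ^ d) f).2
  rw [key, degree_mul, degree_X_pow, degree_eq_natDegree hf'] at h1
  have : d + (f : ℂ[X]).natDegree < d := by exact_mod_cast h1
  omega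

end Companion

/-! ### Rigidity of pairs of operators with rank one difference -/

section Levelt

variable {V : Type*} [AddCommGroup V] [Module ℂ V]

/-- The vector `w` is an eigenvector of `S` with eigenvalue `ζ`, so the contributions along `w` form
a geometric series. -/
lemma pow_apply_of_rank_one {S : Module.End ℂ V} {φ : V →ₗ[ℂ] ℂ} {w : V} {ζ : ℂ}
    (hS : ∀ x, S x = x + φ x • w) (hζ : φ w = ζ - 1) (e : ℕ) (x : V) :
    (S ^ e) x = x + ((∑ i ∈ Finset.range e, ζ ^ i) * φ x) • w := by
  induction e with
  | zero => simp
  | succ e ih =>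
    rw [pow_succ', Module.End.mul_apply, ih, hS, map_add, map_smul, hζ, Finset.sum_range_succ']
    rw [add_assoc, ← add_smul]
    congr 2
    have : ∑ i ∈ Finset.range e, ζ ^ (i + 1) = ζ * ∑ i ∈ Finset.range e, ζ ^ i := by
      rw [Finset.mul_sum]
      exact Finset.sum_congr rfl fun i _ => pow_succ' ζ i
    rw [this, smul_eq_mul, pow_zero]
    ring

/-- Two endomorphisms that differ by a rank one map `x ↦ φ x • w`, where no non-zero vector has
its whole orbit in the kernel of `φ`, are simultaneously conjugate to multiplications by `X`
modulo their characteristic polynomials. -/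
theorem exists_equiv_mulX [FiniteDimensional ℂ V] {d : ℕ} (h0 : 0 < d) (hV : Module.finrank ℂ V = d)
    {A B : Module.End ℂ V} {φ : V →ₗ[ℂ] ℂ} {w : V} (hB : ∀ x, B x = A x + φ x • w)
    (hobs : ∀ x, (∀ i : ℕ, φ ((A ^ i) x) = 0) → x = 0) :
    ∃ (P Q : ℂ[X]) (hP : P.Monic) (hd : P.natDegree = d) (hQ : Q.Monic) (hd' : Q.natDegree = d)
      (T : PolyLT d ≃ₗ[ℂ] V), (∀ f, T (mulX P hP hd f) = A (T f)) ∧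
        ∀ f, T (mulX Q hQ hd' f) = B (T f) := by
  have hP : A.charpoly.Monic := A.charpoly_monic
  have hd : A.charpoly.natDegree = d := by rw [LinearMap.charpoly_natDegree, hV]
  have hQ : B.charpoly.Monic := B.charpoly_monic
  have hd' : B.charpoly.natDegree = d := by rw [LinearMap.charpoly_natDegree, hV]
  have hPA : aeval A A.charpoly = 0 := LinearMap.aeval_self_charpoly A
  have hQB : aeval B B.charpoly = 0 := LinearMap.aeval_self_charpoly B
  have hsum : ∀ (E : Module.End ℂ V) (g : ℂ[X]), g ∈ degreeLT ℂ d → ∀ x,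
      aeval E g x = ∑ i ∈ Finset.range d, g.coeff i • (E ^ i) x := by
    intro E g hg x
    rw [aeval_eq_sum_range' (n := d)]
    · simp [LinearMap.sum_apply]
    · rcases eq_or_ne g 0 with rfl | h
      · simpa using h0
      · exact (natDegree_lt_iff_degree_lt h).2 (mem_degreeLT.1 hg)
  -- By Cayley-Hamilton the values of φ ∘ A^i for i < d determine all the others, so the hypothesis
  -- `hobs` makes `θ` injective and, by dimension, bijective.
  let θ : V →ₗ[ℂ] (Fin d → ℂ) := LinearMap.pi fun i => φ ∘ₗ (A ^ (i : ℕ))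
  have hθ : Function.Injective θ := by
    rw [injective_iff_map_eq_zero]
    intro x hx
    refine hobs x fun i => ?_
    have h1 : A ^ i = aeval A ((X ^ i : ℂ[X]) %ₘ A.charpoly) := by
      have := congrArg (aeval A) (modByMonic_add_div (X ^ i : ℂ[X]) A.charpoly)
      rw [map_add, map_mul, hPA, zero_mul, add_zero, map_pow, aeval_X] at this
      exact this.symm
    have h2 : (X ^ i : ℂ[X]) %ₘ A.charpoly ∈ degreeLT ℂ d := by
      rw [mem_degreeLT]
      refine lt_of_lt_of_eq (degree_modByMonic_lt _ hP) ?_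
      rw [degree_eq_natDegree hP.ne_zero, hd]
    rw [h1, hsum A _ h2, map_sum]
    refine Finset.sum_eq_zero fun j hj => ?_
    have h3 : φ ((A ^ j) x) = 0 := congrFun hx ⟨j, Finset.mem_range.1 hj⟩
    rw [map_smul, h3, smul_zero]
  have hθs : Function.Surjective θ :=
    (LinearMap.injective_iff_surjective_of_finrank_eq_finrank (by simp [hV])).1 hθ
  -- This `v` is a simultaneous cyclic vector: φ kills A^i v for i < d - 1, so A and B act
  -- identically along its orbit up to exponent d - 1. The map f ↦ f(A) v then agrees with f ↦ f(B)
  -- v in degree less than d.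
  obtain ⟨v, hv⟩ := hθs (Pi.single ⟨d - 1, by omega⟩ 1)
  have hv0 : ∀ i < d - 1, φ ((A ^ i) v) = 0 := by
    intro i hi
    have := congrFun hv ⟨i, by omega⟩
    rw [Pi.single_eq_of_ne (by simp [Fin.ext_iff]; omega)] at this
    exact this
  have hv1 : φ ((A ^ (d - 1)) v) = 1 := by
    have := congrFun hv ⟨d - 1, by omega⟩
    rw [Pi.single_eq_same] at this
    exact this
  have hAB : ∀ i ≤ d - 1, (B ^ i) v = (A ^ i) v := by
    intro i
    induction i with
    | zero => simp
    | succ i ih =>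
      intro hi
      rw [pow_succ', Module.End.mul_apply, ih (by omega), hB, hv0 i (by omega), zero_smul, add_zero,
        pow_succ', Module.End.mul_apply]
  have hAB' : ∀ f : PolyLT d, aeval B (f : ℂ[X]) v = aeval A (f : ℂ[X]) v := by
    intro f
    rw [hsum B _ f.2, hsum A _ f.2]
    refine Finset.sum_congr rfl fun i hi => ?_
    rw [hAB i (by have := Finset.mem_range.1 hi; omega)]
  let T₀ : PolyLT d →ₗ[ℂ] V :=
    (LinearMap.applyₗ v ∘ₗ (aeval A : ℂ[X] →ₐ[ℂ] Module.End ℂ V).toLinearMap) ∘ₗ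
      (degreeLT ℂ d).subtype
  have hT₀ : ∀ f, T₀ f = aeval A (f : ℂ[X]) v := fun f => rfl
  have hinj : Function.Injective T₀ := by
    rw [injective_iff_map_eq_zero]
    intro f hf
    by_contra hne
    have hf' : (f : ℂ[X]) ≠ 0 := fun h => hne (Subtype.ext h)
    have he : (f : ℂ[X]).natDegree < d := (natDegree_lt_iff_degree_lt hf').2 (mem_degreeLT.1 f.2)
    set e := (f : ℂ[X]).natDegree with he_def
    -- Applying A^{d-1-e} moves the leading term to exponent d - 1, the only one so far on which φ
    -- is non-zero, so φ reads off the leading coefficient.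
    have h1 : φ ((A ^ (d - 1 - e)) (T₀ f)) = (f : ℂ[X]).coeff e := by
      rw [hT₀, aeval_eq_sum_range, LinearMap.sum_apply, map_sum, map_sum,
        Finset.sum_range_succ, Finset.sum_eq_zero, zero_add]
      · rw [LinearMap.smul_apply, map_smul, map_smul, ← Module.End.mul_apply, ← pow_add,
          ← he_def, show d - 1 - e + e = d - 1 by omega, hv1, smul_eq_mul, mul_one]
      · intro j hj
        have := Finset.mem_range.1 hj
        rw [LinearMap.smul_apply, map_smul, map_smul, ← Module.End.mul_apply, ← pow_add,
          hv0 _ (by omega), smul_zero]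
    rw [hf, map_zero, map_zero] at h1
    exact hf' (leadingCoeff_eq_zero.1 h1.symm)
  have hdim : Module.finrank ℂ (PolyLT d) = Module.finrank ℂ V := by
    rw [hV, (degreeLTEquiv ℂ d).finrank_eq, Module.finrank_fin_fun]
  have : FiniteDimensional ℂ (PolyLT d) := (degreeLTEquiv ℂ d).symm.finiteDimensional
  refine ⟨_, _, hP, hd, hQ, hd', LinearEquiv.ofInjectiveOfFinrankEq T₀ hinj hdim, ?_, ?_⟩
  · intro f
    change T₀ _ = A (T₀ f)
    rw [hT₀, hT₀, mulX_apply, map_sub, map_mul, map_mul, hPA, mul_zero, sub_zero, aeval_X,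
      Module.End.mul_apply]
  · intro f
    change T₀ _ = B (T₀ f)
    rw [hT₀, hT₀, ← hAB', ← hAB', mulX_apply, map_sub, map_mul, map_mul, hQB, mul_zero, sub_zero,
      aeval_X, Module.End.mul_apply]

end Levelt

/-! ### Reflection representations and their number -/

/-- The general linear group of the space of polynomials of degree less than `d`. -/
abbrev GLd (d : ℕ) : Type := (Module.End ℂ (PolyLT d))ˣ

/-- Representations of dimension `d` in which the elements of `C` act by rank one perturbations of
the identity without a common non-zero fixed vector, and `Y` acts trivially. -/
structure IsReflRep {G : Type} [Group G] (d : ℕ) (C Y : Set G) (ρ : G →* GLd d) : Prop where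
  rank_le_one : ∀ r ∈ C, ∃ (φ : PolyLT d →ₗ[ℂ] ℂ) (w : PolyLT d),
    ∀ x, (ρ r : Module.End ℂ (PolyLT d)) x = x + φ x • w
  fixed_eq_zero : ∀ x, (∀ r ∈ C, (ρ r : Module.End ℂ (PolyLT d)) x = x) → x = 0
  map_eq_one : ∀ y ∈ Y, ρ y = 1

/-- Isomorphism of representations. -/
def RepIso {G : Type} [Group G] {d : ℕ} (ρ σ : G →* GLd d) : Prop :=
  ∃ T : PolyLT d ≃ₗ[ℂ] PolyLT d, ∀ g x,
    T ((ρ g : Module.End ℂ (PolyLT d)) x) = (σ g : Module.End ℂ (PolyLT d)) (T x)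

section RepIso

variable {G : Type} [Group G] {d : ℕ} {ρ σ τ : G →* GLd d}

lemma RepIso.refl (ρ : G →* GLd d) : RepIso ρ ρ := ⟨LinearEquiv.refl ℂ _, fun _ _ => rfl⟩

lemma RepIso.symm (h : RepIso ρ σ) : RepIso σ ρ := by
  obtain ⟨T, hT⟩ := h
  refine ⟨T.symm, fun g x => ?_⟩
  rw [LinearEquiv.symm_apply_eq, hT, LinearEquiv.apply_symm_apply]

lemma RepIso.trans (h : RepIso ρ σ) (h' : RepIso σ τ) : RepIso ρ τ := by
  obtain ⟨T, hT⟩ := h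
  obtain ⟨T', hT'⟩ := h'
  exact ⟨T.trans T', fun g x => by
    rw [LinearEquiv.trans_apply, LinearEquiv.trans_apply, hT, hT']⟩

/-- The isomorphism relation on reflection representations. -/
def reflSetoid {G : Type} [Group G] (d : ℕ) (C Y : Set G) :
    Setoid {ρ : G →* GLd d // IsReflRep d C Y ρ} where
  r ρ σ := RepIso ρ.1 σ.1
  iseqv := ⟨fun _ => RepIso.refl _, RepIso.symm, RepIso.trans⟩

/-- The number of isomorphism classes of reflection representations. -/
noncomputable def reflCount {G : Type} [Group G] (d : ℕ) (C Y : Set G) : ℕ :=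
  Nat.card (Quotient (reflSetoid d C Y))

lemma IsReflRep.comp {H : Type} [Group H] {C Y : Set G} {C' Y' : Set H} {f : G →* H}
    (hC : f '' C = C') (hY : f '' Y = Y') {ρ : H →* GLd d} (h : IsReflRep d C' Y' ρ) :
    IsReflRep d C Y (ρ.comp f) := by
  subst hC hY
  refine ⟨fun r hr => h.1 _ ⟨r, hr, rfl⟩, fun x hx => h.2 x ?_, fun y hy => h.3 _ ⟨y, hy, rfl⟩⟩
  rintro _ ⟨r, hr, rfl⟩
  exact hx r hr

lemma image_symm_eq {H : Type} [Group H] {C : Set G} {C' : Set H} {f : G ≃* H}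
    (hC : f '' C = C') : f.symm '' C' = C := by
  rw [← hC, ← Set.image_comp]
  simp

lemma reflCount_congr {H : Type} [Group H] {C Y : Set G} {C' Y' : Set H} (f : G ≃* H)
    (hC : f '' C = C') (hY : f '' Y = Y') (d : ℕ) : reflCount d C Y = reflCount d C' Y' := by
  refine Nat.card_congr (Quotient.congr
    { toFun := fun ρ => ⟨ρ.1.comp f.symm.toMonoidHom,
        ρ.2.comp (f := f.symm.toMonoidHom) (image_symm_eq hC) (image_symm_eq hY)⟩
      invFun := fun ρ => ⟨ρ.1.comp f.toMonoidHom, ρ.2.comp (f := f.toMonoidHom) hC hY⟩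
      left_inv := fun ρ => Subtype.ext (MonoidHom.ext fun g => by simp)
      right_inv := fun ρ => Subtype.ext (MonoidHom.ext fun g => by simp) } ?_)
  rintro ρ σ
  constructor
  · rintro ⟨T, hT⟩
    exact ⟨T, fun g x => hT _ x⟩
  · rintro ⟨T, hT⟩
    refine ⟨T, fun g x => ?_⟩
    simpa using hT (f g) x

end RepIso

/-! ### Extension of homomorphisms along a central element -/

/-- The only possible definition is w δ^i ↦ ρ(w) c^i. Two expressions of one element differ by a
power of δ lying in `W`, so `hcompat` is exactly well-definedness, and centrality gives
multiplicativity. -/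
lemma exists_extension {G H : Type} [Group G] [Group H] {W : Subgroup G} {δ : G}
    (hδ : ∀ g, Commute δ g) (hG : ∀ g : G, ∃ w : W, ∃ i : ℤ, g = w * δ ^ i) (ρ : W →* H) (c : H)
    (hc : ∀ w, Commute c (ρ w)) (hcompat : ∀ (w : W) (i : ℤ), (w : G) = δ ^ i → ρ w = c ^ i) :
    ∃ σ : G →* H, (∀ w : W, σ w = ρ w) ∧ σ δ = c := by
  choose w i hwi using hG
  have key : ∀ (v : W) (j : ℤ) (v' : W) (j' : ℤ), (v : G) * δ ^ j = v' * δ ^ j' →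
      ρ v * c ^ j = ρ v' * c ^ j' := by
    intro v j v' j' h
    have h1 : ((v'⁻¹ * v : W) : G) = δ ^ (j' - j) := by
      rw [Subgroup.coe_mul, Subgroup.coe_inv, inv_mul_eq_iff_eq_mul, zpow_sub, ← mul_assoc,
        ← h, mul_inv_cancel_right]
    have h2 := hcompat _ _ h1
    rw [map_mul, map_inv, inv_mul_eq_iff_eq_mul] at h2
    rw [h2, mul_assoc, ← zpow_add, sub_add_cancel]
  refine ⟨MonoidHom.mk' (fun g => ρ (w g) * c ^ i g) ?_, ?_, ?_⟩
  · intro a b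
    have h1 : ((w (a * b) : W) : G) * δ ^ i (a * b) = (w a * w b : W) * δ ^ (i a + i b) := by
      rw [← hwi, Subgroup.coe_mul, zpow_add]
      nth_rw 1 [hwi a, hwi b]
      have := ((hδ (w b)).zpow_left (i a)).eq
      rw [mul_assoc, ← mul_assoc (δ ^ i a), this]
      simp only [mul_assoc]
    rw [key _ _ _ _ h1, map_mul, zpow_add]
    have := ((hc (w b)).zpow_left (i a)).eq
    rw [mul_assoc (ρ (w a)) (c ^ i a), ← mul_assoc (c ^ i a), this]
    simp only [mul_assoc]
  · intro v
    have := key (w v) (i v) v 0 (by rw [← hwi, zpow_zero, mul_one])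
    rw [zpow_zero, mul_one] at this
    exact this
  · have := key (w δ) (i δ) 1 1 (by rw [← hwi, Subgroup.coe_one, zpow_one, one_mul])
    rw [map_one, one_mul, zpow_one] at this
    exact this

/-! ### Monic divisors of `X ^ a - c` and sets of roots -/

/-- The monic polynomial with a given set of simple roots. -/
noncomputable def rootPoly (S : Finset ℂ) : ℂ[X] := ∏ α ∈ S, (X - C α)

lemma rootPoly_monic (S : Finset ℂ) : (rootPoly S).Monic := monic_prod_X_sub_C _ _

lemma rootPoly_natDegree (S : Finset ℂ) : (rootPoly S).natDegree = S.card :=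
  natDegree_finsetProd_X_sub_C_eq_card _ _

lemma rootPoly_roots (S : Finset ℂ) : (rootPoly S).roots = S.val := roots_prod_X_sub_C S

lemma rootPoly_injective : Function.Injective rootPoly := fun S S' h => by
  have := congrArg roots h
  rw [rootPoly_roots, rootPoly_roots] at this
  exact Finset.val_inj.1 this

lemma rootPoly_coeff_zero (S : Finset ℂ) :
    (rootPoly S).coeff 0 = (-1) ^ S.card * ∏ α ∈ S, α := by
  rw [rootPoly, coeff_zero_eq_eval_zero, eval_prod, ← Finset.prod_const, ← Finset.prod_mul_distrib]
  exact Finset.prod_congr rfl fun α _ => by simp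

lemma rootPoly_dvd {S : Finset ℂ} {a : ℕ} (ha : 0 < a) {c : ℂ} (h : ∀ α ∈ S, α ^ a = c) :
    rootPoly S ∣ X ^ a - C c := by
  have hne : (X ^ a - C c : ℂ[X]) ≠ 0 := X_pow_sub_C_ne_zero ha c
  have := (Multiset.prod_X_sub_C_dvd_iff_le_roots hne S.val).2 (by
    rw [Multiset.le_iff_subset S.nodup]
    intro α hα
    rw [mem_roots hne, IsRoot, eval_sub, eval_pow, eval_X, eval_C, h α hα, sub_self])
  exact this

/-- For c ≠ 0 the polynomial X^a - c is separable, so a monic divisor is determined by its set of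
roots. -/
lemma exists_rootPoly {P : ℂ[X]} (hP : P.Monic) {a : ℕ} (ha : 0 < a) {c : ℂ} (hc : c ≠ 0)
    (h : P ∣ X ^ a - C c) :
    ∃ S : Finset ℂ, P = rootPoly S ∧ S.card = P.natDegree ∧ ∀ α ∈ S, α ^ a = c := by
  have hne : (X ^ a - C c : ℂ[X]) ≠ 0 := X_pow_sub_C_ne_zero ha c
  have hsep : (X ^ a - C c : ℂ[X]).Separable :=
    separable_X_pow_sub_C c (by exact_mod_cast ha.ne') hc
  have hnd : P.roots.Nodup := nodup_roots (hsep.of_dvd h)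
  have hcard : P.roots.card = P.natDegree := IsAlgClosed.card_roots_eq_natDegree
  have hprod := prod_multiset_X_sub_C_of_monic_of_roots_card_eq hP hcard
  refine ⟨⟨P.roots, hnd⟩, hprod.symm, hcard, fun α hα => ?_⟩
  have h1 : α ∈ P.roots := hα
  have h2 := (mem_roots'.1 h1).2.dvd h
  rw [IsRoot, eval_sub, eval_pow, eval_X, eval_C, sub_eq_zero] at h2
  exact h2

lemma card_nthRootsFinset_of_ne_zero {N : ℕ} (hN : 0 < N) {μ : ℂ} (hμ : μ ≠ 0) :
    (nthRootsFinset N μ).card = N := by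
  have hζ := Complex.isPrimitiveRoot_exp N hN.ne'
  rw [nthRootsFinset_def, Multiset.toFinset_card_of_nodup (hζ.nthRoots_nodup hμ), hζ.card_nthRoots, if_pos]
  exact ⟨μ ^ (1 / N : ℂ), by
    rw [← Complex.cpow_nat_mul, mul_one_div_cancel (by exact_mod_cast hN.ne'), Complex.cpow_one]⟩

/-! ### The reflection as quotient of two companion operators -/

section Model

variable {d : ℕ} {P Q : ℂ[X]} {hP : P.Monic} {hd : P.natDegree = d} {hQ : Q.Monic}
  {hd' : Q.natDegree = d}

/-- The linear form governing the rank one map `S` with `S (X mod P) = (X mod Q)`. -/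
noncomputable def constForm (d : ℕ) (P : ℂ[X]) : PolyLT d →ₗ[ℂ] ℂ :=
  (-(P.coeff 0)⁻¹) • ((lcoeff ℂ 0).comp (degreeLT ℂ d).subtype)

lemma constForm_apply (f : PolyLT d) :
    constForm d P f = -(P.coeff 0)⁻¹ * (f : ℂ[X]).coeff 0 := rfl

/-- Writing x = Ay, one has Sx = (SA)y, and the two companion operators differ by the top
coefficient of y times P - Q. That coefficient is recovered from the constant term of x, because
reduction modulo P contributes P(0) there. -/
lemma apply_of_mul_mulX (hP0 : P.coeff 0 ≠ 0) {S A : GLd d}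
    (hA : (A : Module.End ℂ (PolyLT d)) = mulX P hP hd)
    (hSA : (S * A : GLd d) = mulX Q hQ hd') (x : PolyLT d) :
    (S : Module.End ℂ (PolyLT d)) x = x + constForm d P x • monicSub P Q hP hd hQ hd' := by
  have hx : x = mulX P hP hd (((A⁻¹ : GLd d) : Module.End ℂ (PolyLT d)) x) := by
    rw [← hA, ← Module.End.mul_apply, Units.mul_inv, Module.End.one_apply]
  generalize ((A⁻¹ : GLd d) : Module.End ℂ (PolyLT d)) x = y at hx
  have h1 : (S : Module.End ℂ (PolyLT d)) x = mulX Q hQ hd' y := by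
    rw [hx, ← hSA, Units.val_mul, hA, Module.End.mul_apply]
  rw [h1, mulX_eq_add (hP := hP) (hd := hd), ← hx]
  congr 2
  rw [constForm_apply, hx, coeff_zero_mulX]
  field_simp

lemma constForm_monicSub (hP0 : P.coeff 0 ≠ 0) :
    constForm d P (monicSub P Q hP hd hQ hd') = Q.coeff 0 / P.coeff 0 - 1 := by
  rw [constForm_apply, monicSub, coeff_sub]
  field_simp
  ring

/-- The eigenvalue of S on P - Q is ζ = Q(0)/P(0). If ζ ≠ 1, then S^k = 1 exactly when ζ^k = 1; if ζ
= 1, S is a non-trivial transvection and has infinite order, whence the second condition. -/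
lemma pow_eq_one_iff_of_mul_mulX (h0 : 0 < d) (hP0 : P.coeff 0 ≠ 0) {S A : GLd d}
    (hA : (A : Module.End ℂ (PolyLT d)) = mulX P hP hd)
    (hSA : (S * A : GLd d) = mulX Q hQ hd') {k : ℕ} (hk : 0 < k) (hPQ : P ≠ Q) :
    S ^ k = 1 ↔ Q.coeff 0 ^ k = P.coeff 0 ^ k ∧ Q.coeff 0 ≠ P.coeff 0 := by
  have hw : monicSub P Q hP hd hQ hd' ≠ 0 := by
    intro h
    have := congrArg Subtype.val h
    exact hPQ (sub_eq_zero.1 this)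
  have hS := apply_of_mul_mulX hP0 hA hSA
  have hpow := pow_apply_of_rank_one hS (constForm_monicSub hP0) k
  set ζ := Q.coeff 0 / P.coeff 0 with hζ
  have hgeom := geom_sum_mul ζ k
  have h1 : S ^ k = 1 ↔ ∑ i ∈ Finset.range k, ζ ^ i = 0 := by
    rw [← Units.val_inj, Units.val_pow_eq_pow_val, Units.val_one]
    constructor
    · intro h
      have h2 := hpow ⟨1, one_mem_polyLT h0⟩
      rw [h, Module.End.one_apply, left_eq_add, smul_eq_zero] at h2
      have h3 := h2.resolve_right hw
      rw [mul_eq_zero] at h3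
      refine h3.resolve_right ?_
      rw [constForm_apply]
      simpa using hP0
    · intro h
      refine LinearMap.ext fun x => ?_
      rw [hpow, h, zero_mul, zero_smul, add_zero, Module.End.one_apply]
  have h2 : Q.coeff 0 ^ k = P.coeff 0 ^ k ↔ ζ ^ k = 1 := by
    rw [hζ, div_pow, div_eq_one_iff_eq (pow_ne_zero _ hP0)]
  have h3 : Q.coeff 0 = P.coeff 0 ↔ ζ = 1 := by
    rw [hζ, div_eq_one_iff_eq hP0]
  rw [h1, h2, Ne, h3]
  constructor
  · intro h
    refine ⟨?_, ?_⟩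
    · rw [h, zero_mul] at hgeom
      exact (sub_eq_zero.1 hgeom.symm)
    · intro h4
      rw [h4] at h
      simp at h
      omega
  · rintro ⟨h4, h5⟩
    rw [h4, sub_self] at hgeom
    exact (mul_eq_zero.1 hgeom).resolve_right (sub_ne_zero.2 h5)

end Model

/-! ### Representations of the ambient group built from pairs of polynomials -/

namespace JReflectionData

variable (P : JReflectionData) {d : ℕ}

/-- Homomorphisms from the ambient J-group, from the images of the generators. -/
lemma exists_hom_of_gen {H : Type} [Group H] (S T U : H) (hS : S ^ P.k = 1)
    (hT : T ^ (P.b * P.n) = 1) (hU : U ^ (P.c * P.m) = 1) (h1 : S * T * U = T * U * S)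
    (h2 : T * U * S = U * S * T) :
    ∃ σ : P.Amb →* H, σ (P.gen .s) = S ∧ σ (P.gen .t) = T ∧ σ (P.gen .u) = U := by
  let f : JGen → H := fun
    | .s => S
    | .t => T
    | .u => U
  have hf : ∀ r ∈ jRels P.k (P.b * P.n) (P.c * P.m), FreeGroup.lift f r = 1 := by
    rintro r (rfl | rfl | rfl | rfl | rfl)
    · rw [map_pow, FreeGroup.lift_apply_of]; exact hS
    · rw [map_pow, FreeGroup.lift_apply_of]; exact hT
    · rw [map_pow, FreeGroup.lift_apply_of]; exact hU
    · simp only [map_mul, map_inv, FreeGroup.lift_apply_of, mul_inv_eq_one]; exact h1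
    · simp only [map_mul, map_inv, FreeGroup.lift_apply_of, mul_inv_eq_one]; exact h2
  exact ⟨PresentedGroup.toGroup hf, PresentedGroup.toGroup.of hf, PresentedGroup.toGroup.of hf,
    PresentedGroup.toGroup.of hf⟩

/-- The scalar automorphisms. -/
noncomputable def scal (d : ℕ) : ℂˣ →* GLd d :=
  Units.map (algebraMap ℂ (Module.End ℂ (PolyLT d))).toMonoidHom

lemma scal_commute (c : ℂˣ) (g : GLd d) : Commute (scal d c) g :=
  Units.ext (Algebra.commutes (c : ℂ) (g : Module.End ℂ (PolyLT d)))

lemma scal_val (c : ℂˣ) :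
    (scal d c : Module.End ℂ (PolyLT d)) = algebraMap ℂ _ (c : ℂ) := rfl

lemma scal_apply (c : ℂˣ) (x : PolyLT d) :
    (scal d c : Module.End ℂ (PolyLT d)) x = (c : ℂ) • x := by
  rw [scal_val, Module.algebraMap_end_apply]

lemma scal_injective (h0 : 0 < d) : Function.Injective (scal d) := by
  intro c c' h
  have h1 := congrArg (fun g : GLd d => (g : Module.End ℂ (PolyLT d)) ⟨1, one_mem_polyLT h0⟩) h
  simp only [scal_apply] at h1
  have h2 := congrArg (fun f : PolyLT d => (f : ℂ[X]).coeff 0) h1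
  simp at h2
  exact Units.ext h2

lemma coeff_zero_ne_zero_of_dvd {a : ℕ} (ha : 0 < a) {A : ℂ[X]} (hAa : A ∣ X ^ a - C 1) :
    A.coeff 0 ≠ 0 := by
  intro h
  have h1 : X ∣ A := X_dvd_iff.2 h
  have h2 := X_dvd_iff.1 (h1.trans hAa)
  rw [coeff_sub, coeff_X_pow, if_neg ha.ne, coeff_C_zero] at h2
  simp at h2

/-- The representation of the ambient J-group attached to two polynomials. -/
lemma exists_rep (h0 : 0 < d) {A B : ℂ[X]} (hA : A.Monic) (hd : A.natDegree = d) (hB : B.Monic)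
    (hd' : B.natDegree = d) {a : ℕ} (ha : 0 < a) (hab : a ∣ P.b * P.n) (lam : ℂˣ)
    (hAa : A ∣ X ^ a - C 1) (hBm : B ∣ X ^ P.m - C ((lam : ℂ) ^ P.m))
    (hk : B.coeff 0 ^ P.k = A.coeff 0 ^ P.k) (hne : B.coeff 0 ≠ A.coeff 0) :
    ∃ σ : P.Amb →* GLd d, (σ (P.gen .t) : Module.End ℂ (PolyLT d)) = mulX A hA hd ∧
      ((σ (P.gen .s) * σ (P.gen .t) : GLd d) : Module.End ℂ (PolyLT d)) = mulX B hB hd' ∧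
      σ P.delta = scal d lam ∧ σ (P.gen .t) ^ a = 1 ∧ σ (P.gen .u) ^ P.m = 1 := by
  have hmA : mulX A hA hd ^ a = 1 := by rw [mulX_pow_eq hAa, map_one]
  have hmB : mulX B hB hd' ^ P.m = algebraMap ℂ _ ((lam : ℂ) ^ P.m) := mulX_pow_eq hBm
  have hA0 := coeff_zero_ne_zero_of_dvd ha hAa
  let T : GLd d := Units.ofPowEqOne _ a hmA ha.ne'
  have hT : (T : Module.End ℂ (PolyLT d)) = mulX A hA hd := rfl
  have hTa : T ^ a = 1 := Units.ext (by rw [Units.val_pow_eq_pow_val, hT, hmA, Units.val_one])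
  -- `D₀` is the image of u⁻¹: as stu must act by λ, the operator st = λu⁻¹ is λD₀. The condition on
  -- `B` makes D₀^m = 1, and s is then forced to be λD₀t⁻¹.
  let D₀ : Module.End ℂ (PolyLT d) := (((lam⁻¹ : ℂˣ) : ℂ)) • mulX B hB hd'
  have hD₀ : D₀ ^ P.m = 1 := by
    rw [_root_.smul_pow, hmB, Algebra.algebraMap_eq_smul_one, smul_smul, ← mul_pow, Units.inv_mul, one_pow,
      one_smul]
  let D : GLd d := Units.ofPowEqOne _ P.m hD₀ P.m_pos.ne'
  have hD : (D : Module.End ℂ (PolyLT d)) = D₀ := rfl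
  have hDm : D ^ P.m = 1 := Units.ext (by rw [Units.val_pow_eq_pow_val, hD, hD₀, Units.val_one])
  have hlD : ((scal d lam * D : GLd d) : Module.End ℂ (PolyLT d)) = mulX B hB hd' := by
    rw [Units.val_mul, hD, scal_val, Algebra.algebraMap_eq_smul_one, smul_one_mul, smul_smul,
      Units.mul_inv, one_smul]
  let S : GLd d := scal d lam * D * T⁻¹
  have hST : ((S * T : GLd d) : Module.End ℂ (PolyLT d)) = mulX B hB hd' := by
    rw [show S * T = scal d lam * D from inv_mul_cancel_right _ _, hlD]
  have hSk : S ^ P.k = 1 :=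
    (pow_eq_one_iff_of_mul_mulX h0 hA0 hT hST (lt_of_lt_of_le two_pos P.two_le_k)
      (fun h => hne (by rw [h]))).2 ⟨hk, hne⟩
  have hl : ∀ g : GLd d, scal d lam * g = g * scal d lam := fun g => (scal_commute lam g).eq
  have hSTU : S * T * D⁻¹ = scal d lam := by
    rw [show S * T = scal d lam * D from inv_mul_cancel_right _ _, mul_inv_cancel_right]
  have hTUS : T * D⁻¹ * S = scal d lam := by
    change T * D⁻¹ * (scal d lam * D * T⁻¹) = _
    rw [hl D]
    have : T * D⁻¹ * (D * scal d lam * T⁻¹) = T * (scal d lam * T⁻¹) := by group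
    rw [this, hl T⁻¹, mul_inv_cancel_left]
  have hUST : D⁻¹ * S * T = scal d lam := by
    rw [mul_assoc, show S * T = scal d lam * D from inv_mul_cancel_right _ _, hl D,
      inv_mul_cancel_left]
  obtain ⟨σ, hσs, hσt, hσu⟩ := P.exists_hom_of_gen S T D⁻¹ hSk
    (by obtain ⟨e, he⟩ := hab; rw [he, pow_mul, hTa, one_pow])
    (by rw [mul_comm, pow_mul, inv_pow, hDm, inv_one, one_pow])
    (hSTU.trans hTUS.symm) (hTUS.trans hUST.symm)
  refine ⟨σ, by rw [hσt, hT], by rw [hσs, hσt, hST], ?_, by rw [hσt, hTa], by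
    rw [hσu, inv_pow, hDm, inv_one]⟩
  rw [delta, map_mul, map_mul, hσs, hσt, hσu, hSTU]

variable {P} {a : ℕ} {Y : Set P.W}

lemma refl_s : P.refl .s = P.gen .s := pow_one _

lemma conj_s_mem (g : P.Amb) : ∃ r ∈ P.cls .s, (r : P.Amb) = g * P.gen .s * g⁻¹ := by
  refine ⟨⟨g * P.gen .s * g⁻¹, ?_⟩, ⟨g, 1, ?_, ?_⟩, rfl⟩
  · have : P.gen .s ∈ P.W := by
      rw [← refl_s]
      exact P.refl_mem .s
    exact (inferInstance : P.W.Normal).conj_mem _ this g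
  · rw [Ne, refl_zpow_eq_one_iff]
    intro h
    have h1 := Int.le_of_dvd one_pos h
    have h2 := P.two_le_k
    have h3 : (P.k : ℤ) ≤ 1 := h1
    omega
  · rw [zpow_one]
    exact congrArg (fun a => g * a * g⁻¹) refl_s.symm

lemma exists_pow_of_mem_cls_s {r : P.W} (hr : r ∈ P.cls .s) :
    ∃ (g : P.Amb) (e : ℕ), (r : P.Amb) = g * P.gen .s ^ e * g⁻¹ := by
  obtain ⟨g, e, -, h⟩ := hr
  refine ⟨g, (e % P.k).toNat, ?_⟩
  have hk : (P.k : ℤ) ≠ 0 := by have := P.two_le_k; omega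
  have h1 : P.gen .s ^ e = P.gen .s ^ (e % P.k) := by
    have h2 := P.gen_pow .s
    conv_lhs => rw [← Int.mul_ediv_add_emod e P.k, zpow_add, zpow_mul, zpow_natCast]
    rw [show P.gen .s ^ P.k = 1 from h2, one_zpow, one_mul]
  rw [h, refl_s, h1, ← zpow_natCast, Int.toNat_of_nonneg (Int.emod_nonneg _ hk)]

/-- The model representations are reflection representations. -/
lemma isReflRep_of_mulX {A B : ℂ[X]} {hA : A.Monic} {hd : A.natDegree = d}
    {hB : B.Monic} {hd' : B.natDegree = d} (hA0 : A.coeff 0 ≠ 0) (hAB : A ≠ B)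
    {σ : P.Amb →* GLd d} (hσt : (σ (P.gen .t) : Module.End ℂ (PolyLT d)) = mulX A hA hd)
    (hσst : ((σ (P.gen .s) * σ (P.gen .t) : GLd d) : Module.End ℂ (PolyLT d)) = mulX B hB hd')
    (hY : ∀ y ∈ Y, σ y = 1) :
    IsReflRep d (P.cls .s) Y (σ.comp P.W.subtype) := by
  have hS := apply_of_mul_mulX hA0 hσt hσst
  have hw : monicSub A B hA hd hB hd' ≠ 0 := by
    intro h
    have := congrArg Subtype.val h
    exact hAB (sub_eq_zero.1 this)
  refine ⟨?_, ?_, hY⟩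
  · intro r hr
    obtain ⟨g, e, h⟩ := exists_pow_of_mem_cls_s hr
    have hpow := pow_apply_of_rank_one (ζ := constForm d A (monicSub A B hA hd hB hd') + 1)
      hS (by ring) e
    refine ⟨((∑ i ∈ Finset.range e, (constForm d A (monicSub A B hA hd hB hd') + 1) ^ i) •
      constForm d A) ∘ₗ ((σ g)⁻¹ : GLd d).1, (σ g : Module.End ℂ _) (monicSub A B hA hd hB hd'),
      fun x => ?_⟩
    change (σ r : Module.End ℂ (PolyLT d)) x = _
    rw [h, map_mul, map_mul, map_inv, map_pow, Units.val_mul, Units.val_mul, Module.End.mul_apply,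
      Module.End.mul_apply, Units.val_pow_eq_pow_val, hpow, map_add, map_smul,
      ← Module.End.mul_apply, Units.mul_inv, Module.End.one_apply]
    rfl
  · intro x hx
    -- Being fixed by the conjugate of s by t^{-(i+1)} says that st and t agree on t^i x. Their
    -- difference is the top coefficient of t^i x times B - A up to sign, so that coefficient
    -- vanishes.
    refine eq_zero_of_coeff_mulX (hP := hA) (hd := hd) fun i => ?_
    obtain ⟨r, hr, h⟩ := conj_s_mem (P := P) (P.gen .t ^ (i + 1))⁻¹
    have h1 := hx r hr
    change (σ r : Module.End ℂ (PolyLT d)) x = x at h1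
    have h2 : σ (P.gen .s) * σ (P.gen .t) * σ (P.gen .t) ^ i = σ (P.gen .t) ^ (i + 1) * σ r := by
      rw [h, ← map_pow, ← map_pow, ← map_mul, ← map_mul, ← map_mul, pow_succ']
      congr 1
      group
    have h3 := congrArg (fun g : GLd d => (g : Module.End ℂ (PolyLT d)) x) h2
    simp only [Units.val_mul, Module.End.mul_apply, h1, Units.val_pow_eq_pow_val] at h3
    rw [← Module.End.mul_apply, ← Units.val_mul, hσst, hσt,
      mulX_eq_add (hP := hA) (hd := hd), pow_succ', Module.End.mul_apply, add_eq_left,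
      smul_eq_zero] at h3
    exact h3.resolve_right hw

end JReflectionData

/-! ### Central scalars, extensions and the normal form -/

namespace JReflectionData

variable {P : JReflectionData} {d a : ℕ} {Y : Set P.W}

variable (P) in
/-- The central element of a J-reflection group. -/
def zeta : P.W := ⟨P.delta ^ (P.n * P.m), P.delta_pow_mem⟩

lemma zeta_commute (w : P.W) : Commute P.zeta w :=
  Subtype.ext ((P.delta_commute w).pow_left _)

lemma exists_nonzero (h0 : 0 < d) : ∃ x : PolyLT d, x ≠ 0 :=
  ⟨⟨1, one_mem_polyLT h0⟩, fun h => one_ne_zero (congrArg Subtype.val h)⟩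

lemma finrank_polyLT (d : ℕ) : Module.finrank ℂ (PolyLT d) = d := by
  rw [(degreeLTEquiv ℂ d).finrank_eq, Module.finrank_fin_fun]

/-- The central element acts by a scalar in a reflection representation. -/
lemma exists_scalar (h0 : 0 < d) {ρ : P.W →* GLd d} (h : IsReflRep d (P.cls .s) Y ρ) :
    ∃ μ : ℂˣ, ρ P.zeta = scal d μ := by
  obtain ⟨s, hs, hs'⟩ := conj_s_mem (P := P) 1
  rw [one_mul, inv_one, mul_one] at hs'
  obtain ⟨φ, w, hφ⟩ := h.1 s hs
  have hconj : ∀ r ∈ P.cls .s, ∃ (v : P.W) (e : ℕ), r = v * s ^ e * v⁻¹ := by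
    intro r hr
    obtain ⟨g, e, h1⟩ := exists_pow_of_mem_cls_s hr
    obtain ⟨v, hv⟩ := P.conj_eq_conj_W (P.gen .s ^ e) g
    refine ⟨v, e, Subtype.ext ?_⟩
    rw [h1, hv, ← hs']
    simp
  -- Every reflection of the class of s is conjugate within `P.W` to a power of s, so the single
  -- form φ and its translates detect all vectors.
  have hfix : ∀ x, (∀ v : P.W, φ ((ρ v : Module.End ℂ (PolyLT d)) x) = 0) → x = 0 := by
    intro x hx
    refine h.2 x fun r hr => ?_
    obtain ⟨v, e, rfl⟩ := hconj r hr
    have h2 : (ρ s : Module.End ℂ (PolyLT d)) ((ρ v⁻¹ : Module.End ℂ (PolyLT d)) x) =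
        (ρ v⁻¹ : Module.End ℂ (PolyLT d)) x := by
      rw [hφ, hx, zero_smul, add_zero]
    have h3 : ∀ e : ℕ, ((ρ s : Module.End ℂ (PolyLT d)) ^ e)
        ((ρ v⁻¹ : Module.End ℂ (PolyLT d)) x) = (ρ v⁻¹ : Module.End ℂ (PolyLT d)) x := by
      intro e
      induction e with
      | zero => rfl
      | succ e ih => rw [pow_succ, Module.End.mul_apply, h2, ih]
    rw [map_mul, map_mul, Units.val_mul, Units.val_mul, Module.End.mul_apply,
      Module.End.mul_apply, map_pow, Units.val_pow_eq_pow_val, h3, ← Module.End.mul_apply,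
      ← Units.val_mul, ← map_mul, mul_inv_cancel, map_one, Units.val_one, Module.End.one_apply]
  obtain ⟨y, hy⟩ := exists_nonzero h0
  obtain ⟨x₀, hx₀⟩ : ∃ x₀, φ x₀ ≠ 0 := by
    by_contra! hc
    exact hy (hfix y fun v => hc _)
  have hw : w ≠ 0 := by
    rintro rfl
    refine hy (h.2 y fun r hr => ?_)
    obtain ⟨v, e, rfl⟩ := hconj r hr
    have h1 : ρ s = 1 := Units.ext (LinearMap.ext fun x => by simp [hφ])
    simp [h1]
  have hcomm : ∀ (v : P.W) (x : PolyLT d), (ρ v : Module.End ℂ (PolyLT d))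
      ((ρ P.zeta : Module.End ℂ (PolyLT d)) x) =
      (ρ P.zeta : Module.End ℂ (PolyLT d)) ((ρ v : Module.End ℂ (PolyLT d)) x) := by
    intro v x
    rw [← Module.End.mul_apply, ← Units.val_mul, ← map_mul, ← (zeta_commute v).eq, map_mul,
      Units.val_mul, Module.End.mul_apply]
  set Z : Module.End ℂ (PolyLT d) := (ρ P.zeta : Module.End ℂ (PolyLT d)) with hZ
  -- Commutation of Z with s, compared on the rank one part, makes w an eigenvector of Z and φ an
  -- eigenform with the same eigenvalue μ. Every translate of φ then kills Zx - μx.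
  have key : ∀ x, φ (Z x) • w = φ x • Z w := by
    intro x
    have h1 := hcomm s x
    rw [hφ, hφ, map_add, map_smul] at h1
    exact add_left_cancel h1
  set μ := φ (Z x₀) / φ x₀ with hμ
  have hZw : Z w = μ • w := by
    rw [hμ, div_eq_inv_mul, mul_smul, key, smul_smul, inv_mul_cancel₀ hx₀, one_smul]
  have hφZ : ∀ x, φ (Z x) = μ * φ x := by
    intro x
    have h1 := key x
    rw [hZw, smul_smul] at h1
    rw [smul_left_injective ℂ hw h1, mul_comm]
  have hZx : ∀ x, Z x = μ • x := by
    intro x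
    rw [← sub_eq_zero]
    refine hfix _ fun v => ?_
    rw [map_sub, map_smul, hcomm, map_sub, hφZ, map_smul, smul_eq_mul, sub_self]
  have hμ0 : μ ≠ 0 := by
    intro h1
    have h2 : ((ρ P.zeta)⁻¹ * ρ P.zeta : GLd d) = 1 := inv_mul_cancel _
    have h3 := congrArg (fun g : GLd d => (g : Module.End ℂ (PolyLT d)) y) h2
    simp only [Units.val_mul, Module.End.mul_apply, Units.val_one, Module.End.one_apply] at h3
    rw [← hZ, hZx, h1, zero_smul, map_zero] at h3
    exact hy h3.symm
  refine ⟨Units.mk0 μ hμ0, Units.ext (LinearMap.ext fun x => ?_)⟩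
  rw [scal_apply, ← hZ, hZx, Units.val_mk0]

/-- Extensions of a reflection representation to the ambient J-group. -/
lemma exists_extension_amb {ρ : P.W →* GLd d} {lam : ℂˣ}
    (hlam : ρ P.zeta = scal d (lam ^ (P.n * P.m))) :
    ∃ σ : P.Amb →* GLd d, σ.comp P.W.subtype = ρ ∧ σ P.delta = scal d lam := by
  obtain ⟨σ, h1, h2⟩ := exists_extension P.delta_commute P.exists_eq_mul_delta ρ (scal d lam)
    (fun w => scal_commute lam _) (by
      intro w i hw
      obtain ⟨j, hj⟩ := P.dvd_of_delta_zpow_mem (i := i) (hw ▸ w.2)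
      have h3 : w = P.zeta ^ j := Subtype.ext (by
        rw [hw, hj, zpow_mul, zpow_natCast, Subgroup.coe_zpow]
        rfl)
      rw [h3, map_zpow, hlam, hj, map_pow, zpow_mul, zpow_natCast])
  exact ⟨σ, MonoidHom.ext h1, h2⟩

/-- The normal form of a representation of the ambient J-group whose restriction is a reflection
representation. -/
lemma exists_normal_form (h0 : 0 < d) (ha : 0 < a) {σ : P.Amb →* GLd d} {lam : ℂˣ}
    (h : IsReflRep d (P.cls .s) Y (σ.comp P.W.subtype)) (hδ : σ P.delta = scal d lam)
    (hta : σ (P.gen .t) ^ a = 1) (hum : σ (P.gen .u) ^ P.m = 1) :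
    ∃ (A B : ℂ[X]) (hA : A.Monic) (hd : A.natDegree = d) (hB : B.Monic) (hd' : B.natDegree = d)
      (T : PolyLT d ≃ₗ[ℂ] PolyLT d),
      (∀ f, T (mulX A hA hd f) = (σ (P.gen .t) : Module.End ℂ (PolyLT d)) (T f)) ∧
      (∀ f, T (mulX B hB hd' f) =
        ((σ (P.gen .s) * σ (P.gen .t) : GLd d) : Module.End ℂ (PolyLT d)) (T f)) ∧
      A ∣ X ^ a - C 1 ∧ B ∣ X ^ P.m - C ((lam : ℂ) ^ P.m) ∧
      B.coeff 0 ^ P.k = A.coeff 0 ^ P.k ∧ B.coeff 0 ≠ A.coeff 0 := by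
  obtain ⟨s, hs, hs'⟩ := conj_s_mem (P := P) 1
  rw [one_mul, inv_one, mul_one] at hs'
  obtain ⟨φ, w, hφ⟩ := h.1 s hs
  have hφ : ∀ x, (σ (P.gen .s) : Module.End ℂ (PolyLT d)) x = x + φ x • w := by
    rw [← hs']; exact hφ
  set S := σ (P.gen .s) with hS
  set A₀ := σ (P.gen .t) with hA₀
  have hfin : FiniteDimensional ℂ (PolyLT d) := (degreeLTEquiv ℂ d).symm.finiteDimensional
  have hApow : ((A₀ : Module.End ℂ (PolyLT d)) ^ a) = 1 := by
    rw [← Units.val_pow_eq_pow_val, hta, Units.val_one]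
  -- vectors whose orbit under `t` is killed by `φ` are fixed by all reflections
  have hobs : ∀ x, (∀ i : ℕ, φ (((A₀ : Module.End ℂ (PolyLT d)) ^ i) x) = 0) → x = 0 := by
    let U : Set (PolyLT d) := {x | ∀ i : ℕ, φ (((A₀ : Module.End ℂ (PolyLT d)) ^ i) x) = 0}
    have hUA : ∀ x ∈ U, (A₀ : Module.End ℂ (PolyLT d)) x ∈ U := fun x hx i => by
      rw [← Module.End.mul_apply, ← pow_succ]; exact hx _
    have hUS : ∀ x ∈ U, (S : Module.End ℂ (PolyLT d)) x = x := fun x hx => by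
      have := hx 0
      rw [pow_zero, Module.End.one_apply] at this
      rw [hφ, this, zero_smul, add_zero]
    -- `K` consists of the elements that preserve `U` together with their inverses. It contains s
    -- (trivial on `U`), t (of finite order, so its inverse is a power) and δ (scalar), hence u as
    -- well, and is everything.
    let K : Subgroup P.Amb :=
      { carrier := {g | ∀ x ∈ U, (σ g : Module.End ℂ (PolyLT d)) x ∈ U ∧
          (σ g⁻¹ : Module.End ℂ (PolyLT d)) x ∈ U}
        one_mem' := fun x hx => by simpa using hx
        mul_mem' := fun {g g'} hg hg' x hx => by
          rw [mul_inv_rev, map_mul, map_mul, Units.val_mul, Units.val_mul, Module.End.mul_apply,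
            Module.End.mul_apply]
          exact ⟨(hg _ (hg' x hx).1).1, (hg' _ (hg x hx).2).2⟩
        inv_mem' := fun {g} hg x hx => by
          rw [inv_inv]
          exact ⟨(hg x hx).2, (hg x hx).1⟩ }
    have hKs : P.gen .s ∈ K := fun x hx => by
      refine ⟨by rw [← hS, hUS x hx]; exact hx, ?_⟩
      have h1 : (σ (P.gen .s)⁻¹ : Module.End ℂ (PolyLT d)) x = x := by
        conv_lhs => rw [← hUS x hx]
        rw [hS, ← Module.End.mul_apply, ← Units.val_mul, ← map_mul, inv_mul_cancel, map_one,
          Units.val_one, Module.End.one_apply]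
      rw [h1]; exact hx
    have hKt : P.gen .t ∈ K := fun x hx => by
      refine ⟨hUA x hx, fun i => ?_⟩
      have h1 : (σ (P.gen .t)⁻¹ : GLd d) = A₀ ^ (a - 1) := by
        rw [map_inv, ← hA₀, inv_eq_iff_mul_eq_one, ← pow_succ', Nat.sub_add_cancel ha, hta]
      rw [h1, Units.val_pow_eq_pow_val, ← Module.End.mul_apply, ← pow_add]
      exact hx _
    have hKδ : P.delta ∈ K := fun x hx => by
      rw [map_inv, hδ, ← map_inv, scal_apply, scal_apply]
      exact ⟨fun i => by rw [map_smul, map_smul, hx i, smul_zero],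
        fun i => by rw [map_smul, map_smul, hx i, smul_zero]⟩
    have hKu : P.gen .u ∈ K := by
      have : P.gen .u = (P.gen .s * P.gen .t)⁻¹ * P.delta := by
        rw [delta, inv_mul_cancel_left]
      rw [this]
      exact K.mul_mem (K.inv_mem (K.mul_mem hKs hKt)) hKδ
    have hK : ∀ g, g ∈ K := by
      intro g
      have h1 : Subgroup.closure (Set.range P.gen) ≤ K := by
        rw [Subgroup.closure_le]
        rintro _ ⟨i, rfl⟩
        cases i
        exacts [hKs, hKt, hKu]
      rw [closure_gen] at h1
      exact h1 (Subgroup.mem_top g)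
    intro x hx
    refine h.2 x fun r hr => ?_
    obtain ⟨g, e, h1⟩ := exists_pow_of_mem_cls_s hr
    change (σ r : Module.End ℂ (PolyLT d)) x = x
    have h2 : ∀ e : ℕ, ((S : Module.End ℂ (PolyLT d)) ^ e)
        ((σ g⁻¹ : Module.End ℂ (PolyLT d)) x) = (σ g⁻¹ : Module.End ℂ (PolyLT d)) x := by
      intro e
      induction e with
      | zero => rfl
      | succ e ih => rw [pow_succ, Module.End.mul_apply, hUS _ (hK g x hx).2, ih]
    rw [h1, map_mul, map_mul, Units.val_mul, Units.val_mul, Module.End.mul_apply,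
      Module.End.mul_apply, map_pow, Units.val_pow_eq_pow_val, h2, ← Module.End.mul_apply,
      ← Units.val_mul, ← map_mul, mul_inv_cancel, map_one, Units.val_one, Module.End.one_apply]
  have hB₀ : ∀ x, ((S * A₀ : GLd d) : Module.End ℂ (PolyLT d)) x =
      (A₀ : Module.End ℂ (PolyLT d)) x + (φ ∘ₗ (A₀ : Module.End ℂ (PolyLT d))) x • w := by
    intro x
    rw [Units.val_mul, Module.End.mul_apply, hφ]
    rfl
  -- The form for the pair (t, st) is φ ∘ t instead of φ. As t^a = 1, replacing i by i + (a - 1)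
  -- recovers the condition for φ.
  obtain ⟨A, B, hA, hd, hB, hd', T, hTA, hTB⟩ := exists_equiv_mulX h0 (finrank_polyLT d) hB₀ (by
    intro x hx
    refine hobs x fun i => ?_
    have h1 := hx (i + (a - 1))
    rw [LinearMap.comp_apply, ← Module.End.mul_apply, ← pow_succ', add_assoc,
      Nat.sub_add_cancel ha, pow_add, hApow, mul_one] at h1
    exact h1)
  -- transport to the model
  let τ : GLd d := ⟨T.toLinearMap, T.symm.toLinearMap, LinearMap.ext fun x => by simp,
    LinearMap.ext fun x => by simp⟩
  have hτ : ∀ (g : GLd d) (f f' : PolyLT d), T f' = (g : Module.End ℂ (PolyLT d)) (T f) →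
      ((τ⁻¹ * g * τ : GLd d) : Module.End ℂ (PolyLT d)) f = f' := by
    intro g f f' hf
    change T.symm ((g : Module.End ℂ (PolyLT d)) (T f)) = f'
    rw [← hf, LinearEquiv.symm_apply_apply]
  have hconj : ∀ (g : GLd d) (e : ℕ), (τ⁻¹ * g * τ) ^ e = τ⁻¹ * g ^ e * τ := fun g e => by
    have := conj_pow (i := e) (a := τ⁻¹) (b := g)
    rwa [inv_inv] at this
  have hA₁ : ((τ⁻¹ * A₀ * τ : GLd d) : Module.End ℂ (PolyLT d)) = mulX A hA hd :=
    LinearMap.ext fun f => hτ _ _ _ (hTA f)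
  have hB₁ : ((τ⁻¹ * (S * A₀) * τ : GLd d) : Module.End ℂ (PolyLT d)) = mulX B hB hd' :=
    LinearMap.ext fun f => hτ _ _ _ (hTB f)
  have hSA₁ : ((τ⁻¹ * S * τ) * (τ⁻¹ * A₀ * τ) : GLd d) = τ⁻¹ * (S * A₀) * τ := by group
  have hAa : A ∣ X ^ a - C 1 := by
    refine dvd_of_aeval_mulX (hP := hA) (hd := hd) h0 ?_
    rw [map_sub, map_pow, aeval_X, aeval_C, ← hA₁, ← Units.val_pow_eq_pow_val, hconj, hta, mul_one,
      inv_mul_cancel, Units.val_one, map_one, sub_self]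
  have hSA : S * A₀ = scal d lam * (σ (P.gen .u))⁻¹ := by
    rw [← hδ, delta, map_mul, map_mul, mul_inv_cancel_right]
  have hBm : B ∣ X ^ P.m - C ((lam : ℂ) ^ P.m) := by
    refine dvd_of_aeval_mulX (hP := hB) (hd := hd') h0 ?_
    rw [map_sub, map_pow, aeval_X, aeval_C, ← hB₁, ← Units.val_pow_eq_pow_val, hconj, hSA,
      (scal_commute lam _).mul_pow, inv_pow, hum, inv_one, mul_one, ← map_pow,
      ← (scal_commute _ _).eq, mul_assoc, inv_mul_cancel, mul_one, scal_val, Units.val_pow_eq_pow_val,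
      sub_self]
  have hAB : A ≠ B := by
    rintro rfl
    have h1 : S * A₀ = A₀ := by
      have h2 : τ⁻¹ * (S * A₀) * τ = τ⁻¹ * A₀ * τ := Units.ext (hB₁.trans hA₁.symm)
      exact mul_left_cancel (mul_right_cancel h2)
    have h3 : S = 1 := mul_eq_right.1 h1
    obtain ⟨y, hy⟩ := exists_nonzero h0
    refine hy (h.2 y fun r hr => ?_)
    obtain ⟨g, e, h4⟩ := exists_pow_of_mem_cls_s hr
    change (σ r : Module.End ℂ (PolyLT d)) y = y
    rw [h4, map_mul, map_mul, map_pow, ← hS, h3, one_pow, mul_one, ← map_mul, mul_inv_cancel,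
      map_one, Units.val_one, Module.End.one_apply]
  have hSk : S ^ P.k = 1 := by
    rw [hS, ← map_pow]
    exact (congrArg σ (P.gen_pow .s)).trans (map_one σ)
  refine ⟨A, B, hA, hd, hB, hd', T, hTA, hTB, hAa, hBm,
    (pow_eq_one_iff_of_mul_mulX h0 (coeff_zero_ne_zero_of_dvd ha hAa) hA₁
      ((congrArg Units.val hSA₁).trans hB₁) (lt_of_lt_of_le two_pos P.two_le_k) hAB).1 ?_⟩
  rw [hconj, hSk, mul_one, inv_mul_cancel]

/-! ### The number of reflection representations -/

variable (P d a) in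
/-- The admissible scalars for given sets of eigenvalues. -/
noncomputable def lamSet (p : Finset ℂ × Finset ℂ) : Finset ℂ :=
  (nthRootsFinset (d * P.k) (((∏ α ∈ p.1, α) / ∏ γ ∈ p.2, γ) ^ P.k)) \
    nthRootsFinset d ((∏ α ∈ p.1, α) / ∏ γ ∈ p.2, γ)

variable (P d a) in
/-- The parameters of the reflection representations: the eigenvalues of `t`, those of `u⁻¹`, and
the scalar by which `stu` acts. -/
noncomputable def datum : Finset (Σ _ : Finset ℂ × Finset ℂ, ℂ) :=
  (Finset.powersetCard d (nthRootsFinset a 1) ×ˢ Finset.powersetCard d (nthRootsFinset P.m 1)).sigma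
    (P.lamSet d)

lemma prod_ne_zero_of_mem {N : ℕ} (hN : 0 < N) {S : Finset ℂ}
    (hS : S ∈ Finset.powersetCard d (nthRootsFinset N 1)) : ∏ α ∈ S, α ≠ 0 := by
  rw [Finset.prod_ne_zero_iff]
  intro α hα h
  have := (mem_nthRootsFinset hN 1).1 ((Finset.mem_powersetCard.1 hS).1 hα)
  rw [h, zero_pow hN.ne'] at this
  exact zero_ne_one this

/-- The condition is that det s = λ^d ∏γ / ∏α is a k-th root of unity other than 1: dk solutions λ,
of which d are excluded. -/
lemma card_lamSet (h0 : 0 < d) {p : Finset ℂ × Finset ℂ} (h1 : ∏ α ∈ p.1, α ≠ 0)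
    (h2 : ∏ γ ∈ p.2, γ ≠ 0) : (P.lamSet d p).card = d * (P.k - 1) := by
  have hk : 0 < P.k := lt_of_lt_of_le two_pos P.two_le_k
  have hc := div_ne_zero h1 h2
  rw [lamSet, Finset.card_sdiff_of_subset, card_nthRootsFinset_of_ne_zero (Nat.mul_pos h0 hk)
    (pow_ne_zero _ hc), card_nthRootsFinset_of_ne_zero h0 hc, Nat.mul_sub, mul_one]
  intro x hx
  rw [mem_nthRootsFinset (Nat.mul_pos h0 hk), pow_mul]
  rw [mem_nthRootsFinset h0] at hx
  rw [hx]

lemma card_datum (h0 : 0 < d) (ha : 0 < a) :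
    (P.datum d a).card = a.choose d * P.m.choose d * (d * (P.k - 1)) := by
  rw [datum, Finset.card_sigma, Finset.sum_congr rfl (fun p hp => card_lamSet h0
    (prod_ne_zero_of_mem ha (Finset.mem_product.1 hp).1)
    (prod_ne_zero_of_mem P.m_pos (Finset.mem_product.1 hp).2)), Finset.sum_const,
    Finset.card_product, Finset.card_powersetCard, Finset.card_powersetCard,
    card_nthRootsFinset_of_ne_zero ha one_ne_zero,
    card_nthRootsFinset_of_ne_zero P.m_pos one_ne_zero, smul_eq_mul]

end JReflectionData

/-! ### Classification by eigenvalue data and the count -/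

namespace JReflectionData

variable {P : JReflectionData} {d a : ℕ} {Y : Set P.W}

lemma scaled_injective {l : ℂ} (hl : l ≠ 0) : Function.Injective fun γ : ℂ => l * γ :=
  mul_right_injective₀ hl

/-- The representation with a given set of parameters. -/
def IsModel (x : Σ _ : Finset ℂ × Finset ℂ, ℂ) (σ : P.Amb →* GLd d) : Prop :=
  ∃ (hd : (rootPoly x.1.1).natDegree = d)
    (hd' : (rootPoly (x.1.2.image fun γ => x.2 * γ)).natDegree = d) (lam : ℂˣ), (lam : ℂ) = x.2 ∧
    (σ (P.gen .t) : Module.End ℂ (PolyLT d)) = mulX (rootPoly x.1.1) (rootPoly_monic _) hd ∧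
    ((σ (P.gen .s) * σ (P.gen .t) : GLd d) : Module.End ℂ (PolyLT d)) =
      mulX (rootPoly (x.1.2.image fun γ => x.2 * γ)) (rootPoly_monic _) hd' ∧
    σ P.delta = scal d lam

lemma mem_datum_iff (h0 : 0 < d) {x : Σ _ : Finset ℂ × Finset ℂ, ℂ} :
    x ∈ P.datum d a ↔ (x.1.1 ⊆ nthRootsFinset a 1 ∧ x.1.1.card = d) ∧
      (x.1.2 ⊆ nthRootsFinset P.m 1 ∧ x.1.2.card = d) ∧
      (x.2 ^ d) ^ P.k = ((∏ α ∈ x.1.1, α) / ∏ γ ∈ x.1.2, γ) ^ P.k ∧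
      x.2 ^ d ≠ (∏ α ∈ x.1.1, α) / ∏ γ ∈ x.1.2, γ := by
  have hk : 0 < P.k := lt_of_lt_of_le two_pos P.two_le_k
  rw [datum, Finset.mem_sigma, Finset.mem_product, Finset.mem_powersetCard,
    Finset.mem_powersetCard, lamSet, Finset.mem_sdiff, mem_nthRootsFinset h0,
    mem_nthRootsFinset (Nat.mul_pos h0 hk), pow_mul, and_assoc]

lemma rootPoly_scaled_coeff_zero {Γ : Finset ℂ} {l : ℂ} (hl : l ≠ 0) :
    (rootPoly (Γ.image fun γ => l * γ)).coeff 0 =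
      (-1) ^ Γ.card * (l ^ Γ.card * ∏ γ ∈ Γ, γ) := by
  rw [rootPoly_coeff_zero, Finset.card_image_of_injective _ (scaled_injective hl),
    Finset.prod_image (scaled_injective hl).injOn, Finset.prod_mul_distrib, Finset.prod_const]

/-- The constant terms are signed products of roots. Both polynomials have degree d, so the signs
cancel and the order condition on s becomes one on λ. -/
lemma coeff_conditions_iff {S Γ : Finset ℂ} {l : ℂ} (hl : l ≠ 0) (hS : S.card = d)
    (hΓ : Γ.card = d) (hΓ0 : ∏ γ ∈ Γ, γ ≠ 0) (k : ℕ) :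
    ((rootPoly (Γ.image fun γ => l * γ)).coeff 0 ^ k = (rootPoly S).coeff 0 ^ k ∧
      (rootPoly (Γ.image fun γ => l * γ)).coeff 0 ≠ (rootPoly S).coeff 0) ↔
    (l ^ d) ^ k = ((∏ α ∈ S, α) / ∏ γ ∈ Γ, γ) ^ k ∧ l ^ d ≠ (∏ α ∈ S, α) / ∏ γ ∈ Γ, γ := by
  have h1 : ((-1 : ℂ) ^ d) ≠ 0 := pow_ne_zero _ (by norm_num)
  rw [rootPoly_scaled_coeff_zero hl, rootPoly_coeff_zero, hS, hΓ, mul_pow ((-1 : ℂ) ^ d),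
    mul_pow ((-1 : ℂ) ^ d), mul_right_inj' (pow_ne_zero _ h1), Ne, mul_right_inj' h1, mul_pow,
    div_pow, eq_div_iff (pow_ne_zero _ hΓ0), Ne, eq_div_iff hΓ0]

/-- A linear automorphism that intertwines the images of `t`, `st` and `stu` intertwines the two
representations. -/
lemma repIso_of_gen {σ τ : P.Amb →* GLd d} (T : PolyLT d ≃ₗ[ℂ] PolyLT d)
    (ht : ∀ x, T ((σ (P.gen .t) : Module.End ℂ (PolyLT d)) x) =
      (τ (P.gen .t) : Module.End ℂ (PolyLT d)) (T x))
    (hst : ∀ x, T (((σ (P.gen .s) * σ (P.gen .t) : GLd d) : Module.End ℂ (PolyLT d)) x) =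
      ((τ (P.gen .s) * τ (P.gen .t) : GLd d) : Module.End ℂ (PolyLT d)) (T x))
    (hδ : ∀ x, T ((σ P.delta : Module.End ℂ (PolyLT d)) x) =
      (τ P.delta : Module.End ℂ (PolyLT d)) (T x)) :
    ∀ g x, T ((σ g : Module.End ℂ (PolyLT d)) x) = (τ g : Module.End ℂ (PolyLT d)) (T x) := by
  let K : Subgroup P.Amb :=
    { carrier := {g | ∀ x, T ((σ g : Module.End ℂ (PolyLT d)) x) =
        (τ g : Module.End ℂ (PolyLT d)) (T x)}
      one_mem' := fun x => by simp
      mul_mem' := fun {g g'} hg hg' x => by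
        rw [map_mul, map_mul, Units.val_mul, Units.val_mul, Module.End.mul_apply,
          Module.End.mul_apply, hg, hg']
      inv_mem' := fun {g} hg x => by
        have h1 := hg ((σ g⁻¹ : Module.End ℂ (PolyLT d)) x)
        rw [← Module.End.mul_apply, ← Units.val_mul, ← map_mul, mul_inv_cancel, map_one,
          Units.val_one, Module.End.one_apply] at h1
        rw [h1, ← Module.End.mul_apply, ← Units.val_mul, ← map_mul, inv_mul_cancel, map_one,
          Units.val_one, Module.End.one_apply] }
  have hKt : P.gen .t ∈ K := ht
  have hKst : P.gen .s * P.gen .t ∈ K := fun x => by rw [map_mul, map_mul]; exact hst x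
  have hKδ : P.delta ∈ K := hδ
  have hKs : P.gen .s ∈ K := by
    rw [← mul_inv_cancel_right (P.gen .s) (P.gen .t)]
    exact K.mul_mem hKst (K.inv_mem hKt)
  have hKu : P.gen .u ∈ K := by
    have : P.gen .u = (P.gen .s * P.gen .t)⁻¹ * P.delta := by rw [delta, inv_mul_cancel_left]
    rw [this]
    exact K.mul_mem (K.inv_mem hKst) hKδ
  have h1 : Subgroup.closure (Set.range P.gen) ≤ K := by
    rw [Subgroup.closure_le]
    rintro _ ⟨i, rfl⟩
    cases i
    exacts [hKs, hKt, hKu]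
  rw [closure_gen] at h1
  exact fun g => h1 (Subgroup.mem_top g)

lemma exists_isModel (h0 : 0 < d) (ha : 0 < a) (hab : a ∣ P.b * P.n)
    (hY : ∀ σ : P.Amb →* GLd d, (∀ y ∈ Y, σ y = 1) ↔
      σ (P.gen .t) ^ a = 1 ∧ σ (P.gen .u) ^ P.m = 1)
    {x : Σ _ : Finset ℂ × Finset ℂ, ℂ} (hx : x ∈ P.datum d a) :
    ∃ σ : P.Amb →* GLd d, IsModel x σ ∧ IsReflRep d (P.cls .s) Y (σ.comp P.W.subtype) := by
  obtain ⟨⟨S, Γ⟩, l⟩ := x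
  have hp := (Finset.mem_sigma.1 hx).1
  have hS0 := prod_ne_zero_of_mem ha (Finset.mem_product.1 hp).1
  have hΓ0 := prod_ne_zero_of_mem P.m_pos (Finset.mem_product.1 hp).2
  obtain ⟨⟨hS, hSd⟩, ⟨hΓ, hΓd⟩, hk⟩ := (mem_datum_iff h0).1 hx
  have hk0 : P.k ≠ 0 := by have := P.two_le_k; omega
  have hl : l ≠ 0 := by
    rintro rfl
    have h1 := hk.1
    rw [zero_pow h0.ne', zero_pow hk0] at h1
    exact pow_ne_zero _ (div_ne_zero hS0 hΓ0) h1.symm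
  have hcoeff := (coeff_conditions_iff hl hSd hΓd hΓ0 P.k).2 hk
  have hd : (rootPoly S).natDegree = d := by rw [rootPoly_natDegree, hSd]
  have hd' : (rootPoly (Γ.image fun γ => l * γ)).natDegree = d := by
    rw [rootPoly_natDegree, Finset.card_image_of_injective _ (scaled_injective hl), hΓd]
  have hAa : rootPoly S ∣ X ^ a - C 1 :=
    rootPoly_dvd ha fun α hα => (mem_nthRootsFinset ha 1).1 (hS hα)
  have hBm : rootPoly (Γ.image fun γ => l * γ) ∣
      X ^ P.m - C (((Units.mk0 l hl : ℂˣ) : ℂ) ^ P.m) := by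
    refine rootPoly_dvd P.m_pos fun β hβ => ?_
    obtain ⟨γ, hγ, rfl⟩ := Finset.mem_image.1 hβ
    rw [mul_pow, (mem_nthRootsFinset P.m_pos 1).1 (hΓ hγ), mul_one, Units.val_mk0]
  obtain ⟨σ, h1, h2, h3, h4, h5⟩ := P.exists_rep h0 (rootPoly_monic _) hd (rootPoly_monic _) hd' ha
    hab (Units.mk0 l hl) hAa hBm hcoeff.1 hcoeff.2
  exact ⟨σ, ⟨hd, hd', Units.mk0 l hl, rfl, h1, h2, h3⟩,
    isReflRep_of_mulX (coeff_zero_ne_zero_of_dvd ha hAa) (fun h => hcoeff.2 (by rw [h])) h1 h2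
      ((hY σ).2 ⟨h4, h5⟩)⟩

/-- With the same scalar for δ, an isomorphism over `P.W` is one over J = W⟨δ⟩. It conjugates the
companion operators of t and of st, which determine their polynomials. -/
lemma IsModel.eq_of_repIso (h0 : 0 < d) {x x' : Σ _ : Finset ℂ × Finset ℂ, ℂ}
    {σ σ' : P.Amb →* GLd d} (hx : IsModel x σ) (hx' : IsModel x' σ') (hl : x.2 = x'.2)
    (h : RepIso (σ.comp P.W.subtype) (σ'.comp P.W.subtype)) : x = x' := by
  obtain ⟨⟨S, Γ⟩, l⟩ := x
  obtain ⟨⟨S', Γ'⟩, l'⟩ := x'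
  obtain rfl : l = l' := hl
  obtain ⟨hd, hd', lam, hlam, ht, hst, hδ⟩ := hx
  obtain ⟨hd₁, hd₁', lam', hlam', ht', hst', hδ'⟩ := hx'
  obtain rfl : lam = lam' := Units.ext (hlam.trans hlam'.symm)
  obtain ⟨T, hT⟩ := h
  have hTδ : ∀ (i : ℤ) x, T ((σ (P.delta ^ i) : Module.End ℂ (PolyLT d)) x) =
      (σ' (P.delta ^ i) : Module.End ℂ (PolyLT d)) (T x) := by
    intro i x
    rw [map_zpow, map_zpow, hδ, hδ', ← map_zpow, scal_apply, scal_apply, map_smul]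
  have hTg : ∀ g x, T ((σ g : Module.End ℂ (PolyLT d)) x) =
      (σ' g : Module.End ℂ (PolyLT d)) (T x) := by
    intro g x
    obtain ⟨w, i, rfl⟩ := P.exists_eq_mul_delta g
    rw [map_mul, map_mul, Units.val_mul, Units.val_mul, Module.End.mul_apply,
      Module.End.mul_apply, ← hTδ]
    exact hT w _
  have e1 : rootPoly S = rootPoly S' := eq_of_mulX_conj h0 T fun f => by
    have := hTg (P.gen .t) f
    rw [ht, ht'] at this
    exact this
  have e2 : rootPoly (Γ.image fun γ => l * γ) = rootPoly (Γ'.image fun γ => l * γ) :=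
    eq_of_mulX_conj h0 T fun f => by
      have := hTg (P.gen .s * P.gen .t) f
      rw [map_mul, map_mul, hst, hst'] at this
      exact this
  have hl0 : l ≠ 0 := by
    have h1 : (lam : ℂ) = l := hlam
    rw [← h1]
    exact lam.ne_zero
  have e3 : S = S' := rootPoly_injective e1
  have e4 : Γ = Γ' := Finset.image_injective (scaled_injective hl0) (rootPoly_injective e2)
  rw [e3, e4]

/-- Once λ is chosen the representation extends to J. The normal form then supplies the eigenvalues,
those of st being divided by λ to give the eigenvalues of u⁻¹. -/
lemma exists_datum (h0 : 0 < d) (ha : 0 < a)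
    (hY : ∀ σ : P.Amb →* GLd d, (∀ y ∈ Y, σ y = 1) ↔
      σ (P.gen .t) ^ a = 1 ∧ σ (P.gen .u) ^ P.m = 1)
    {ρ : P.W →* GLd d} (h : IsReflRep d (P.cls .s) Y ρ) {lam : ℂˣ}
    (hlam : ρ P.zeta = scal d (lam ^ (P.n * P.m))) :
    ∃ x ∈ P.datum d a, x.2 = lam ∧
      ∀ σ : P.Amb →* GLd d, IsModel x σ → RepIso (σ.comp P.W.subtype) ρ := by
  obtain ⟨σ, rfl, hδ⟩ := exists_extension_amb hlam
  obtain ⟨hta, hum⟩ := (hY σ).1 h.3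
  obtain ⟨A, B, hA, hd, hB, hd', T, hTA, hTB, hAa, hBm, hk⟩ :=
    exists_normal_form h0 ha h hδ hta hum
  obtain ⟨S, rfl, hSd, hS⟩ := exists_rootPoly hA ha one_ne_zero hAa
  obtain ⟨S₁, rfl, hS₁d, hS₁⟩ :=
    exists_rootPoly hB P.m_pos (pow_ne_zero _ lam.ne_zero) hBm
  let Γ : Finset ℂ := S₁.image fun β => (lam : ℂ)⁻¹ * β
  have hl := lam.ne_zero
  have hS₁Γ : S₁ = Γ.image fun γ => (lam : ℂ) * γ := by
    rw [Finset.image_image]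
    have : ((fun γ => (lam : ℂ) * γ) ∘ fun β => (lam : ℂ)⁻¹ * β) = id := by
      funext β
      simp
    rw [this, Finset.image_id]
  have hΓd : Γ.card = d := by
    rw [Finset.card_image_of_injective _ (scaled_injective (inv_ne_zero hl)), hS₁d, hd']
  have hΓ : Γ ⊆ nthRootsFinset P.m 1 := by
    intro γ hγ
    obtain ⟨β, hβ, rfl⟩ := Finset.mem_image.1 hγ
    rw [mem_nthRootsFinset P.m_pos, mul_pow, hS₁ β hβ, inv_pow,
      inv_mul_cancel₀ (pow_ne_zero _ hl)]
  have hSa : S ⊆ nthRootsFinset a 1 := fun α hα => (mem_nthRootsFinset ha 1).2 (hS α hα)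
  have hΓ0 : ∏ γ ∈ Γ, γ ≠ 0 :=
    prod_ne_zero_of_mem P.m_pos (Finset.mem_powersetCard.2 ⟨hΓ, hΓd⟩)
  rw [hS₁Γ, coeff_conditions_iff hl (hSd.trans hd) hΓd hΓ0] at hk
  refine ⟨⟨(S, Γ), lam⟩, (mem_datum_iff h0).2 ⟨⟨hSa, hSd.trans hd⟩, ⟨hΓ, hΓd⟩, hk⟩, rfl, ?_⟩
  rintro τ ⟨_, _, lam', hlam', ht, hst, hδ'⟩
  obtain rfl : lam' = lam := Units.ext hlam'
  refine ⟨T, fun g => repIso_of_gen (σ := τ) (τ := σ) T ?_ ?_ ?_ (g : P.Amb)⟩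
  · intro x
    rw [ht]
    exact hTA x
  · intro x
    rw [hst, ← hTB]
    congr 2
    simp only [← hS₁Γ]
  · intro x
    rw [hδ, hδ', scal_apply, scal_apply, map_smul]

lemma RepIso.scalar {ρ ρ' : P.W →* GLd d} (h : RepIso ρ ρ') {μ : ℂˣ} {w : P.W}
    (hμ : ρ w = scal d μ) : ρ' w = scal d μ := by
  obtain ⟨T, hT⟩ := h
  refine Units.ext (LinearMap.ext fun x => ?_)
  have := hT w (T.symm x)
  rw [hμ, scal_apply, map_smul, LinearEquiv.apply_symm_apply] at this
  rw [← this, scal_apply]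

/-- The number of reflection representations of a J-reflection group. -/
theorem reflCount_mul (h0 : 0 < d) (ha : 0 < a) (hab : a ∣ P.b * P.n)
    (hY : ∀ σ : P.Amb →* GLd d, (∀ y ∈ Y, σ y = 1) ↔
      σ (P.gen .t) ^ a = 1 ∧ σ (P.gen .u) ^ P.m = 1) :
    reflCount d (P.cls .s) Y * (P.n * P.m) =
      a.choose d * P.m.choose d * (d * (P.k - 1)) := by
  have hnm : 0 < P.n * P.m := Nat.mul_pos P.n_pos P.m_pos
  choose σ hσ hσ' using fun x : P.datum d a => exists_isModel h0 ha hab hY x.2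
  let Φ : P.datum d a → Quotient (reflSetoid d (P.cls .s) Y) := fun x =>
    Quotient.mk _ ⟨(σ x).comp P.W.subtype, hσ' x⟩
  have hΦ : ∀ x (ρ : {ρ : P.W →* GLd d // IsReflRep d (P.cls .s) Y ρ}),
      Φ x = Quotient.mk _ ρ ↔ RepIso ((σ x).comp P.W.subtype) ρ.1 := fun x ρ => Quotient.eq
  -- The data giving a fixed representation correspond to its extensions, that is, to the nm roots λ
  -- of λ^{nm} = μ, where μ is the scalar of δ^{nm}.
  have hfib : ∀ q, Nat.card {x // Φ x = q} = P.n * P.m := by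
    intro q
    obtain ⟨ρ, rfl⟩ := Quotient.exists_rep q
    obtain ⟨μ, hμ⟩ := exists_scalar h0 ρ.2
    have hmem : ∀ x : {x // Φ x = Quotient.mk _ ρ},
        x.1.1.2 ∈ nthRootsFinset (P.n * P.m) (μ : ℂ) := by
      rintro ⟨x, hx⟩
      obtain ⟨_, _, lam, hlam, _, _, hδ⟩ := hσ x
      have h1 := RepIso.scalar ((hΦ x ρ).1 hx).symm hμ
      have h2 : σ x (P.delta ^ (P.n * P.m)) = scal d μ := h1
      rw [map_pow, hδ, ← map_pow] at h2
      rw [mem_nthRootsFinset hnm, ← hlam, ← Units.val_pow_eq_pow_val, scal_injective h0 h2]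
    have hbij : Function.Bijective fun x : {x // Φ x = Quotient.mk _ ρ} =>
        (⟨x.1.1.2, hmem x⟩ : nthRootsFinset (P.n * P.m) (μ : ℂ)) := by
      constructor
      · rintro ⟨x, hx⟩ ⟨x', hx'⟩ hxx
        refine Subtype.ext (Subtype.ext ?_)
        exact (hσ x).eq_of_repIso h0 (hσ x') (congrArg Subtype.val hxx)
          (((hΦ x ρ).1 hx).trans ((hΦ x' ρ).1 hx').symm)
      · rintro ⟨l, hl⟩
        rw [mem_nthRootsFinset hnm] at hl
        have hl0 : l ≠ 0 := by
          rintro rfl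
          rw [zero_pow hnm.ne'] at hl
          exact μ.ne_zero hl.symm
        obtain ⟨x, hx, hx2, hx3⟩ := exists_datum h0 ha hY ρ.2 (lam := Units.mk0 l hl0) (by
          rw [hμ]
          congr 1
          exact Units.ext (by rw [Units.val_pow_eq_pow_val, Units.val_mk0, hl]))
        exact ⟨⟨⟨x, hx⟩, (hΦ _ _).2 (hx3 _ (hσ ⟨x, hx⟩))⟩, Subtype.ext hx2⟩
    rw [Nat.card_eq_of_bijective _ hbij, Nat.card_eq_fintype_card, Fintype.card_coe,
      card_nthRootsFinset_of_ne_zero hnm μ.ne_zero]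
  -- An empty fibre would have cardinality 0, contradicting nm > 0; surjectivity makes the quotient
  -- finite.
  have hsurj : Function.Surjective Φ := by
    intro q
    by_contra hq
    have h1 := hfib q
    have : IsEmpty {x // Φ x = q} := ⟨fun x => hq ⟨x.1, x.2⟩⟩
    rw [Nat.card_of_isEmpty] at h1
    omega
  have : Finite (Quotient (reflSetoid d (P.cls .s) Y)) := Finite.of_surjective Φ hsurj
  have := Fintype.ofFinite (Quotient (reflSetoid d (P.cls .s) Y))
  rw [← card_datum h0 ha, ← Fintype.card_coe, ← Nat.card_eq_fintype_card,
    ← Nat.card_congr (Equiv.sigmaFiberEquiv Φ), Nat.card_sigma, Finset.sum_congr rfl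
    (fun q _ => hfib q), Finset.sum_const, smul_eq_mul, reflCount, Nat.card_eq_fintype_card,
    Finset.card_univ]

end JReflectionData

namespace JReflectionData

variable {P Q : JReflectionData} {d : ℕ}

/-! ### The counts for the classes of reflections -/

lemma map_cls_eq_one_iff {H : Type} [Group H] (i : JGen) (σ : P.Amb →* H) :
    (∀ y ∈ P.cls i, σ y = 1) ↔ σ (P.gen i) ^ P.expo i = 1 := by
  rw [← map_pow]
  change _ ↔ σ (P.refl i) = 1
  constructor
  · intro h
    by_cases hi : 2 ≤ P.ord i
    · exact h _ (P.reflW_mem_cls hi)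
    · have h1 : P.ord i = 1 := by have := P.ord_pos i; omega
      have h2 := P.refl_pow_ord i
      rw [h1, pow_one] at h2
      rw [h2, map_one]
  · rintro h y ⟨g, e, -, hy⟩
    rw [hy, map_mul, map_mul, map_zpow, h, one_zpow, mul_one, map_inv, mul_inv_cancel]

/-- Killing the class of u imposes nothing on t, whose eigenvalues range over all bn-th roots of
unity; hence a = bn. -/
lemma reflCount_cls_u_mul (h0 : 0 < d) :
    reflCount d (P.cls .s) (P.cls .u) * (P.n * P.m) =
      (P.b * P.n).choose d * P.m.choose d * (d * (P.k - 1)) := by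
  refine reflCount_mul h0 (Nat.mul_pos P.b_pos P.n_pos) dvd_rfl fun σ => ?_
  have h1 : σ (P.gen .t) ^ (P.b * P.n) = 1 := by
    rw [← map_pow]
    exact (congrArg σ (P.gen_pow .t)).trans (map_one σ)
  rw [map_cls_eq_one_iff]
  exact (and_iff_right h1).symm

lemma reflCount_cls_tu_mul (h0 : 0 < d) :
    reflCount d (P.cls .s) (P.cls .t ∪ P.cls .u) * (P.n * P.m) =
      P.n.choose d * P.m.choose d * (d * (P.k - 1)) := by
  refine reflCount_mul h0 P.n_pos (Dvd.intro_left _ rfl) fun σ => ?_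
  have h1 := map_cls_eq_one_iff .t σ
  have h2 := map_cls_eq_one_iff .u σ
  change _ ↔ σ (P.gen .t) ^ P.expo .t = 1 ∧ σ (P.gen .u) ^ P.expo .u = 1
  rw [← h1, ← h2]
  simp only [Set.mem_union, or_imp, forall_and]

lemma choose_two_mul (x : ℕ) : (x.choose 2 : ℤ) * 2 = x * (x - 1) := by
  cases x with
  | zero => simp
  | succ x =>
    have h := Nat.add_one_mul_choose_eq x 1
    rw [Nat.choose_one_right] at h
    have h' : ((x : ℤ) + 1) * x = ((x + 1).choose 2 : ℤ) * 2 := by exact_mod_cast h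
    rw [← h']
    push_cast
    ring

lemma choose_three_mul (x : ℕ) : (x.choose 3 : ℤ) * 6 = x * (x - 1) * (x - 2) := by
  cases x with
  | zero => simp
  | succ x =>
    have h := Nat.add_one_mul_choose_eq x 2
    have h' : ((x : ℤ) + 1) * x.choose 2 = ((x + 1).choose 3 : ℤ) * 3 := by exact_mod_cast h
    have h2 := choose_two_mul x
    push_cast
    linear_combination (-2) * h' + ((x : ℤ) + 1) * h2

lemma two_mul_of_reflCount_two {N a : ℕ}
    (h : N * (P.n * P.m) = a.choose 2 * P.m.choose 2 * (2 * (P.k - 1))) :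
    2 * (N : ℤ) * P.n = a * (a - 1) * (P.m - 1) * (P.k - 1) := by
  have hm : (P.m : ℤ) ≠ 0 := by exact_mod_cast P.m_pos.ne'
  have hk := P.two_le_k
  have h' : (N : ℤ) * (P.n * P.m) = a.choose 2 * P.m.choose 2 * (2 * (P.k - 1)) := by
    have := congrArg (Nat.cast : ℕ → ℤ) h
    push_cast [Nat.cast_sub (show 1 ≤ P.k by omega)] at this
    exact this
  refine mul_left_cancel₀ hm ?_
  have h1 := choose_two_mul a
  have h2 := choose_two_mul P.m
  linear_combination 2 * h' + (P.m.choose 2 * 2 * (P.k - 1) : ℤ) * h1 +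
    (a * (a - 1) * (P.k - 1) : ℤ) * h2

lemma twelve_mul_of_reflCount_three {N a : ℕ}
    (h : N * (P.n * P.m) = a.choose 3 * P.m.choose 3 * (3 * (P.k - 1))) :
    12 * (N : ℤ) * P.n =
      a * (a - 1) * (a - 2) * ((P.m - 1) * (P.m - 2)) * (P.k - 1) := by
  have hm : (P.m : ℤ) ≠ 0 := by exact_mod_cast P.m_pos.ne'
  have hk := P.two_le_k
  have h' : (N : ℤ) * (P.n * P.m) = a.choose 3 * P.m.choose 3 * (3 * (P.k - 1)) := by
    have := congrArg (Nat.cast : ℕ → ℤ) h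
    push_cast [Nat.cast_sub (show 1 ≤ P.k by omega)] at this
    exact this
  refine mul_left_cancel₀ hm ?_
  have h1 := choose_three_mul a
  have h2 := choose_three_mul P.m
  linear_combination 12 * h' + (P.m.choose 3 * 6 * (P.k - 1) : ℤ) * h1 +
    (a * (a - 1) * (a - 2) * (P.k - 1) : ℤ) * h2

lemma k_sub_one_ne_zero (P : JReflectionData) : (P.k : ℤ) - 1 ≠ 0 := by
  have := P.two_le_k
  omega

lemma reflCount_cls_u_two :
    2 * (reflCount 2 (P.cls .s) (P.cls .u) : ℤ) =
      P.b * (P.b * P.n - 1) * (P.m - 1) * (P.k - 1) := by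
  have hn : (P.n : ℤ) ≠ 0 := by exact_mod_cast P.n_pos.ne'
  have := two_mul_of_reflCount_two (reflCount_cls_u_mul (P := P) two_pos)
  push_cast at this
  refine mul_right_cancel₀ hn (this.trans ?_)
  ring

lemma reflCount_cls_tu_two :
    2 * (reflCount 2 (P.cls .s) (P.cls .t ∪ P.cls .u) : ℤ) =
      (P.n - 1) * (P.m - 1) * (P.k - 1) := by
  have hn : (P.n : ℤ) ≠ 0 := by exact_mod_cast P.n_pos.ne'
  have := two_mul_of_reflCount_two (reflCount_cls_tu_mul (P := P) two_pos)
  refine mul_right_cancel₀ hn (this.trans ?_)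
  ring

lemma reflCount_cls_tu_three :
    12 * (reflCount 3 (P.cls .s) (P.cls .t ∪ P.cls .u) : ℤ) =
      ((P.n - 1) * (P.m - 1) * (P.k - 1)) * ((P.n - 2) * (P.m - 2)) := by
  have hn : (P.n : ℤ) ≠ 0 := by exact_mod_cast P.n_pos.ne'
  have := twelve_mul_of_reflCount_three (reflCount_cls_tu_mul (P := P) three_pos)
  refine mul_right_cancel₀ hn (this.trans ?_)
  ring

/-! ### Isomorphisms between ambient J-groups -/

/-- Reversing the order of the generators. -/
lemma exists_hom_inv {π : JGen → JGen} (hm : ∀ i, P.modulus i = Q.modulus (π i))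
    (h1 : Q.gen (π .u) * Q.gen (π .t) * Q.gen (π .s) = Q.delta)
    (h2 : Q.gen (π .s) * Q.gen (π .u) * Q.gen (π .t) = Q.delta)
    (h3 : Q.gen (π .t) * Q.gen (π .s) * Q.gen (π .u) = Q.delta) :
    ∃ σ : P.Amb →* Q.Amb, ∀ i, σ (P.gen i) = (Q.gen (π i))⁻¹ := by
  have hpow : ∀ i, (Q.gen (π i))⁻¹ ^ P.modulus i = 1 := fun i => by
    rw [hm, inv_pow, gen_pow, inv_one]
  obtain ⟨σ, hs, ht, hu⟩ := P.exists_hom_of_gen (Q.gen (π .s))⁻¹ (Q.gen (π .t))⁻¹ (Q.gen (π .u))⁻¹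
    (hpow .s) (hpow .t) (hpow .u)
    (inv_injective (by simpa [mul_assoc] using h1.trans h2.symm))
    (inv_injective (by simpa [mul_assoc] using h2.trans h3.symm))
  exact ⟨σ, fun i => by cases i <;> assumption⟩

lemma exists_amb_equiv {π : JGen → JGen} (hπ : ∀ i, π (π i) = i) {σ : P.Amb →* Q.Amb}
    {τ : Q.Amb →* P.Amb} (hσ : ∀ i, σ (P.gen i) = (Q.gen (π i))⁻¹)
    (hτ : ∀ i, τ (Q.gen i) = (P.gen (π i))⁻¹) :
    ∃ e : P.Amb ≃* Q.Amb, ∀ i, e (P.gen i) = (Q.gen (π i))⁻¹ := by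
  refine ⟨MonoidHom.toMulEquiv σ τ ?_ ?_, hσ⟩
  · refine PresentedGroup.ext fun i => ?_
    change τ (σ (P.gen i)) = P.gen i
    rw [hσ, map_inv, hτ, hπ, inv_inv]
  · refine PresentedGroup.ext fun i => ?_
    change σ (τ (Q.gen i)) = Q.gen i
    rw [hτ, map_inv, hσ, hπ, inv_inv]

lemma exists_W_equiv {π : JGen → JGen} (hπ : ∀ i, π (π i) = i)
    (he : ∀ i, P.expo i = Q.expo (π i)) (e : P.Amb ≃* Q.Amb)
    (hgen : ∀ i, e (P.gen i) = (Q.gen (π i))⁻¹) :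
    ∃ f : P.W ≃* Q.W, ∀ i, f '' P.cls i = Q.cls (π i) := by
  have hrefl : ∀ i, e (P.refl i) = (Q.refl (π i))⁻¹ := fun i => by
    rw [refl, map_pow, hgen, he, inv_pow, refl]
  have hsymm : ∀ i, e.symm (Q.refl (π i)) = (P.refl i)⁻¹ := fun i => by
    rw [MulEquiv.symm_apply_eq, map_inv, hrefl, inv_inv]
  have h1 : P.W ≤ Q.W.comap e.toMonoidHom := by
    have : (Q.W.comap e.toMonoidHom).Normal := Subgroup.Normal.comap inferInstance _
    refine Subgroup.normalClosure_le_normal fun a ha => ?_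
    obtain ⟨i, rfl⟩ := (P.mem_basic_iff a).1 ha
    change e (P.refl i) ∈ Q.W
    rw [hrefl]
    exact inv_mem (Q.refl_mem _)
  have h2 : Q.W ≤ P.W.comap e.symm.toMonoidHom := by
    have : (P.W.comap e.symm.toMonoidHom).Normal := Subgroup.Normal.comap inferInstance _
    refine Subgroup.normalClosure_le_normal fun a ha => ?_
    obtain ⟨i, rfl⟩ := (Q.mem_basic_iff a).1 ha
    change e.symm (Q.refl i) ∈ P.W
    rw [← hπ i, hsymm]
    exact inv_mem (P.refl_mem _)
  have hW : P.W.map e.toMonoidHom = Q.W :=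
    le_antisymm (Subgroup.map_le_iff_le_comap.2 h1) fun q hq =>
      ⟨e.symm q, h2 hq, e.apply_symm_apply q⟩
  let f : P.W ≃* Q.W := (e.subgroupMap P.W).trans (MulEquiv.subgroupCongr hW)
  have hf : ∀ r : P.W, ((f r : Q.W) : Q.Amb) = e r := fun r => rfl
  refine ⟨f, fun i => Set.Subset.antisymm ?_ ?_⟩
  · rintro _ ⟨r, ⟨g, l, hl, hr⟩, rfl⟩
    refine ⟨e g, -l, ?_, ?_⟩
    · rw [zpow_neg, ← inv_zpow, ← hrefl, ← map_zpow, Ne, MulEquiv.map_eq_one_iff]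
      exact hl
    · rw [hf, hr, map_mul, map_mul, map_inv, map_zpow, hrefl, inv_zpow, zpow_neg]
  · rintro q ⟨g, l, hl, hq⟩
    refine ⟨f.symm q, ⟨e.symm g, -l, ?_, e.injective ?_⟩, f.apply_symm_apply q⟩
    · rw [zpow_neg, ← inv_zpow, ← hsymm, ← map_zpow, Ne, MulEquiv.map_eq_one_iff]
      exact hl
    · rw [← hf, MulEquiv.apply_symm_apply, hq, map_mul, map_mul, map_inv, map_zpow, hrefl,
        MulEquiv.apply_symm_apply, inv_zpow, zpow_neg, inv_inv]

/-- The transposition of the last two columns. -/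
def swapTU : JGen → JGen
  | .s => .s
  | .t => .u
  | .u => .t

/-- The transposition of the first two columns. -/
def swapST : JGen → JGen
  | .s => .t
  | .t => .s
  | .u => .u

/-- Exchanging two letters reverses the cyclic order in stu = tus = ust, and inverting all the
generators restores it. A class is stable under inversion, so it goes onto the exchanged class. -/
lemma exists_swap_equiv (P : JReflectionData) :
    ∃ f : P.W ≃* P.swap.W, ∀ i, f '' P.cls i = P.swap.cls (swapTU i) := by
  have hom : ∀ P : JReflectionData, ∃ σ : P.Amb →* P.swap.Amb,
      ∀ i, σ (P.gen i) = (P.swap.gen (swapTU i))⁻¹ := fun P =>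
    exists_hom_inv (fun i => by cases i <;> rfl) P.swap.delta_eq_tus.symm rfl
      P.swap.delta_eq_ust.symm
  have hπ : ∀ i, swapTU (swapTU i) = i := fun i => by cases i <;> rfl
  obtain ⟨σ, hσ⟩ := hom P
  obtain ⟨τ, hτ⟩ := hom P.swap
  obtain ⟨e, he⟩ := exists_amb_equiv hπ hσ hτ
  exact exists_W_equiv hπ (fun i => by cases i <;> rfl) e he

/-- The column of s has exponent 1, so exchanging it with the column of t preserves the shape of the
data only when n = 1. -/
lemma exists_swapST_equiv {P Q : JReflectionData} (hP : P.n = 1) (hQ : Q.n = 1)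
    (hk : Q.k = P.b) (hb : Q.b = P.k) (hc : Q.c = P.c) (hm : Q.m = P.m) :
    ∃ f : P.W ≃* Q.W, ∀ i, f '' P.cls i = Q.cls (swapST i) := by
  have hom : ∀ {P Q : JReflectionData}, P.n = 1 → Q.n = 1 → Q.k = P.b → Q.b = P.k → Q.c = P.c →
      Q.m = P.m → ∃ σ : P.Amb →* Q.Amb, ∀ i, σ (P.gen i) = (Q.gen (swapST i))⁻¹ := by
    intro P Q hP hQ hk hb hc hm
    refine exists_hom_inv (fun i => ?_) Q.delta_eq_ust.symm Q.delta_eq_tus.symm rfl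
    cases i <;> simp [modulus, swapST, hP, hQ, hk, hb, hc, hm]
  have hπ : ∀ i, swapST (swapST i) = i := fun i => by cases i <;> rfl
  obtain ⟨σ, hσ⟩ := hom hP hQ hk hb hc hm
  obtain ⟨τ, hτ⟩ := hom hQ hP hb.symm hk.symm hc.symm hm.symm
  obtain ⟨e, he⟩ := exists_amb_equiv hπ hσ hτ
  exact exists_W_equiv hπ (fun i => by cases i <;> simp [expo, swapST, hP, hQ, hm]) e he

/-! ### Representations that are trivial on the first class -/

lemma mk_commute_gen_t (g : P.Amb) :
    Commute (QuotientGroup.mk (P.gen .t) : P.Amb ⧸ Subgroup.normalClosure {P.gen .s})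
      (QuotientGroup.mk g) := by
  have hs : (QuotientGroup.mk (P.gen .s) : P.Amb ⧸ Subgroup.normalClosure {P.gen .s}) = 1 := by
    rw [QuotientGroup.eq_one_iff]
    exact Subgroup.subset_normalClosure rfl
  have hg : g ∈ Subgroup.closure (Set.range P.gen) := by rw [closure_gen]; trivial
  induction hg using Subgroup.closure_induction with
  | mem x hx =>
    obtain ⟨i, rfl⟩ := hx
    cases i
    · rw [hs]
      exact Commute.one_right _
    · exact Commute.refl _
    · have h := congrArg (QuotientGroup.mk (s := Subgroup.normalClosure {P.gen .s}))
        P.delta_eq_ust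
      rw [delta, QuotientGroup.mk_mul, QuotientGroup.mk_mul, QuotientGroup.mk_mul,
        QuotientGroup.mk_mul, hs, one_mul, mul_one] at h
      exact h
  | one => exact Commute.one_right _
  | mul x y _ _ hx hy => exact hx.mul_right hy
  | inv x _ hx => exact hx.inv_right

/-- All J-conjugates of s belong to the class of s, so killing that class kills the normal closure
taken in the ambient group. -/
lemma map_eq_one_of_mem_normalClosure {H : Type} [Group H] {ρ : P.W →* H}
    (h : ∀ y ∈ P.cls .s, ρ y = 1) {w : P.W}
    (hw : (w : P.Amb) ∈ Subgroup.normalClosure {P.gen .s}) : ρ w = 1 := by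
  have h1 : Subgroup.normalClosure {P.gen .s} ≤ ρ.ker.map P.W.subtype := by
    refine (Subgroup.closure_le _).2 fun x hx => ?_
    obtain ⟨a, rfl, hx⟩ := Group.mem_conjugatesOfSet_iff.1 hx
    obtain ⟨g, rfl⟩ := isConj_iff.1 hx
    obtain ⟨r, hr, hr'⟩ := conj_s_mem g
    exact ⟨r, h r hr, hr'⟩
  obtain ⟨v, hv, hvw⟩ := h1 hw
  rw [← Subtype.ext hvw]
  exact hv

/-- Modulo the normal closure of s the element t is central, so the whole class of t acts by powers
of one rank one perturbation of the identity, which fixes a non-zero vector in dimension 2. -/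
lemma reflCount_cls_t_eq_zero (hb : 2 ≤ P.b) {Y : Set P.W} (hY : P.cls .s ⊆ Y) :
    reflCount 2 (P.cls .t) Y = 0 := by
  have hempty : IsEmpty {ρ : P.W →* GLd 2 // IsReflRep 2 (P.cls .t) Y ρ} := by
    refine ⟨fun ⟨ρ, h⟩ => ?_⟩
    let a : P.W := ⟨P.refl .t, P.refl_mem .t⟩
    obtain ⟨φ, w, hφ⟩ := h.1 a (P.reflW_mem_cls (i := .t) hb)
    have : FiniteDimensional ℂ (PolyLT 2) := (degreeLTEquiv ℂ 2).symm.finiteDimensional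
    have hker : LinearMap.ker φ ≠ ⊥ := LinearMap.ker_ne_bot_of_finrank_lt (by
      rw [finrank_polyLT, Module.finrank_self]
      exact one_lt_two)
    obtain ⟨x, hx, hx0⟩ := (Submodule.ne_bot_iff _).1 hker
    refine hx0 (h.2 x fun r hr => ?_)
    obtain ⟨g, e, -, hr⟩ := hr
    obtain ⟨v, hv⟩ := P.conj_eq_conj_W (P.refl .t ^ e) g
    have hcomm : ρ (v * a ^ e * v⁻¹ * (a ^ e)⁻¹) = 1 := by
      refine map_eq_one_of_mem_normalClosure (fun y hy => h.3 y (hY hy)) ?_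
      rw [← QuotientGroup.eq_one_iff]
      have h1 := (((mk_commute_gen_t (v : P.Amb)).pow_left P.n).zpow_left e).eq
      rw [← QuotientGroup.mk_pow, ← QuotientGroup.mk_zpow] at h1
      change QuotientGroup.mk ((v : P.Amb) * (P.gen .t ^ P.n) ^ e * (v : P.Amb)⁻¹ *
        ((P.gen .t ^ P.n) ^ e)⁻¹) = _
      rw [QuotientGroup.mk_mul, QuotientGroup.mk_mul, QuotientGroup.mk_mul, ← h1,
        QuotientGroup.mk_inv, mul_inv_cancel_right, QuotientGroup.mk_inv, mul_inv_cancel]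
    have hra : ρ r = ρ a ^ e := by
      rw [map_mul, map_inv, mul_inv_eq_one, map_zpow] at hcomm
      rw [← hcomm]
      congr 1
      exact Subtype.ext (by rw [hr, hv]; rfl)
    have hax : ρ a ∈ MulAction.stabilizer (GLd 2) x := by
      rw [MulAction.mem_stabilizer_iff]
      change (ρ a : Module.End ℂ (PolyLT 2)) x = x
      rw [hφ, LinearMap.mem_ker.1 hx, zero_smul, add_zero]
    rw [hra]
    exact MulAction.mem_stabilizer_iff.1 (Subgroup.zpow_mem _ hax e)
  rw [reflCount, Nat.card_eq_zero]
  exact Or.inl inferInstance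

/-! ### The braid group is determined by the reflections -/

lemma eq_of_image_cls_eq {f : P.W ≃* Q.W} {i i' j : JGen} (hi : 2 ≤ P.ord i)
    (h : f '' P.cls i = Q.cls j) (h' : f '' P.cls i' = Q.cls j) : i = i' := by
  have h1 : P.cls i = P.cls i' := f.injective.image_injective (h.trans h'.symm)
  exact P.cls_disjoint (P.reflW_mem_cls hi) (h1 ▸ P.reflW_mem_cls hi)

lemma image_R_of_cls {f : P.W ≃* Q.W} {π : JGen → JGen} (hπ : ∀ i, π (π i) = i)
    (hf : ∀ i, f '' P.cls i = Q.cls (π i)) : f '' P.R = Q.R := by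
  have h1 : ∀ P : JReflectionData, P.R = ⋃ i, P.cls i := fun P => by
    ext h
    rw [mem_R_iff, Set.mem_iUnion]
  rw [h1, h1, Set.image_iUnion]
  refine (Set.iUnion_congr hf).trans (Function.Surjective.iUnion_comp ?_ _)
  exact fun i => ⟨π i, hπ i⟩

instance : Finite JGen :=
  Finite.of_surjective ![JGen.s, JGen.t, JGen.u] fun i => by
    cases i
    exacts [⟨0, rfl⟩, ⟨1, rfl⟩, ⟨2, rfl⟩]

/-- Three non-empty classes have three distinct images among the three classes of `Q`, so none of
these is empty. -/
lemma two_le_ord_of_image {f : P.W ≃* Q.W} (hf : f '' P.R = Q.R) (hb : P.b ≠ 1) (hc : P.c ≠ 1)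
    (j : JGen) : 2 ≤ Q.ord j := by
  have hord : ∀ i, 2 ≤ P.ord i := by
    have h1 := P.b_pos
    have h2 := P.c_pos
    rintro (_ | _ | _)
    · exact P.two_le_k
    · change 2 ≤ P.b
      omega
    · change 2 ≤ P.c
      omega
  choose π hπ hπ' using fun i => exists_image_cls hf (hord i)
  have hinj : Function.Injective π := fun i i' h =>
    eq_of_image_cls_eq (hord i) (hπ i) (h ▸ hπ i')
  obtain ⟨i, rfl⟩ := Finite.injective_iff_surjective.1 hinj j
  exact hπ' i

lemma two_classes {f : P.W ≃* Q.W} (hf : f '' P.R = Q.R) (hQ : Q.c = 1) (hb : P.b ≠ 1) :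
    (f '' P.cls .s = Q.cls .s ∧ f '' P.cls .t = Q.cls .t) ∨
      (f '' P.cls .s = Q.cls .t ∧ f '' P.cls .t = Q.cls .s) := by
  have hs : 2 ≤ P.ord .s := P.two_le_k
  have ht : 2 ≤ P.ord .t := by
    have := P.b_pos
    change 2 ≤ P.b
    omega
  have hQu : ¬ 2 ≤ Q.ord .u := by
    change ¬ 2 ≤ Q.c
    omega
  obtain ⟨i, hi, hi'⟩ := exists_image_cls hf hs
  obtain ⟨j, hj, hj'⟩ := exists_image_cls hf ht
  have hij : i ≠ j := fun h => by
    have := eq_of_image_cls_eq hs hi (h ▸ hj)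
    cases this
  cases i <;> cases j
  exacts [absurd rfl hij, Or.inl ⟨hi, hj⟩, absurd hj' hQu, Or.inr ⟨hi, hj⟩, absurd rfl hij,
    absurd hj' hQu, absurd hi' hQu, absurd hi' hQu, absurd rfl hij]

lemma two_le_b_of_image {f : P.W ≃* Q.W} (hf : f '' P.R = Q.R) (hQ : Q.c = 1) (hb : P.b ≠ 1) :
    Q.b ≠ 1 := by
  intro h
  have ht : 2 ≤ P.ord .t := by
    have := P.b_pos
    change 2 ≤ P.b
    omega
  have hQt : Q.cls .t = ∅ := Q.cls_empty h
  rcases two_classes hf hQ hb with ⟨-, h1⟩ | ⟨h1, -⟩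
  · have := h1 ▸ Set.mem_image_of_mem f (P.reflW_mem_cls ht)
    rw [hQt] at this
    exact this
  · have := h1 ▸ Set.mem_image_of_mem f (P.reflW_mem_cls (i := .s) P.two_le_k)
    rw [hQt] at this
    exact this

lemma image_cls_u {f : P.W ≃* Q.W} (hP : P.c = 1) (hQ : Q.c = 1) :
    f '' P.cls .u = Q.cls .u := by
  rw [P.cls_empty (i := .u) hP, Q.cls_empty (i := .u) hQ, Set.image_empty]

/-- The two counts in dimension 2 give b(bn-1)(m-1)(k-1) and (n-1)(m-1)(k-1). Subtracting b² times
the second from the first eliminates n and leaves b(b-1)(m-1)(k-1); b and k are already known as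
orders of reflections, and b ≥ 2. -/
lemma m_eq_of_image {f : P.W ≃* Q.W} (hP : P.c = 1) (hQ : Q.c = 1) (hb : P.b ≠ 1)
    (hs : f '' P.cls .s = Q.cls .s) (ht : f '' P.cls .t = Q.cls .t) : P.m = Q.m := by
  have hb2 : 2 ≤ P.b := by have := P.b_pos; omega
  have hk : P.k = Q.k := ord_eq_of_image (i := .s) P.two_le_k hs
  have hbb : P.b = Q.b := ord_eq_of_image (i := .t) hb2 ht
  have hu : f '' P.cls .u = Q.cls .u := image_cls_u hP hQ
  have e1 := reflCount_congr f hs hu 2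
  have e2 := reflCount_congr f hs (by rw [Set.image_union, ht, hu] :
    f '' (P.cls .t ∪ P.cls .u) = Q.cls .t ∪ Q.cls .u) 2
  have a1 := reflCount_cls_u_two (P := P)
  have a2 := reflCount_cls_tu_two (P := P)
  rw [e1, reflCount_cls_u_two, ← hk, ← hbb] at a1
  rw [e2, reflCount_cls_tu_two, ← hk] at a2
  have hk0 := P.k_sub_one_ne_zero
  have hb0 : (P.b : ℤ) ≠ 0 := by exact_mod_cast P.b_pos.ne'
  have hb1 : (P.b : ℤ) * (P.b - 1) ≠ 0 := mul_ne_zero hb0 (by omega)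
  have h3 : (P.b * (P.b - 1) * (P.k - 1) : ℤ) * (Q.m - 1) =
      (P.b * (P.b - 1) * (P.k - 1)) * (P.m - 1) := by
    linear_combination a1 - (P.b * P.b : ℤ) * a2
  have h4 := mul_left_cancel₀ (mul_ne_zero hb1 hk0) h3
  omega

/-- Dimension 2 yields (n-1)(m-1) and dimension 3 then yields (n-2)(m-2). Their difference gives n +
m, so the product is known too, and the unordered pair is determined. -/
lemma eq_or_eq_swap_of_image {f : P.W ≃* Q.W} (hPb : P.b = 1) (hPc : P.c = 1) (hQb : Q.b = 1)
    (hQc : Q.c = 1) (hs : f '' P.cls .s = Q.cls .s) :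
    (P.n = Q.n ∧ P.m = Q.m) ∨ (P.n = Q.m ∧ P.m = Q.n) := by
  have hk : P.k = Q.k := ord_eq_of_image (i := .s) P.two_le_k hs
  have hu : f '' P.cls .u = Q.cls .u := image_cls_u hPc hQc
  have ht : f '' P.cls .t = Q.cls .t := by
    rw [P.cls_empty (i := .t) hPb, Q.cls_empty (i := .t) hQb, Set.image_empty]
  have hY : f '' (P.cls .t ∪ P.cls .u) = Q.cls .t ∪ Q.cls .u := by rw [Set.image_union, ht, hu]
  have a1 := reflCount_cls_tu_two (P := P)
  have a2 := reflCount_cls_tu_three (P := P)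
  rw [reflCount_congr f hs hY, reflCount_cls_tu_two, ← hk] at a1
  rw [reflCount_congr f hs hY, reflCount_cls_tu_three, ← hk, a1] at a2
  have hk0 := P.k_sub_one_ne_zero
  have hn0 : (P.n : ℤ) - 1 ≠ 0 := by
    have := P.two_le_bn
    rw [hPb, one_mul] at this
    omega
  have hm0 : (P.m : ℤ) - 1 ≠ 0 := by
    have := P.two_le_cm
    rw [hPc, one_mul] at this
    omega
  have a3 := mul_right_cancel₀ hk0 a1
  have a4 := mul_left_cancel₀ (mul_ne_zero (mul_ne_zero hn0 hm0) hk0) a2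
  have h1 : (P.n : ℤ) + P.m = Q.n + Q.m := by linear_combination a4 - a3
  have h2 : ((P.n : ℤ) - Q.n) * (P.n - Q.m) = 0 := by
    linear_combination (P.n : ℤ) * h1 - h1 + a3
  rcases mul_eq_zero.1 h2 with h3 | h3
  · exact Or.inl (by omega)
  · exact Or.inr (by omega)

/-- The count (n-1)(m-1)(k-1) for the class of s becomes a count for the class of t with s killed,
which is zero; as m and k are at least 2, n = 1. -/
lemma n_eq_one_of_image {f : P.W ≃* Q.W} (hPc : P.c = 1) (hQc : Q.c = 1) (hQb : Q.b ≠ 1)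
    (hs : f '' P.cls .s = Q.cls .t) (ht : f '' P.cls .t = Q.cls .s) : P.n = 1 := by
  have hb2 : 2 ≤ Q.b := by have := Q.b_pos; omega
  have a1 := reflCount_cls_tu_two (P := P)
  rw [reflCount_congr f hs (by rw [Set.image_union, ht, image_cls_u hPc hQc] :
    f '' (P.cls .t ∪ P.cls .u) = Q.cls .s ∪ Q.cls .u),
    reflCount_cls_t_eq_zero hb2 Set.subset_union_left, Nat.cast_zero, mul_zero] at a1
  have hk0 := P.k_sub_one_ne_zero
  have hm0 : (P.m : ℤ) - 1 ≠ 0 := by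
    have := P.two_le_cm
    rw [hPc, one_mul] at this
    omega
  have h1 := (mul_eq_zero.1 ((mul_eq_zero.1 a1.symm).resolve_right hk0)).resolve_right hm0
  omega

lemma nonempty_braidGroup_of_c_eq_one {f : P.W ≃* Q.W} (hf : f '' P.R = Q.R) (hPc : P.c = 1)
    (hQc : Q.c = 1) : Nonempty (P.braidGroup ≃* Q.braidGroup) := by
  by_cases hPb : P.b = 1
  · have hQb : Q.b = 1 := by
      by_contra h
      exact two_le_b_of_image (image_symm_R hf) hPc h hPb
    have hs : f '' P.cls .s = Q.cls .s := by
      obtain ⟨j, hj, hj'⟩ := exists_image_cls (i := .s) hf P.two_le_k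
      cases j
      · exact hj
      · have h1 : 2 ≤ Q.b := hj'
        omega
      · have h1 : 2 ≤ Q.c := hj'
        omega
    obtain ⟨e₁⟩ := P.braidGroup_toric hPb hPc
    obtain ⟨e₂⟩ := Q.braidGroup_toric hQb hQc
    rcases eq_or_eq_swap_of_image hPb hPc hQb hQc hs with ⟨hn, hm⟩ | ⟨hn, hm⟩
    · rw [← hn, ← hm] at e₂
      exact ⟨e₁.trans e₂.symm⟩
    · rw [← hn, ← hm] at e₂
      obtain ⟨e₃⟩ := nonempty_torusRels_swap P.n P.m
      exact ⟨e₁.trans (e₃.trans e₂.symm)⟩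
  · have hQb := two_le_b_of_image hf hQc hPb
    have hm : P.m = Q.m := by
      rcases two_classes hf hQc hPb with ⟨hs, ht⟩ | ⟨hs, ht⟩
      · exact m_eq_of_image hPc hQc hPb hs ht
      · have hn := n_eq_one_of_image hPc hQc hQb hs ht
        have hb2 : 2 ≤ P.b := by have := P.b_pos; omega
        have hk2 := P.two_le_k
        -- As n = 1, the first two columns can be exchanged without changing m. Composing with that
        -- exchange reduces to the case where `f` preserves both classes.
        let P' : JReflectionData := ⟨P.b, P.k, 1, P.c, P.m, hb2, by omega, P.two_le_cm,
          Nat.coprime_one_left _⟩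
        obtain ⟨g, hg⟩ := exists_swapST_equiv (P := P') (Q := P) rfl hn rfl rfl rfl rfl
        have hs' : (g.trans f) '' P'.cls .s = Q.cls .s := by
          rw [MulEquiv.coe_trans, Set.image_comp, hg]
          exact ht
        have ht' : (g.trans f) '' P'.cls .t = Q.cls .t := by
          rw [MulEquiv.coe_trans, Set.image_comp, hg]
          exact hs
        exact m_eq_of_image (P := P') hPc hQc (by change P.k ≠ 1; omega) hs' ht'
    obtain ⟨e₁⟩ := P.braidGroup_lower hPb hPc
    obtain ⟨e₂⟩ := Q.braidGroup_lower hQb hQc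
    rw [← hm] at e₂
    exact ⟨e₁.trans e₂.symm⟩

lemma exists_c_eq_one (h : P.b = 1 ∨ P.c = 1) :
    ∃ P' : JReflectionData, P'.c = 1 ∧ Nonempty (P.braidGroup ≃* P'.braidGroup) ∧
      ∃ f : P.W ≃* P'.W, f '' P.R = P'.R := by
  rcases h with h | h
  · obtain ⟨f, hf⟩ := P.exists_swap_equiv
    exact ⟨P.swap, h, P.braidGroup_swap, f, image_R_of_cls (fun i => by cases i <;> rfl) hf⟩
  · exact ⟨P, h, ⟨MulEquiv.refl _⟩, MulEquiv.refl _, Set.image_id _⟩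

lemma b_eq_one_or_c_eq_one_of_image {f : P.W ≃* Q.W} (hf : f '' P.R = Q.R)
    (h : P.b = 1 ∨ P.c = 1) : Q.b = 1 ∨ Q.c = 1 := by
  by_contra! hQ
  have h1 := two_le_ord_of_image (image_symm_R hf) hQ.1 hQ.2
  have hb : 2 ≤ P.b := h1 .t
  have hc : 2 ≤ P.c := h1 .u
  omega

lemma nonempty_braidGroup_equiv {f : P.W ≃* Q.W} (hf : f '' P.R = Q.R) :
    Nonempty (P.braidGroup ≃* Q.braidGroup) := by
  by_cases h : P.b = 1 ∨ P.c = 1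
  · obtain ⟨P', hP', ⟨e₁⟩, f₁, hf₁⟩ := exists_c_eq_one h
    obtain ⟨Q', hQ', ⟨e₂⟩, f₂, hf₂⟩ := exists_c_eq_one (b_eq_one_or_c_eq_one_of_image hf h)
    obtain ⟨e⟩ := nonempty_braidGroup_of_c_eq_one (f := f₁.symm.trans (f.trans f₂)) (by
      rw [MulEquiv.coe_trans, MulEquiv.coe_trans, Set.image_comp, Set.image_comp,
        image_symm_R hf₁, hf, hf₂]) hP' hQ'
    exact ⟨e₁.trans (e.trans e₂.symm)⟩
  · have h' : ¬ (Q.b = 1 ∨ Q.c = 1) := fun h1 =>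
      h (b_eq_one_or_c_eq_one_of_image (image_symm_R hf) h1)
    push Not at h h'
    obtain ⟨e₁⟩ := P.braidGroup_both h.1 h.2
    obtain ⟨e₂⟩ := Q.braidGroup_both h'.1 h'.2
    exact ⟨e₁.trans e₂.symm⟩

end JReflectionData

end JBraid

theorem theorem3p19 (P₁ P₂ : JBraid.JReflectionData)
    (h : JBraid.JReflectionData.IsomorphicInReflection P₁ P₂) :
    Nonempty (P₁.braidGroup ≃* P₂.braidGroup) := by
  obtain ⟨f, hf⟩ := h
  exact JBraid.JReflectionData.nonempty_braidGroup_equiv hf
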